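/- **Theorem (exact Fourier inversion formula).** Let $(X,g)$ be a smooth (Hausdorff, finite-dimensional, boundaryless) Riemannian manifold with Levi-Civita connection $\nabla_g$. Let $E$ be the complexification of $S^{\lambda}T_X\otimes_{\mathbb R}S^{\mu}T_X^*$, where $S^\lambda,S^\mu$ are the Schur powers attached to two Young diagrams $\lambda,\mu$ (images of Young symmetrizers in tensor powers), and let $(F,h_F)$ be a smooth Hermitian vector bundle over $X$. Write $\nabla_g$ also for the induced connection on the bundles $(T_X^*)^{\otimes k}\otimes_{\mathbb R}E$. Let $p\le 2$ and let $A=\sum_{r=0}^{p}A_r\nabla_g^{p-r}$ be a differential operator of order $p$ from $E$ to $F$, where $A_r\in C^\infty(X,S^{p-r}T_X\otimes_{\mathbb R}\mathrm{Hom}_{\mathbb R}(E,F))$ is regarded as a symmetric real-linear map $(T_X^*)^{\otimes(p-r)}\otimes_{\mathbb R} E\to F$. Its total symbol is given, for $\eta\in T^*_{X,x}$ and $e\in E_x$, by $$a(\eta)\,e=\sum_{r=0}^{p}A_r\bigl(\eta^{\otimes(p-r)}\otimes(2\pi i)^{p-r}e\bigr)\in F_x .$$ (If the $A_r$ are complex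 linear in $E$, this is $\sum_r(2\pi i)^{p-r}A_r(\eta^{\otimes(p-r)}\otimes e)$.) For $x\in X$, let $\mathrm{Cut}(x)$ be the cut locus of $x$, i.e. the set of points $\exp_x\xi$, $\xi\ne0$, such that the geodesic $t\mapsto\exp_x(t\xi)$ is minimizing on $[0,1]$ but on no $[0,t]$ with $t>1$. Let $D_x\subset T_{X,x}$ be the connected component of $0$ in the set of all $\xi$ in the domain of $\exp_x$ with $\exp_x\xi\notin\mathrm{Cut}(x)$ (if $X$ is complete and connected, this is the domain which $\exp_x$ maps diffeomorphically onto $X\smallsetminus\mathrm{Cut}(x)$). For $\xi\in D_x$ let $\tau_x^E:E_{\exp_x\xi}\to E_x$ be the parallel transport along the geodesic $t\mapsto\exp_x(t\xi)$. Let $\chi:[0,\infty)\to[0,1]$ be a smooth function with $\chi=1$ on $[0,1]$ and $\chi=0$ on $[2,\infty)$, let $\varepsilon_x>0$ be such that $\{|\xi|_{g_x}\le2\varepsilon_x\}\subset D_x$, and set $\chi_x(\xi)=\chi(|\xi|_{g_x}/\varepsilon_x)$. Then for every $u\in C^\infty(X,E)$ and every $x\in X$ the following integrals converge absolutely (the inner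 one for every $\eta$) and $$Au(x)=\int_{\eta\in T^*_{X,x}}a(\eta)\left(\int_{\xi\in D_x}\tau_x^E\bigl(u(\exp_x\xi)\bigr)\,e^{-2\pi i\,\eta\cdot\xi}\,\chi_x(\xi)\,dV_{g_x}(\xi)\right)dV_{g_x^*}(\eta),$$ where $dV_{g_x}$ and $dV_{g_x^*}$ are the Euclidean volumes on $T_{X,x}$ and $T^*_{X,x}$. -/

import Mathlib

open scoped Manifold ContDiff
open MeasureTheory

noncomputable section

namespace FourierInversion

/-! ### Tensors, Young symmetrizers and Schur powers of a vector space -/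

section Algebra

/-- The cells of a Young diagram; they index the tensor slots of the corresponding Schur power. -/
abbrev Cells (d : YoungDiagram) : Type := {c : ℕ × ℕ // c ∈ d.cells}

/-- Permutations of the cells preserving every row. -/
def rowGroup (d : YoungDiagram) : Finset (Equiv.Perm (Cells d)) :=
  Finset.univ.filter fun s => ∀ c, (s c).1.1 = c.1.1

/-- Permutations of the cells preserving every column. -/
def colGroup (d : YoungDiagram) : Finset (Equiv.Perm (Cells d)) :=
  Finset.univ.filter fun s => ∀ c, (s c).1.2 = c.1.2

variable (lam mu : YoungDiagram)
variable (V : Type*) [NormedAddCommGroup V] [NormedSpace ℝ V]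
variable {W : Type*} [NormedAddCommGroup W] [NormedSpace ℝ W]

/-- Complex valued multilinear forms in `|mu|` vectors. -/
abbrev Cov : Type _ := ContinuousMultilinearMap ℝ (fun _ : Cells mu => V) ℂ

/-- The complexification of `V^{⊗|lam|} ⊗ (V*)^{⊗|mu|}`: complex valued multilinear forms in
`|lam|` covectors and `|mu|` vectors, the slots being indexed by the cells of the diagrams. -/
abbrev Tens : Type _ :=
  ContinuousMultilinearMap ℝ (fun _ : Cells lam => StrongDual ℝ V) (Cov mu V)

/-! Shortcut instances, all of them the standard ones. -/

instance : NormedAddCommGroup (Cov mu V) := inferInstance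
instance : AddCommGroup (Cov mu V) := inferInstance
instance : NormedSpace ℝ (Cov mu V) := inferInstance
instance : NormedSpace ℂ (Cov mu V) := inferInstance
instance : Module ℝ (Cov mu V) := inferInstance
instance : Module ℂ (Cov mu V) := inferInstance
instance : SMulCommClass ℝ ℂ (Cov mu V) := inferInstance
instance : IsScalarTower ℝ ℂ (Cov mu V) := inferInstance
instance : ContinuousConstSMul ℂ (Cov mu V) := inferInstance
instance : NormedAddCommGroup (Tens lam mu V) := inferInstance
instance : AddCommGroup (Tens lam mu V) := inferInstance
instance : NormedSpace ℝ (Tens lam mu V) := inferInstance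
instance : NormedSpace ℂ (Tens lam mu V) := inferInstance
instance : Module ℝ (Tens lam mu V) := inferInstance
instance : Module ℂ (Tens lam mu V) := inferInstance
instance : SMulCommClass ℝ ℂ (Tens lam mu V) := inferInstance
instance : IsScalarTower ℝ ℂ (Tens lam mu V) := inferInstance

variable {lam mu V}

/-- The value at `(θ, v)` of the tensor obtained from `w` by applying the Young symmetrizer
`∑_{p ∈ rows} ∑_{q ∈ columns} sign(q) p q` of `lam` in the contravariant slots and that of `mu` in
the covariant slots. -/
def youngSum (w : Tens lam mu V) (θ : Cells lam → StrongDual ℝ V) (v : Cells mu → V) : ℂ :=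
  ∑ p ∈ rowGroup lam, ∑ q ∈ colGroup lam, ∑ p' ∈ rowGroup mu, ∑ q' ∈ colGroup mu,
    ((Equiv.Perm.sign q : ℤ) : ℂ) * ((Equiv.Perm.sign q' : ℤ) : ℂ) *
      w (fun c => θ ((p * q) c)) (fun c => v ((p' * q') c))

theorem youngSum_add (a b : Tens lam mu V) (θ : Cells lam → StrongDual ℝ V) (v : Cells mu → V) :
    youngSum (a + b) θ v = youngSum a θ v + youngSum b θ v := by
  simp only [youngSum, ← Finset.sum_add_distrib, ← mul_add]
  rfl

theorem youngSum_zero (θ : Cells lam → StrongDual ℝ V) (v : Cells mu → V) :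
    youngSum (0 : Tens lam mu V) θ v = 0 :=
  Finset.sum_eq_zero fun _ _ => Finset.sum_eq_zero fun _ _ => Finset.sum_eq_zero fun _ _ =>
    Finset.sum_eq_zero fun _ _ => mul_zero _

theorem youngSum_smul (c : ℂ) (a : Tens lam mu V) (θ : Cells lam → StrongDual ℝ V)
    (v : Cells mu → V) : youngSum (c • a) θ v = c * youngSum a θ v := by
  simp only [youngSum, Finset.mul_sum, mul_left_comm c]
  rfl

variable (lam mu V)

/-- The complexification of `S^lam V ⊗ S^mu V*`: the image of the Young symmetrizers. -/
def schur : Submodule ℂ (Tens lam mu V) where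
  carrier := {w | ∃ w₀ : Tens lam mu V, ∀ θ v, w θ v = youngSum w₀ θ v}
  add_mem' := by
    rintro a b ⟨a₀, ha⟩ ⟨b₀, hb⟩
    exact ⟨a₀ + b₀, fun θ v =>
      (congrArg₂ (· + ·) (ha θ v) (hb θ v)).trans (youngSum_add a₀ b₀ θ v).symm⟩
  zero_mem' := ⟨0, fun θ v => (youngSum_zero θ v).symm⟩
  smul_mem' := by
    rintro c a ⟨a₀, ha⟩
    exact ⟨c • a₀, fun θ v => (congrArg (c * ·) (ha θ v)).trans (youngSum_smul c a₀ θ v).symm⟩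

/-- The complex vector space `(S^lam V ⊗ S^mu V*) ⊗ ℂ`. -/
abbrev Schur : Type _ := schur lam mu V

/-- The space `(V*)^{⊗k} ⊗ (S^lam V ⊗ S^mu V*) ⊗ ℂ`. -/
abbrev KSchur (k : ℕ) : Type _ :=
  ContinuousMultilinearMap ℝ (fun _ : Fin k => V) (Schur lam mu V)

instance : NormedAddCommGroup (Schur lam mu V) := inferInstance
instance : AddCommGroup (Schur lam mu V) := inferInstance
instance : AddMonoid (Schur lam mu V) := inferInstance
instance : AddCommMonoid (Schur lam mu V) := inferInstance
instance : AddGroup (Schur lam mu V) := inferInstance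
instance : NormedSpace ℝ (Schur lam mu V) := Submodule.normedSpace _
instance : NormedSpace ℂ (Schur lam mu V) := Submodule.normedSpace _
instance : Module ℝ (Schur lam mu V) := Submodule.module' _
instance : Module ℂ (Schur lam mu V) := inferInstance
instance (k : ℕ) : NormedAddCommGroup (KSchur lam mu V k) := inferInstance
instance (k : ℕ) : AddCommGroup (KSchur lam mu V k) := inferInstance
instance (k : ℕ) : AddMonoid (KSchur lam mu V k) := inferInstance
instance (k : ℕ) : AddCommMonoid (KSchur lam mu V k) := inferInstance
instance (k : ℕ) : AddGroup (KSchur lam mu V k) := inferInstance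
instance (k : ℕ) : NormedSpace ℝ (KSchur lam mu V k) := inferInstance
instance (k : ℕ) : Module ℝ (KSchur lam mu V k) := inferInstance

variable {lam mu V}

/-- Transport of tensors along an isomorphism `P : V → W` with inverse `Q`. -/
def tensMap (P : V →L[ℝ] W) (Q : W →L[ℝ] V) : Tens lam mu V →L[ℝ] Tens lam mu W :=
  (ContinuousLinearMap.compContinuousMultilinearMapL ℝ (fun _ : Cells lam => StrongDual ℝ W)
      (ContinuousMultilinearMap ℝ (fun _ : Cells mu => V) ℂ)
      (ContinuousMultilinearMap ℝ (fun _ : Cells mu => W) ℂ)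
      (ContinuousMultilinearMap.compContinuousLinearMapL fun _ : Cells mu => Q)).comp
    (ContinuousMultilinearMap.compContinuousLinearMapL
      fun _ : Cells lam => (ContinuousLinearMap.compL ℝ V W ℝ).flip P)

theorem tensMap_apply (P : V →L[ℝ] W) (Q : W →L[ℝ] V) (w : Tens lam mu V)
    (θ : Cells lam → StrongDual ℝ W) (v : Cells mu → W) :
    tensMap P Q w θ v = w (fun c => (θ c).comp P) (fun c => Q (v c)) := rfl

/-- The derivation `(slotSum a M)(v₁, …, vₖ) = ∑ i, M(v₁, …, a vᵢ, …, vₖ)`. -/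
def slotSum {ι : Type*} [Fintype ι] [DecidableEq ι] {G : Type*} [NormedAddCommGroup G]
    [NormedSpace ℝ G] (a : V →L[ℝ] V) :
    ContinuousMultilinearMap ℝ (fun _ : ι => V) G →L[ℝ]
      ContinuousMultilinearMap ℝ (fun _ : ι => V) G :=
  ∑ i, ContinuousMultilinearMap.compContinuousLinearMapL
    (Function.update (fun _ : ι => ContinuousLinearMap.id ℝ V) i a)

theorem slotSum_apply {ι : Type*} [Fintype ι] [DecidableEq ι] {G : Type*} [NormedAddCommGroup G]
    [NormedSpace ℝ G] (a : V →L[ℝ] V) (M : ContinuousMultilinearMap ℝ (fun _ : ι => V) G)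
    (v : ι → V) : slotSum a M v = ∑ i, M (Function.update v i (a (v i))) := by
  simp only [slotSum, _root_.sum_apply]
  refine Finset.sum_congr rfl fun i _ => ?_
  simp only [ContinuousMultilinearMap.compContinuousLinearMapL_apply,
    ContinuousMultilinearMap.compContinuousLinearMap_apply]
  congr 1
  funext j
  by_cases h : j = i
  · subst h; simp
  · simp [h]

/-- The action of an endomorphism of `V` on tensors, as a derivation: `a` acts on the contravariant
slots and minus its transpose on the covariant ones. -/
def tensAct (a : V →L[ℝ] V) : Tens lam mu V →L[ℝ] Tens lam mu V :=
  slotSum ((ContinuousLinearMap.compL ℝ V V ℝ).flip a) -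
    ContinuousLinearMap.compContinuousMultilinearMapL ℝ (fun _ : Cells lam => StrongDual ℝ V)
      (ContinuousMultilinearMap ℝ (fun _ : Cells mu => V) ℂ)
      (ContinuousMultilinearMap ℝ (fun _ : Cells mu => V) ℂ) (slotSum a)

theorem tensAct_apply (a : V →L[ℝ] V) (w : Tens lam mu V) (θ : Cells lam → StrongDual ℝ V)
    (v : Cells mu → V) :
    tensAct a w θ v = ∑ c, w (Function.update θ c ((θ c).comp a)) v -
      ∑ c, w θ (Function.update v c (a (v c))) := by
  simp only [tensAct, _root_.sub_apply, _root_.sub_apply,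
    slotSum_apply, _root_.sum_apply]
  congr 1
  change slotSum a (w θ) v = _
  rw [slotSum_apply]

theorem tensMap_mem (P : V →L[ℝ] W) (Q : W →L[ℝ] V) {w : Tens lam mu V}
    (hw : w ∈ schur lam mu V) : tensMap P Q w ∈ schur lam mu W := by
  obtain ⟨w₀, hw₀⟩ := hw
  refine ⟨tensMap P Q w₀, fun θ v => ?_⟩
  rw [tensMap_apply, hw₀]
  rfl

theorem update_comp_perm {ι A : Type*} [DecidableEq ι] (s : Equiv.Perm ι) (θ : ι → A) (c : ι)
    (y : A) : Function.update (fun i => θ (s i)) c y = fun i => Function.update θ (s c) y (s i) := by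
  funext i
  by_cases h : i = c
  · subst h; simp
  · simp [h]

theorem tensAct_perm (a : V →L[ℝ] V) (w : Tens lam mu V) (θ : Cells lam → StrongDual ℝ V)
    (v : Cells mu → V) (s : Equiv.Perm (Cells lam)) (s' : Equiv.Perm (Cells mu)) :
    tensAct a w (fun c => θ (s c)) (fun c => v (s' c)) =
      ∑ c, w (fun i => Function.update θ c ((θ c).comp a) (s i)) (fun i => v (s' i)) -
      ∑ c, w (fun i => θ (s i)) (fun i => Function.update v c (a (v c)) (s' i)) := by
  rw [tensAct_apply]
  simp only [update_comp_perm]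
  congr 1
  · exact Equiv.sum_comp s fun c =>
      w (fun i => Function.update θ c ((θ c).comp a) (s i)) (fun i => v (s' i))
  · exact Equiv.sum_comp s' fun c =>
      w (fun i => θ (s i)) (fun i => Function.update v c (a (v c)) (s' i))

theorem tensAct_mem (a : V →L[ℝ] V) {w : Tens lam mu V}
    (hw : w ∈ schur lam mu V) : tensAct a w ∈ schur lam mu V := by
  obtain ⟨w₀, hw₀⟩ := hw
  refine ⟨tensAct a w₀, fun θ v => ?_⟩
  rw [tensAct_apply]
  simp only [hw₀, youngSum, tensAct_perm, mul_sub, Finset.mul_sum, Finset.sum_sub_distrib]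
  congr 1
  · rw [Finset.sum_comm]
    refine Finset.sum_congr rfl fun p _ => ?_
    rw [Finset.sum_comm]
    refine Finset.sum_congr rfl fun q _ => ?_
    rw [Finset.sum_comm]
    refine Finset.sum_congr rfl fun p' _ => ?_
    rw [Finset.sum_comm]
  · rw [Finset.sum_comm]
    refine Finset.sum_congr rfl fun p _ => ?_
    rw [Finset.sum_comm]
    refine Finset.sum_congr rfl fun q _ => ?_
    rw [Finset.sum_comm]
    refine Finset.sum_congr rfl fun p' _ => ?_
    rw [Finset.sum_comm]

/-- Transport of elements of `(S^lam V ⊗ S^mu V*) ⊗ ℂ` along an isomorphism `P` with inverse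
`Q`. -/
def schurMap (P : V →L[ℝ] W) (Q : W →L[ℝ] V) : Schur lam mu V →L[ℝ] Schur lam mu W where
  toFun w := ⟨tensMap P Q w.1, tensMap_mem P Q w.2⟩
  map_add' w w' := Subtype.ext (map_add (tensMap P Q) w.1 w'.1)
  map_smul' c w := Subtype.ext (map_smul (tensMap P Q) c w.1)
  cont := ((tensMap P Q).continuous.comp continuous_subtype_val).subtype_mk _

/-- The action of an endomorphism of `V` on `(S^lam V ⊗ S^mu V*) ⊗ ℂ` as a derivation. -/
def schurAct (a : V →L[ℝ] V) : Schur lam mu V →L[ℝ] Schur lam mu V where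
  toFun w := ⟨tensAct a w.1, tensAct_mem a w.2⟩
  map_add' w w' := Subtype.ext (map_add (tensAct a) w.1 w'.1)
  map_smul' c w := Subtype.ext (map_smul (tensAct a) c w.1)
  cont := ((tensAct a).continuous.comp continuous_subtype_val).subtype_mk _

/-- Transport of elements of `(V*)^{⊗k} ⊗ (S^lam V ⊗ S^mu V*) ⊗ ℂ` along an isomorphism `P` with
inverse `Q`. -/
def kMap {k : ℕ} (P : V →L[ℝ] W) (Q : W →L[ℝ] V) (M : KSchur lam mu V k) : KSchur lam mu W k :=
  (schurMap P Q).compContinuousMultilinearMap (M.compContinuousLinearMap fun _ => Q)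

/-- The action of an endomorphism of `V` on `(V*)^{⊗k} ⊗ (S^lam V ⊗ S^mu V*) ⊗ ℂ`. -/
def kAct {k : ℕ} (a : V →L[ℝ] V) (M : KSchur lam mu V k) : KSchur lam mu V k :=
  (schurAct a).compContinuousMultilinearMap M - slotSum a M

/-- The element `η^{⊗k} ⊗ e` of `(V*)^{⊗k} ⊗ (S^lam V ⊗ S^mu V*) ⊗ ℂ`. -/
def powTensor (k : ℕ) (η : StrongDual ℝ V) (e : Schur lam mu V) : KSchur lam mu V k :=
  ((ContinuousMultilinearMap.mkPiAlgebra ℝ (Fin k) ℝ).compContinuousLinearMap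
    fun _ => η).smulRight e

theorem kMap_add {k : ℕ} (P : V →L[ℝ] W) (Q : W →L[ℝ] V) (M N : KSchur lam mu V k) :
    kMap P Q (M + N) = kMap P Q M + kMap P Q N := by
  ext1 v
  exact map_add (schurMap P Q) (M fun i => Q (v i)) (N fun i => Q (v i))

theorem kMap_smul {k : ℕ} (P : V →L[ℝ] W) (Q : W →L[ℝ] V) (r : ℝ) (M : KSchur lam mu V k) :
    kMap P Q (r • M) = r • kMap P Q M := by
  ext1 v
  exact map_smul (schurMap P Q) r (M fun i => Q (v i))

theorem tensAct_add (a b : V →L[ℝ] V) (w : Tens lam mu V) :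
    tensAct (a + b) w = tensAct a w + tensAct b w := by
  ext θ v
  simp only [_root_.add_apply, tensAct_apply, ContinuousLinearMap.comp_add,
    ContinuousMultilinearMap.map_update_add, _root_.add_apply,
    Finset.sum_add_distrib]
  ring

theorem tensAct_smul (r : ℝ) (a : V →L[ℝ] V) (w : Tens lam mu V) :
    tensAct (r • a) w = r • tensAct a w := by
  ext θ v
  simp only [_root_.smul_apply, tensAct_apply, ContinuousLinearMap.comp_smul,
    ContinuousMultilinearMap.map_update_smul, _root_.smul_apply,
    Finset.smul_sum, smul_sub]

theorem kAct_add {k : ℕ} (a b : V →L[ℝ] V) (M : KSchur lam mu V k) :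
    kAct (a + b) M = kAct a M + kAct b M := by
  ext1 v
  have h : schurAct (a + b) (M v) = schurAct a (M v) + schurAct b (M v) :=
    Subtype.ext (tensAct_add a b (M v).1)
  simp only [kAct, _root_.sub_apply, _root_.add_apply,
    ContinuousLinearMap.compContinuousMultilinearMap_coe, Function.comp_apply, slotSum_apply,
    h, _root_.add_apply, ContinuousMultilinearMap.map_update_add,
    Finset.sum_add_distrib]
  abel

theorem kAct_smul {k : ℕ} (r : ℝ) (a : V →L[ℝ] V) (M : KSchur lam mu V k) :
    kAct (r • a) M = r • kAct a M := by
  ext1 v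
  have h : schurAct (r • a) (M v) = r • schurAct a (M v) :=
    Subtype.ext (tensAct_smul r a (M v).1)
  simp only [kAct, _root_.sub_apply, _root_.smul_apply,
    ContinuousLinearMap.compContinuousMultilinearMap_coe, Function.comp_apply, slotSum_apply,
    h, _root_.smul_apply, ContinuousMultilinearMap.map_update_smul,
    Finset.smul_sum, smul_sub]

end Algebra

/-! ### Riemannian geometry -/

/-- The Christoffel symbols of the first kind at `z` of a field `G` of bilinear forms on a vector
space: `(v, w, y) ↦ (∂_v G(w, y) + ∂_w G(v, y) - ∂_y G(v, w)) / 2`. -/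
def christoffelLower {H : Type*} [NormedAddCommGroup H] [NormedSpace ℝ H]
    (G : H → H →L[ℝ] H →L[ℝ] ℝ) (z v : H) : H →L[ℝ] H →L[ℝ] ℝ :=
  let dG : H →L[ℝ] H →L[ℝ] H →L[ℝ] ℝ := fderiv ℝ G z
  (1 / 2 : ℝ) • (dG v + dG.flip v - (dG.flip v).flip)

theorem christoffelLower_add {H : Type*} [NormedAddCommGroup H] [NormedSpace ℝ H]
    (G : H → H →L[ℝ] H →L[ℝ] ℝ) (z v w : H) :
    christoffelLower G z (v + w) = christoffelLower G z v + christoffelLower G z w := by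
  ext a b
  simp [christoffelLower]
  ring

theorem christoffelLower_smul {H : Type*} [NormedAddCommGroup H] [NormedSpace ℝ H]
    (G : H → H →L[ℝ] H →L[ℝ] ℝ) (z : H) (r : ℝ) (v : H) :
    christoffelLower G z (r • v) = r • christoffelLower G z v := by
  ext a b
  simp [christoffelLower]
  ring

/-- The isomorphism `V* → V` given by the inner product. -/
def sharp (V : Type*) [NormedAddCommGroup V] [InnerProductSpace ℝ V] [CompleteSpace V] :
    StrongDual ℝ V →L[ℝ] V where
  toFun := (InnerProductSpace.toDual ℝ V).symm
  map_add' := map_add _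
  map_smul' c η := map_smulₛₗ _ c η
  cont := (InnerProductSpace.toDual ℝ V).symm.continuous

/-- The endomorphism `L` of `V` with `⟨L w, y⟩ = B(P w, P y)`. -/
def raiseIndex (V : Type*) [NormedAddCommGroup V] [InnerProductSpace ℝ V] [CompleteSpace V]
    {H : Type*} [NormedAddCommGroup H] [NormedSpace ℝ H] (P : V →L[ℝ] H)
    (B : H →L[ℝ] H →L[ℝ] ℝ) : V →L[ℝ] V :=
  (sharp V).comp (B.bilinearComp P P)

theorem raiseIndex_add (V : Type*) [NormedAddCommGroup V] [InnerProductSpace ℝ V]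
    [CompleteSpace V] {H : Type*} [NormedAddCommGroup H] [NormedSpace ℝ H] (P : V →L[ℝ] H)
    (B C : H →L[ℝ] H →L[ℝ] ℝ) :
    raiseIndex V P (B + C) = raiseIndex V P B + raiseIndex V P C := by
  ext1 w
  exact map_add (sharp V) (B.bilinearComp P P w) (C.bilinearComp P P w)

theorem raiseIndex_smul (V : Type*) [NormedAddCommGroup V] [InnerProductSpace ℝ V]
    [CompleteSpace V] {H : Type*} [NormedAddCommGroup H] [NormedSpace ℝ H] (P : V →L[ℝ] H)
    (r : ℝ) (B : H →L[ℝ] H →L[ℝ] ℝ) : raiseIndex V P (r • B) = r • raiseIndex V P B := by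
  ext1 w
  exact map_smul (sharp V) r (B.bilinearComp P P w)

section Geometry

open Bundle

variable {H : Type*} [NormedAddCommGroup H] [NormedSpace ℝ H]
variable {X : Type*} [TopologicalSpace X] [ChartedSpace H X] [IsManifold 𝓘(ℝ, H) ∞ X]

/-- The identification `T_y X → H` given by the preferred chart at `c` (for `y` in its domain). -/
def toModel (c y : X) : TangentSpace 𝓘(ℝ, H) y →L[ℝ] H :=
  (trivializationAt H (TangentSpace 𝓘(ℝ, H)) c).continuousLinearMapAt ℝ y

/-- The inverse identification `H → T_y X` given by the preferred chart at `c`. -/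
def fromModel (c y : X) : H →L[ℝ] TangentSpace 𝓘(ℝ, H) y :=
  (trivializationAt H (TangentSpace 𝓘(ℝ, H)) c).symmL ℝ y

variable [RiemannianBundle (fun x : X => TangentSpace 𝓘(ℝ, H) x)]

instance instFiniteDimensionalTangent [FiniteDimensional ℝ H] (x : X) :
    FiniteDimensional ℝ (TangentSpace 𝓘(ℝ, H) x) :=
  inferInstanceAs (FiniteDimensional ℝ H)

instance instCompleteTangent [FiniteDimensional ℝ H] (x : X) :
    CompleteSpace (TangentSpace 𝓘(ℝ, H) x) :=
  FiniteDimensional.complete ℝ _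

instance instMeasurableTangent (x : X) : MeasurableSpace (TangentSpace 𝓘(ℝ, H) x) := borel _

instance instBorelTangent (x : X) : BorelSpace (TangentSpace 𝓘(ℝ, H) x) := ⟨rfl⟩

/-- The metric read in the preferred chart at `c`, as a function on the model space with values in
bilinear forms. -/
def metricInChart (c : X) (z : H) : H →L[ℝ] H →L[ℝ] ℝ :=
  (innerSL ℝ : TangentSpace 𝓘(ℝ, H) ((extChartAt 𝓘(ℝ, H) c).symm z) →L[ℝ]
      TangentSpace 𝓘(ℝ, H) ((extChartAt 𝓘(ℝ, H) c).symm z) →L[ℝ] ℝ).bilinearComp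
    (fromModel c _) (fromModel c _)

variable [FiniteDimensional ℝ H]

/-- The Christoffel symbols of the Levi-Civita connection at `x`, in the preferred chart at `x`:
`christoffel x v w = Γ(v, w)`, so that `∇_v W = D_v W + Γ(v, W)` in this chart. -/
def christoffel (x : X) (v : TangentSpace 𝓘(ℝ, H) x) :
    TangentSpace 𝓘(ℝ, H) x →L[ℝ] TangentSpace 𝓘(ℝ, H) x :=
  raiseIndex (TangentSpace 𝓘(ℝ, H) x) (by exact toModel x x)
    (christoffelLower (metricInChart x) (extChartAt 𝓘(ℝ, H) x x) (toModel x x v))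

theorem christoffel_add (x : X) (v w : TangentSpace 𝓘(ℝ, H) x) :
    christoffel x (v + w) = christoffel x v + christoffel x w := by
  rw [christoffel, map_add, christoffelLower_add, raiseIndex_add]
  rfl

theorem christoffel_smul (x : X) (r : ℝ) (v : TangentSpace 𝓘(ℝ, H) x) :
    christoffel x (r • v) = r • christoffel x v := by
  rw [christoffel, map_smul, christoffelLower_smul, raiseIndex_smul]
  rfl

/-! #### Geodesics, exponential map, cut locus -/

/-- The velocity of a curve. -/
def velocity (H : Type*) [NormedAddCommGroup H] [NormedSpace ℝ H] {X : Type*} [TopologicalSpace X]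
    [ChartedSpace H X] (γ : ℝ → X) (t : ℝ) : TangentSpace 𝓘(ℝ, H) (γ t) :=
  mfderiv 𝓘(ℝ, ℝ) 𝓘(ℝ, H) γ t (1 : ℝ)

variable (H) in
/-- `γ` is a smooth solution on `J` of the geodesic equation `∇_{γ'} γ' = 0`, the equation at time
`t` being written in the preferred chart at `γ t`. -/
def IsGeodesicOn (γ : ℝ → X) (J : Set ℝ) : Prop :=
  ∀ t ∈ J, ContMDiffAt 𝓘(ℝ, ℝ) 𝓘(ℝ, H) ∞ γ t ∧
    iteratedDeriv 2 (fun s => extChartAt 𝓘(ℝ, H) (γ t) (γ s)) t +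
      toModel (γ t) (γ t) (christoffel (γ t) (velocity H γ t) (velocity H γ t)) = 0

/-- `γ` is a geodesic with `γ 0 = x` and `γ' 0 = ξ`, defined on an open interval
containing `[0, 1]`. -/
def IsGeodesicFrom (x : X) (ξ : TangentSpace 𝓘(ℝ, H) x) (γ : ℝ → X) : Prop :=
  (∃ a b : ℝ, a < 0 ∧ 1 < b ∧ IsGeodesicOn H γ (Set.Ioo a b)) ∧
    (⟨γ 0, velocity H γ 0⟩ : TangentBundle 𝓘(ℝ, H) X) = ⟨x, ξ⟩

/-- The domain of the exponential map at `x`. -/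
def expDomain (x : X) : Set (TangentSpace 𝓘(ℝ, H) x) :=
  {ξ | ∃ γ : ℝ → X, IsGeodesicFrom x ξ γ}

open Classical in
/-- The geodesic `t ↦ exp_x(t ξ)`, for `t ∈ [0, 1]`, if `ξ` is in the domain of `exp_x`. -/
def geodesic (x : X) (ξ : TangentSpace 𝓘(ℝ, H) x) : ℝ → X :=
  if h : ∃ γ : ℝ → X, IsGeodesicFrom x ξ γ then h.choose else fun _ => x

/-- The Riemannian exponential map at `x` (meaningful on `expDomain x`). -/
def expMap (x : X) (ξ : TangentSpace 𝓘(ℝ, H) x) : X := geodesic x ξ 1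

/-- The geodesic `t ↦ exp_x(t ξ)` is defined and minimizing on `[0, 1]`. -/
def IsMinimizing (x : X) (ξ : TangentSpace 𝓘(ℝ, H) x) : Prop :=
  ξ ∈ expDomain x ∧ Manifold.riemannianEDist 𝓘(ℝ, H) x (expMap x ξ) = ‖ξ‖ₑ

variable (H) in
/-- The cut locus of `x`: the points `exp_x ξ` such that `t ↦ exp_x(t ξ)` is minimizing on `[0, 1]`
but on no larger interval `[0, t]`. -/
def cutLocus (x : X) : Set X :=
  {y | ∃ ξ : TangentSpace 𝓘(ℝ, H) x, ξ ≠ 0 ∧ IsMinimizing x ξ ∧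
    (∀ t : ℝ, 1 < t → ¬ IsMinimizing x (t • ξ)) ∧ expMap x ξ = y}

/-- The domain `D_x`: the connected component of `0` in the set of all `ξ` in the domain of `exp_x`
such that `exp_x ξ` is not in the cut locus of `x`. -/
def injDomain (x : X) : Set (TangentSpace 𝓘(ℝ, H) x) :=
  connectedComponentIn {ξ | ξ ∈ expDomain x ∧ expMap x ξ ∉ cutLocus H x} 0

/-! #### The bundle `E = (S^lam T_X ⊗ S^mu T_X^*) ⊗ ℂ` -/

variable (H) in
/-- The fibre `E_x` of the complexification of `S^lam T_X ⊗ S^mu T_X^*`. -/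
abbrev EFib (lam mu : YoungDiagram) (x : X) : Type _ := Schur lam mu (TangentSpace 𝓘(ℝ, H) x)

variable (H) in
/-- The fibre at `x` of `(T_X^*)^{⊗k} ⊗ E`. -/
abbrev KFib (lam mu : YoungDiagram) (k : ℕ) (x : X) : Type _ :=
  KSchur lam mu (TangentSpace 𝓘(ℝ, H) x) k

variable {lam mu : YoungDiagram}

variable (lam mu) in
/-- The identification `E_y → (S^lam H ⊗ S^mu H^*) ⊗ ℂ` given by the preferred chart at `c`. -/
def eToModel (c y : X) : EFib H lam mu y →L[ℝ] Schur lam mu H :=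
  schurMap (V := TangentSpace 𝓘(ℝ, H) y) (by exact toModel c y) (by exact fromModel c y)

/-- The components, in the preferred chart at `c`, of an element of the fibre at `y` of
`(T_X^*)^{⊗k} ⊗ E`. -/
def kToModel {k : ℕ} (c y : X) (M : KFib H lam mu k y) : KSchur lam mu H k :=
  kMap (V := TangentSpace 𝓘(ℝ, H) y) (by exact toModel c y) (by exact fromModel c y) M

/-- The element of the fibre at `y` of `(T_X^*)^{⊗k} ⊗ E` with given components in the preferred
chart at `c`. -/
def kFromModel {k : ℕ} (c y : X) (M : KSchur lam mu H k) : KFib H lam mu k y :=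
  kMap (W := TangentSpace 𝓘(ℝ, H) y) (by exact fromModel c y) (by exact toModel c y) M

/-- The action on `E_x` of the endomorphism `Γ(v)` of `T_x X`. -/
def eGamma (x : X) (v : TangentSpace 𝓘(ℝ, H) x) : EFib H lam mu x →L[ℝ] EFib H lam mu x :=
  schurAct (V := TangentSpace 𝓘(ℝ, H) x) (by exact christoffel x v)

/-- The action of the endomorphism `Γ(v)` of `T_x X` on the fibre at `x` of
`(T_X^*)^{⊗k} ⊗ E`. -/
def kGamma {k : ℕ} (x : X) (v : TangentSpace 𝓘(ℝ, H) x) (M : KFib H lam mu k x) :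
    KFib H lam mu k x :=
  kAct (V := TangentSpace 𝓘(ℝ, H) x) (by exact christoffel x v) M

theorem kGamma_add {k : ℕ} (x : X) (v w : TangentSpace 𝓘(ℝ, H) x) (M : KFib H lam mu k x) :
    kGamma x (v + w) M = kGamma x v M + kGamma x w M := by
  rw [kGamma, christoffel_add]
  exact kAct_add _ _ M

theorem kGamma_smul {k : ℕ} (x : X) (r : ℝ) (v : TangentSpace 𝓘(ℝ, H) x)
    (M : KFib H lam mu k x) : kGamma x (r • v) M = r • kGamma x v M := by
  rw [kGamma, christoffel_smul]
  exact kAct_smul _ _ M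

theorem kFromModel_add {k : ℕ} (c y : X) (M N : KSchur lam mu H k) :
    (kFromModel c y (M + N) : KFib H lam mu k y) = kFromModel c y M + kFromModel c y N :=
  kMap_add _ _ M N

theorem kFromModel_smul {k : ℕ} (c y : X) (r : ℝ) (M : KSchur lam mu H k) :
    (kFromModel c y (r • M) : KFib H lam mu k y) = r • kFromModel c y M :=
  kMap_smul _ _ r M

/-- Smoothness of a section of `E`: its components in every preferred chart are smooth. -/
def IsSmoothSection (u : ∀ x : X, EFib H lam mu x) : Prop :=
  ∀ c : X, ContMDiffOn 𝓘(ℝ, H) 𝓘(ℝ, Schur lam mu H) ∞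
    (fun y => eToModel lam mu c y (u y)) (chartAt H c).source

/-- The section `s` of `(T_X^*)^{⊗k} ⊗ E` read in the preferred chart at `c`. -/
def sectionInChart {k : ℕ} (s : ∀ x : X, KFib H lam mu k x) (c : X) (z : H) :
    KSchur lam mu H k :=
  kToModel c ((extChartAt 𝓘(ℝ, H) c).symm z) (s ((extChartAt 𝓘(ℝ, H) c).symm z))

/-- `∇_v s` at `x`: in the preferred chart at `x` it is `D_v s + Γ(v) · s`. -/
def nablaAt {k : ℕ} (s : ∀ x : X, KFib H lam mu k x) (x : X) :
    TangentSpace 𝓘(ℝ, H) x →L[ℝ] KFib H lam mu k x :=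
  LinearMap.toContinuousLinearMap
    { toFun := fun v =>
        kFromModel x x (fderiv ℝ (sectionInChart s x) (extChartAt 𝓘(ℝ, H) x x) (toModel x x v)) +
          kGamma x v (s x)
      map_add' := fun v w => by
        rw [map_add, map_add, kGamma_add, kFromModel_add]
        abel
      map_smul' := fun r v => by
        rw [map_smul, map_smul, kGamma_smul, kFromModel_smul, smul_add]
        rfl }

/-- The covariant derivative `∇_g` from sections of `(T_X^*)^{⊗k} ⊗ E` to sections of
`(T_X^*)^{⊗(k+1)} ⊗ E`, the new slot being the first one. -/
def nabla {k : ℕ} (s : ∀ x : X, KFib H lam mu k x) (x : X) : KFib H lam mu (k + 1) x :=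
  ContinuousLinearMap.uncurryLeft (nablaAt s x)

/-- The iterated covariant derivative `∇_g^k u`, a section of `(T_X^*)^{⊗k} ⊗ E`. -/
def nablaIter (u : ∀ x : X, EFib H lam mu x) : (k : ℕ) → ∀ x : X, KFib H lam mu k x
  | 0 => fun x => ContinuousMultilinearMap.constOfIsEmpty ℝ (fun _ : Fin 0 => _) (u x)
  | k + 1 => nabla (nablaIter u k)

/-! #### Parallel transport along radial geodesics -/

/-- `s` is a parallel section of `E` along the restriction of `γ` to `[0, 1]`: the equation
`∇_{γ'} s = 0` at time `t` is written in the preferred chart at `γ t`. -/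
def IsParallel (γ : ℝ → X) (s : ∀ t : ℝ, EFib H lam mu (γ t)) : Prop :=
  ∀ t ∈ Set.Icc (0 : ℝ) 1,
    HasDerivWithinAt (fun r => eToModel lam mu (γ t) (γ r) (s r))
      (- eToModel lam mu (γ t) (γ t) (eGamma (γ t) (velocity H γ t) (s t)))
      (Set.Icc 0 1) t

/-- `w ∈ E_x` is obtained from `e ∈ E_{exp_x ξ}` by parallel transport along the geodesic
`t ↦ exp_x(t ξ)`, from time `1` to time `0`. -/
def IsTransported (x : X) (ξ : TangentSpace 𝓘(ℝ, H) x) (e : EFib H lam mu (expMap x ξ))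
    (w : EFib H lam mu x) : Prop :=
  ∃ s : ∀ t : ℝ, EFib H lam mu (geodesic x ξ t), IsParallel (geodesic x ξ) s ∧
    s 1 = e ∧ (⟨geodesic x ξ 0, s 0⟩ : Σ y : X, EFib H lam mu y) = ⟨x, w⟩

open Classical in
/-- The parallel transport `τ_x^E : E_{exp_x ξ} → E_x` along the geodesic `t ↦ exp_x(t ξ)`. -/
def transport (x : X) (ξ : TangentSpace 𝓘(ℝ, H) x) (e : EFib H lam mu (expMap x ξ)) :
    EFib H lam mu x :=
  if h : ∃ w, IsTransported x ξ e w then h.choose else 0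

/-! #### Differential operators and their symbols -/

/-- The Hermitian inner products on the fibres of the complex vector bundle `F` depend smoothly on
the base point, that is, so do their real parts. -/
def IsSmoothHermitian (H : Type*) [NormedAddCommGroup H] [NormedSpace ℝ H]
    {X : Type*} [TopologicalSpace X] [ChartedSpace H X]
    (FF : Type*) [NormedAddCommGroup FF] [NormedSpace ℂ FF]
    (F : X → Type*) [TopologicalSpace (TotalSpace FF F)] [∀ x, NormedAddCommGroup (F x)]
    [∀ x, InnerProductSpace ℂ (F x)] [FiberBundle FF F] [VectorBundle ℝ FF F] : Prop :=
  letI : ∀ x, InnerProductSpace ℝ (F x) := fun _ => InnerProductSpace.complexToReal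
  IsContMDiffRiemannianBundle 𝓘(ℝ, H) ∞ FF F

/-- A differential operator of order `p` from `E` to the vector bundle `F` (with model fibre `FF`),
given by its coefficients `A_r`, which are smooth sections of
`S^{p-r} T_X ⊗ Hom_ℝ(E, F) ⊆ Hom_ℝ((T_X^*)^{⊗(p-r)} ⊗ E, F)`. -/
structure DiffOp (H : Type*) [NormedAddCommGroup H] [NormedSpace ℝ H] [FiniteDimensional ℝ H]
    {X : Type*} [TopologicalSpace X] [ChartedSpace H X] [IsManifold 𝓘(ℝ, H) ∞ X]
    [RiemannianBundle (fun x : X => TangentSpace 𝓘(ℝ, H) x)] (lam mu : YoungDiagram)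
    (FF : Type*) [NormedAddCommGroup FF] [NormedSpace ℝ FF]
    (F : X → Type*) [TopologicalSpace (TotalSpace FF F)] [∀ x, NormedAddCommGroup (F x)]
    [∀ x, NormedSpace ℝ (F x)] [FiberBundle FF F] [VectorBundle ℝ FF F] (p : ℕ) where
  /-- The value of `A_r` at `x`. -/
  coeff (r : Fin (p + 1)) (x : X) : KFib H lam mu (p - r) x →L[ℝ] F x
  /-- `A_r` is symmetric in its `p - r` contravariant slots. -/
  symm (r : Fin (p + 1)) (x : X) (σ : Equiv.Perm (Fin (p - r))) (M : KFib H lam mu (p - r) x) :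
    coeff r x (M.domDomCongr σ) = coeff r x M
  /-- The components of `A_r` in the preferred charts are smooth. -/
  smooth (r : Fin (p + 1)) (c : X) (M : KSchur lam mu H (p - r)) :
    ContMDiffOn 𝓘(ℝ, H) (𝓘(ℝ, H).prod 𝓘(ℝ, FF)) ∞
      (fun y => (⟨y, coeff r y (kFromModel c y M)⟩ : TotalSpace FF F)) (chartAt H c).source

namespace DiffOp

variable {FF : Type*} [NormedAddCommGroup FF] [NormedSpace ℝ FF]
  {F : X → Type*} [TopologicalSpace (TotalSpace FF F)] [∀ x, NormedAddCommGroup (F x)]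
  [∀ x, NormedSpace ℝ (F x)] [FiberBundle FF F] [VectorBundle ℝ FF F] {p : ℕ}

/-- The operator itself: `A u = ∑_{r=0}^p A_r ∇_g^{p-r} u`. -/
def apply (A : DiffOp H lam mu FF F p) (u : ∀ x : X, EFib H lam mu x) (x : X) : F x :=
  ∑ r : Fin (p + 1), A.coeff r x (nablaIter u (p - r) x)

/-- The total symbol of `A`, as a real-linear map `a(η) : E_x → F_x` for `η ∈ T_x^* X`:
`a(η) e = ∑_{r=0}^p A_r ((2 π i η)^{⊗(p-r)} ⊗ e)`. -/
def symbol (A : DiffOp H lam mu FF F p) (x : X) (η : StrongDual ℝ (TangentSpace 𝓘(ℝ, H) x))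
    (e : EFib H lam mu x) : F x :=
  ∑ r : Fin (p + 1), A.coeff r x
    (powTensor (p - r) η ((2 * Real.pi * Complex.I) ^ (p - r : ℕ) • e))

/-- If the coefficients of `A` are complex linear in `E`, then
`a(η) e = ∑_{r=0}^p (2 π i)^{p-r} A_r (η^{⊗(p-r)} ⊗ e)`. -/
theorem symbol_eq_of_complexLinear [∀ x, Module ℂ (F x)] (A : DiffOp H lam mu FF F p) (x : X)
    (h : ∀ (r : Fin (p + 1)) (η : StrongDual ℝ (TangentSpace 𝓘(ℝ, H) x)) (z : ℂ)
      (e : EFib H lam mu x), A.coeff r x (powTensor (p - r) η (z • e)) =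
        z • A.coeff r x (powTensor (p - r) η e))
    (η : StrongDual ℝ (TangentSpace 𝓘(ℝ, H) x)) (e : EFib H lam mu x) :
    A.symbol x η e = ∑ r : Fin (p + 1),
      (2 * Real.pi * Complex.I) ^ (p - r : ℕ) • A.coeff r x (powTensor (p - r) η e) :=
  Finset.sum_congr rfl fun r _ => h r η _ e

end DiffOp

/-! #### The Fourier transform -/

/-- The measure `dV_{g_x^*}` on `T_x^* X`, image of the Euclidean volume of `T_x X` under the
isometry `T_x X → T_x^* X` given by the metric. -/
def dualVolume (x : X) : Measure (StrongDual ℝ (TangentSpace 𝓘(ℝ, H) x)) :=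
  (volume : Measure (TangentSpace 𝓘(ℝ, H) x)).map
    (InnerProductSpace.toDual ℝ (TangentSpace 𝓘(ℝ, H) x))

/-- The integrand `τ_x^E · u(exp_x ξ) e^{-2πi η·ξ} χ(|ξ| / ε)`. -/
def fourierIntegrand (χ : ℝ → ℝ) (ε : ℝ) (u : ∀ x : X, EFib H lam mu x) (x : X)
    (η : StrongDual ℝ (TangentSpace 𝓘(ℝ, H) x)) (ξ : TangentSpace 𝓘(ℝ, H) x) :
    EFib H lam mu x :=
  (Complex.exp (-2 * Real.pi * Complex.I * (η ξ : ℝ)) * (χ (‖ξ‖ / ε) : ℂ)) •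
    transport x ξ (u (expMap x ξ))

/-- `∫_{D_x} τ_x^E · u(exp_x ξ) e^{-2πi η·ξ} χ(|ξ| / ε) dV_{g_x}(ξ)`. -/
def fourierTransform (χ : ℝ → ℝ) (ε : ℝ) (u : ∀ x : X, EFib H lam mu x) (x : X)
    (η : StrongDual ℝ (TangentSpace 𝓘(ℝ, H) x)) : EFib H lam mu x :=
  ∫ ξ in injDomain x, fourierIntegrand χ ε u x η ξ

end Geometry

end FourierInversion

end

open scoped Manifold ContDiff Bundle

/-!
The function `v(ξ) = χ(|ξ| / ε) τ_x (u (exp_x ξ))` on `T_x X`, extended by `0` outside `D_x`, is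
smooth with compact support, because geodesics and parallel transport depend smoothly on their
initial data. Since `η^{⊗k} ⊗ (2πi)^k v̂(η)` is the Fourier transform of the `k`-th derivative
`D^k v`, Fourier inversion at the origin turns `∫ a(η) v̂(η) dη` into `∑_r A_r (D^{p-r} v(0))`.
Along the radial geodesic with velocity `ξ`, the equations of geodesics and of parallel transport
give `D^k v(0)(ξ, …, ξ) = ∇^k u(ξ, …, ξ)` for `k ≤ 2`, and by polarization these diagonal values
determine the image of `D^k v(0)` under the symmetric map `A_r`.
-/

noncomputable section

namespace FourierInversion

section Geometry

set_option maxSynthPendingDepth 3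

/-- The norm on a tangent space given by the Riemannian metric. -/
abbrev tangentNormedAddCommGroup {H : Type*} [NormedAddCommGroup H]
    [NormedSpace ℝ H] {X : Type*} [TopologicalSpace X] [ChartedSpace H X]
    [Bundle.RiemannianBundle (fun x : X => TangentSpace 𝓘(ℝ, H) x)] (x : X) :
    NormedAddCommGroup (TangentSpace 𝓘(ℝ, H) x) :=
  Bundle.instNormedAddCommGroupOfRiemannianBundleOfIsTopologicalAddGroupOfContinuousConstSMulReal
    (E := fun x : X => TangentSpace 𝓘(ℝ, H) x) x

/-- The inner product on a tangent space given by the Riemannian metric. -/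
abbrev tangentInnerProductSpace {H : Type*} [NormedAddCommGroup H]
    [NormedSpace ℝ H] {X : Type*} [TopologicalSpace X] [ChartedSpace H X]
    [Bundle.RiemannianBundle (fun x : X => TangentSpace 𝓘(ℝ, H) x)] (x : X) :
    InnerProductSpace ℝ (TangentSpace 𝓘(ℝ, H) x) :=
  Bundle.instInnerProductSpaceReal (E := fun x : X => TangentSpace 𝓘(ℝ, H) x) x

-- The general instances unify with every type and make all normed-space synthesis slow, so they are
-- replaced by their specializations to tangent spaces.
attribute [-instance]
  Bundle.instNormedAddCommGroupOfRiemannianBundleOfIsTopologicalAddGroupOfContinuousConstSMulReal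
attribute [-instance] Bundle.instInnerProductSpaceReal
attribute [local instance] tangentNormedAddCommGroup tangentInnerProductSpace

section SmoothFlow

open Set Filter Topology

universe u

section Postcomp

variable {K : Type*} [TopologicalSpace K] [CompactSpace K]

theorem exists_forall_mem_ball_norm_sub_le {E G : Type*} [NormedAddCommGroup E]
    [NormedAddCommGroup G] (f : C(E, G)) (γ : C(K, E)) {ε : ℝ} (hε : 0 < ε) :
    ∃ δ > 0, ∀ t, ∀ y ∈ Metric.ball (γ t) δ, ‖f y - f (γ t)‖ ≤ ε := by
  obtain ⟨δ, hδ, hfδ⟩ := Metric.continuousAt_iff.1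
    ((ContinuousMap.continuous_postcomp (X := K) f).continuousAt (x := γ)) ε hε
  refine ⟨δ, hδ, fun t y hy => ?_⟩
  have hshift : dist (γ + ContinuousMap.const K (y - γ t)) γ < δ := by
    rw [dist_eq_norm, add_sub_cancel_left]
    refine (ContinuousMap.norm_lt_iff _ hδ).2 fun s => ?_
    simpa using mem_ball_iff_norm.1 hy
  simpa [dist_eq_norm] using (ContinuousMap.dist_apply_le_dist t).trans (hfδ hshift).le

variable {E F : Type u} [NormedAddCommGroup E] [NormedSpace ℝ E] [NormedAddCommGroup F]
  [NormedSpace ℝ F]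

variable (K E F) in
/-- The pointwise application of a continuous family of linear maps to a continuous function.
With `a = f' ∘ γ` it is the derivative of `γ ↦ f ∘ γ`. -/
def pointwiseApply : C(K, E →L[ℝ] F) →L[ℝ] C(K, E) →L[ℝ] C(K, F) :=
  LinearMap.mkContinuous₂
    (LinearMap.mk₂ ℝ (fun (a : C(K, E →L[ℝ] F)) (h : C(K, E)) =>
      (⟨fun t => a t (h t), by fun_prop⟩ : C(K, F)))
      (fun a b h => by ext t; simp) (fun r a h => by ext t; simp)
      (fun a h k => by ext t; simp) (fun r a h => by ext t; simp)) 1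
    (fun a h => by
      rw [one_mul]
      refine (ContinuousMap.norm_le _ (by positivity)).2 fun t => ?_
      exact (a t).le_of_opNorm_le_of_le (a.norm_coe_le_norm t) (h.norm_coe_le_norm t))

theorem hasFDerivAt_postcomp (f : C(E, F)) (f' : C(E, E →L[ℝ] F))
    (hf : ∀ x, HasFDerivAt f (f' x) x) (γ : C(K, E)) :
    HasFDerivAt (fun γ : C(K, E) => f.comp γ) (pointwiseApply K E F (f'.comp γ)) γ := by
  rw [hasFDerivAt_iff_isLittleO_nhds_zero, Asymptotics.isLittleO_iff]
  intro ε hε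
  obtain ⟨δ, hδ, hf'δ⟩ := exists_forall_mem_ball_norm_sub_le f' γ hε
  filter_upwards [Metric.ball_mem_nhds (0 : C(K, E)) hδ] with h hh
  rw [mem_ball_zero_iff] at hh
  refine (ContinuousMap.norm_le _ (by positivity)).2 fun t => ?_
  have mean_value := (convex_ball (γ t) δ).norm_image_sub_le_of_norm_hasFDerivWithin_le'
    (fun y _ => (hf y).hasFDerivWithinAt) (hf'δ t) (x := γ t) (y := γ t + h t)
    (Metric.mem_ball_self hδ) (by
      simpa [mem_ball_iff_norm] using (h.norm_coe_le_norm t).trans_lt hh)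
  rw [add_sub_cancel_left] at mean_value
  exact mean_value.trans (mul_le_mul_of_nonneg_left (h.norm_coe_le_norm t) hε.le)

theorem contDiff_postcomp (n : ℕ) : ∀ {F : Type u} [NormedAddCommGroup F] [NormedSpace ℝ F]
    (f : C(E, F)), ContDiff ℝ n f → ContDiff ℝ n (fun γ : C(K, E) => f.comp γ) := by
  induction n with
  | zero => exact fun f _ => contDiff_zero.2 (ContinuousMap.continuous_postcomp f)
  | succ n ih =>
    intro F _ _ f hf
    have hf' : ContDiff ℝ n (fderiv ℝ f) := hf.fderiv_right (by norm_cast)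
    have hd : Differentiable ℝ f := hf.differentiable (by norm_cast)
    let f' : C(E, E →L[ℝ] F) := ⟨fderiv ℝ f, hf'.continuous⟩
    push_cast
    rw [contDiff_succ_iff_hasFDerivAt]
    exact ⟨fun γ => pointwiseApply K E F (f'.comp γ),
      (pointwiseApply K E F).contDiff.comp (ih f' hf'),
      hasFDerivAt_postcomp f f' fun x => (hd x).hasFDerivAt⟩

end Postcomp

section Primitive

variable {E : Type*} [NormedAddCommGroup E] [NormedSpace ℝ E]

theorem neg_one_le_one_real : (-1 : ℝ) ≤ 1 := by norm_num

variable (E) in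
/-- The primitive vanishing at `0` of a continuous function on `[-1, 1]`; the time interval is
normalized so that all solutions of an equation live in one Banach space. -/
def primitive : C(Icc (-1 : ℝ) 1, E) →L[ℝ] C(Icc (-1 : ℝ) 1, E) :=
  LinearMap.mkContinuous
    { toFun := fun γ => ⟨fun s => ∫ r in (0 : ℝ)..s, IccExtend neg_one_le_one_real γ r,
        (intervalIntegral.continuous_primitive
          (fun a b => γ.continuous.Icc_extend'.intervalIntegrable a b) 0).comp
            continuous_subtype_val⟩
      map_add' := fun a b => by
        ext s
        exact intervalIntegral.integral_add (a.continuous.Icc_extend'.intervalIntegrable _ _)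
          (b.continuous.Icc_extend'.intervalIntegrable _ _)
      map_smul' := fun r a => by
        ext s
        exact intervalIntegral.integral_smul r _ }
    1 (fun γ => by
      rw [one_mul]
      refine (ContinuousMap.norm_le _ (norm_nonneg _)).2 fun s => ?_
      refine (intervalIntegral.norm_integral_le_of_norm_le_const (C := ‖γ‖)
        fun r _ => γ.norm_coe_le_norm _).trans (mul_le_of_le_one_right (norm_nonneg _) ?_)
      rw [sub_zero]
      exact abs_le.2 s.2)

theorem primitive_apply_zero (γ : C(Icc (-1 : ℝ) 1, E)) : primitive E γ ⟨0, by norm_num⟩ = 0 :=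
  intervalIntegral.integral_same

theorem hasDerivAt_primitive [CompleteSpace E] (γ : C(Icc (-1 : ℝ) 1, E)) {s : ℝ}
    (hs : s ∈ Ioo (-1 : ℝ) 1) :
    HasDerivAt (IccExtend neg_one_le_one_real (primitive E γ))
      (IccExtend neg_one_le_one_real γ s) s := by
  have hint : HasDerivAt (fun s : ℝ => ∫ r in (0 : ℝ)..s, IccExtend neg_one_le_one_real γ r)
      (IccExtend neg_one_le_one_real γ s) s :=
    intervalIntegral.integral_hasDerivAt_right (γ.continuous.Icc_extend'.intervalIntegrable _ _)
      (γ.continuous.Icc_extend'.stronglyMeasurableAtFilter _ _)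
      γ.continuous.Icc_extend'.continuousAt
  refine hint.congr_of_eventuallyEq ?_
  filter_upwards [Ioo_mem_nhds hs.1 hs.2] with r hr
  exact IccExtend_of_mem _ _ (Ioo_subset_Icc_self hr)

/-- The equation `γ(s) = x + τ ∫₀ˢ g(γ(r)) dr` on `[-1, 1]`, whose solutions are the integral curves
of `g` issued from `x`, run at speed `τ`. -/
def IsScaledFlowLine (g : C(E, E)) (x : E) (τ : ℝ) (γ : C(Icc (-1 : ℝ) 1, E)) : Prop :=
  γ = ContinuousMap.const _ x + τ • primitive E (g.comp γ)

/-- The curve `t ↦ γ(t / τ)`, extended by constants outside `[-τ, τ]`. -/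
def rescaledExtend (τ : ℝ) (γ : C(Icc (-1 : ℝ) 1, E)) (t : ℝ) : E :=
  IccExtend neg_one_le_one_real γ (t / τ)

theorem div_mem_Ioo_neg_one_one {t τ : ℝ} (ht : t ∈ Ioo (-τ) τ) : t / τ ∈ Ioo (-1 : ℝ) 1 := by
  have hτ : 0 < τ := by linarith [ht.1, ht.2]
  constructor
  · rw [lt_div_iff₀ hτ]; linarith [ht.1]
  · rw [div_lt_iff₀ hτ]; linarith [ht.2]

namespace IsScaledFlowLine

variable {g : C(E, E)} {x : E} {τ : ℝ} {γ : C(Icc (-1 : ℝ) 1, E)}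

theorem rescaledExtend_zero (h : IsScaledFlowLine g x τ γ) : rescaledExtend τ γ 0 = x := by
  rw [rescaledExtend, zero_div, IccExtend_of_mem _ _ (by norm_num : (0 : ℝ) ∈ Icc (-1 : ℝ) 1), h]
  simp [primitive_apply_zero]

theorem hasDerivAt_rescaledExtend [CompleteSpace E] (h : IsScaledFlowLine g x τ γ) {t : ℝ}
    (ht : t ∈ Ioo (-τ) τ) :
    HasDerivAt (rescaledExtend τ γ) (g (rescaledExtend τ γ t)) t := by
  have hτ : 0 < τ := by linarith [ht.1, ht.2]
  have hd := (((hasDerivAt_primitive (g.comp γ) (div_mem_Ioo_neg_one_one ht)).scomp t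
    ((hasDerivAt_id t).div_const τ)).const_smul τ).const_add x
  rw [smul_smul, mul_one_div_cancel hτ.ne', one_smul] at hd
  exact hd.congr_of_eventuallyEq (.of_forall fun s => DFunLike.congr_fun h _)

end IsScaledFlowLine

end Primitive

/-- At `τ = 0` the equation for a flow line reads `γ = x`, whose linearization in `γ` is the
identity, so that the implicit function theorem applies. -/
theorem exists_contDiffAt_isScaledFlowLine {E : Type u} [NormedAddCommGroup E] [NormedSpace ℝ E]
    [CompleteSpace E] {n : ℕ} (hn : n ≠ 0) (g : C(E, E)) (hg : ContDiff ℝ n g) (x₀ : E) :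
    ∃ γ : E × ℝ → C(Icc (-1 : ℝ) 1, E), γ (x₀, 0) = ContinuousMap.const _ x₀ ∧
      ContDiffAt ℝ n γ (x₀, 0) ∧ ∀ᶠ q in 𝓝 (x₀, 0), IsScaledFlowLine g q.1 q.2 (γ q) := by
  let defect : (E × ℝ) × C(Icc (-1 : ℝ) 1, E) → C(Icc (-1 : ℝ) 1, E) := fun p =>
    p.2 - (ContinuousLinearMap.const ℝ _ p.1.1 + p.1.2 • primitive E (g.comp p.2))
  let p₀ : (E × ℝ) × C(Icc (-1 : ℝ) 1, E) := ((x₀, 0), ContinuousMap.const _ x₀)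
  have hdefect : ContDiff ℝ n defect := by
    have hprim : ContDiff ℝ n fun p : (E × ℝ) × C(Icc (-1 : ℝ) 1, E) =>
        primitive E (g.comp p.2) :=
      (primitive E).contDiff.comp ((contDiff_postcomp n g hg).comp contDiff_snd)
    fun_prop
  have hzero : defect p₀ = 0 := by
    ext
    simp [defect, p₀]
  have hpartial : fderiv ℝ defect p₀ ∘L .inr ℝ (E × ℝ) C(Icc (-1 : ℝ) 1, E) = .id ℝ _ := by
    have hcurve : (fun γ => defect (p₀.1, γ)) = fun γ => γ - ContinuousMap.const _ x₀ := by
      ext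
      simp [defect, p₀]
    have hchain := (hdefect.differentiable (mod_cast hn) p₀).hasFDerivAt.comp p₀.2
      (hasFDerivAt_prodMk_right p₀.1 p₀.2)
    refine hchain.unique ?_
    change HasFDerivAt (fun γ => defect (p₀.1, γ)) _ _
    rw [hcurve]
    exact (hasFDerivAt_id _).sub_const _
  have hinv : (fderiv ℝ defect p₀ ∘L .inr ℝ (E × ℝ) C(Icc (-1 : ℝ) 1, E)).IsInvertible := by
    rw [hpartial]
    exact ⟨.refl ℝ _, rfl⟩
  have hn' : (n : WithTop ℕ∞) ≠ 0 := mod_cast hn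
  refine ⟨hdefect.contDiffAt.implicitFunction hn' hinv,
    hdefect.contDiffAt.implicitFunction_apply_self hn' hinv,
    hdefect.contDiffAt.contDiffAt_implicitFunction hn' hinv, ?_⟩
  filter_upwards [hdefect.contDiffAt.eventually_apply_implicitFunction hn' hinv] with q hq
  rw [hzero] at hq
  exact sub_eq_zero.1 hq

theorem exists_contDiff_eqOn_ball {E F : Type*} [NormedAddCommGroup E] [NormedSpace ℝ E]
    [HasContDiffBump E] [NormedAddCommGroup F] [NormedSpace ℝ F] {n : ℕ∞} {f : E → F} {U : Set E}
    (hU : IsOpen U) (hf : ContDiffOn ℝ n f U) {x₀ : E} (hx₀ : x₀ ∈ U) :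
    ∃ g : E → F, ContDiff ℝ n g ∧ ∃ r > 0, Metric.ball x₀ r ⊆ U ∧ EqOn g f (Metric.ball x₀ r) := by
  obtain ⟨R, hR, hRU⟩ := Metric.isOpen_iff.1 hU x₀ hx₀
  let ρ : ContDiffBump x₀ := ⟨R / 4, R / 2, by positivity, by linarith⟩
  have hρU : tsupport ρ ⊆ U := by
    rw [ρ.tsupport_eq]
    exact (Metric.closedBall_subset_ball (half_lt_self hR)).trans hRU
  refine ⟨fun x => ρ x • f x, contDiff_iff_contDiffAt.2 fun x => ?_, R / 4, by positivity,
    (Metric.ball_subset_ball (by linarith)).trans hRU, fun x hx => ?_⟩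
  · by_cases hx : x ∈ U
    · exact ρ.contDiffAt.smul (hf.contDiffAt (hU.mem_nhds hx))
    · refine contDiffAt_const (c := (0 : F)) |>.congr_of_eventuallyEq ?_
      filter_upwards [notMem_tsupport_iff_eventuallyEq.1 fun h => hx (hρU h)] with y hy
      simp [hy]
  · beta_reduce
    rw [ρ.one_of_mem_closedBall (Metric.ball_subset_closedBall hx), one_smul]

/-- Smooth dependence on initial values: shrinking the speed `τ` is the same as shrinking the time
interval, so the solutions over `[-1, 1]` with small `τ` give the local flow. -/
theorem exists_contDiffOn_local_flow {E : Type u} [NormedAddCommGroup E] [NormedSpace ℝ E]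
    [CompleteSpace E] [HasContDiffBump E] {f : E → E} {U : Set E} (hU : IsOpen U) {n : ℕ}
    (hf : ContDiffOn ℝ (n + 1 : ℕ) f U) {x₀ : E} (hx₀ : x₀ ∈ U) :
    ∃ δ > 0, ∃ W : Set E, IsOpen W ∧ x₀ ∈ W ∧ ∃ Φ : E → ℝ → E,
      (∀ x ∈ W, Φ x 0 = x ∧ ∀ t ∈ Ioo (-δ) δ, Φ x t ∈ U ∧ HasDerivAt (Φ x) (f (Φ x t)) t) ∧
      ∀ t ∈ Ioo (-δ) δ, ContDiffOn ℝ n (fun x => Φ x t) W := by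
  obtain ⟨g, hg, R, hR, hRU, hgf⟩ := exists_contDiff_eqOn_ball hU hf hx₀
  obtain ⟨γ, hγ₀, hγ, hflow⟩ :=
    exists_contDiffAt_isScaledFlowLine n.succ_ne_zero ⟨g, hg.continuous⟩ hg x₀
  have hnear : ∀ᶠ q in 𝓝 (x₀, (0 : ℝ)), γ q ∈ Metric.ball (ContinuousMap.const _ x₀) R :=
    hγ.continuousAt.eventually_mem
      (Metric.isOpen_ball.mem_nhds (hγ₀ ▸ Metric.mem_ball_self hR))
  have hsmooth : ∀ᶠ q in 𝓝 (x₀, (0 : ℝ)), ContDiffAt ℝ n γ q :=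
    (hγ.of_le (mod_cast n.le_succ)).eventually (by simp)
  obtain ⟨r, hr, hball⟩ :=
    Metric.eventually_nhds_iff_ball.1 (hflow.and (hnear.and hsmooth))
  have hmem : ∀ x ∈ Metric.ball x₀ r, (x, r / 2) ∈ Metric.ball (x₀, (0 : ℝ)) r := fun x hx => by
    rw [Metric.mem_ball, Prod.dist_eq, max_lt_iff, Real.dist_0_eq_abs, abs_of_pos (half_pos hr)]
    exact ⟨hx, half_lt_self hr⟩
  refine ⟨r / 2, half_pos hr, Metric.ball x₀ r, Metric.isOpen_ball, Metric.mem_ball_self hr,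
    fun x => rescaledExtend (r / 2) (γ (x, r / 2)), fun x hx => ?_, fun t _ x hx => ?_⟩
  · obtain ⟨hx_flow, hx_near, -⟩ := hball _ (hmem x hx)
    refine ⟨hx_flow.rescaledExtend_zero, fun t ht => ?_⟩
    have hball_t : rescaledExtend (r / 2) (γ (x, r / 2)) t ∈ Metric.ball x₀ R :=
      (ContinuousMap.dist_apply_le_dist _).trans_lt hx_near
    exact ⟨hRU hball_t, hgf hball_t ▸ hx_flow.hasDerivAt_rescaledExtend ht⟩
  · obtain ⟨-, -, hx_smooth⟩ := hball _ (hmem x hx)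
    have hslice : ContDiffAt ℝ n (fun y => γ (y, r / 2)) x :=
      ContDiffAt.comp (f := fun y : E => (y, r / 2)) x hx_smooth
        (contDiffAt_id.prodMk contDiffAt_const)
    exact ((ContinuousMap.evalCLM ℝ
      (projIcc (-1 : ℝ) 1 neg_one_le_one_real (t / (r / 2)))).contDiff.contDiffAt.comp x
        hslice).contDiffWithinAt

end SmoothFlow
section SchurCalculus

variable {lam mu : YoungDiagram} {V W : Type*} [NormedAddCommGroup V] [NormedSpace ℝ V]
  [NormedAddCommGroup W] [NormedSpace ℝ W]

theorem schur_ext {w w' : Schur lam mu V} (h : ∀ θ v, w.1 θ v = w'.1 θ v) : w = w' :=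
  Subtype.ext (ContinuousMultilinearMap.ext fun θ => ContinuousMultilinearMap.ext fun v => h θ v)

theorem schurMap_apply (P : V →L[ℝ] W) (Q : W →L[ℝ] V) (w : Schur lam mu V)
    (θ : Cells lam → StrongDual ℝ W) (v : Cells mu → W) :
    (schurMap P Q w).1 θ v = w.1 (fun c => (θ c).comp P) (fun c => Q (v c)) := rfl

theorem schurMap_apply_update_left (P : V →L[ℝ] W) (Q : W →L[ℝ] V) (w : Schur lam mu V)
    (θ : Cells lam → StrongDual ℝ W) (v : Cells mu → W) (c : Cells lam) (α : StrongDual ℝ W) :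
    (schurMap P Q w).1 (Function.update θ c α) v =
      w.1 (Function.update (fun d => (θ d).comp P) c (α.comp P)) (fun d => Q (v d)) := by
  rw [schurMap_apply]
  congr 2
  exact funext (Function.apply_update (fun _ (β : StrongDual ℝ W) => β.comp P) θ c α)

theorem schurMap_apply_update_right (P : V →L[ℝ] W) (Q : W →L[ℝ] V) (w : Schur lam mu V)
    (θ : Cells lam → StrongDual ℝ W) (v : Cells mu → W) (c : Cells mu) (x : W) :
    (schurMap P Q w).1 θ (Function.update v c x) =
      w.1 (fun d => (θ d).comp P) (Function.update (fun d => Q (v d)) c (Q x)) := by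
  rw [schurMap_apply]
  congr 1
  exact funext (Function.apply_update (fun _ y => Q y) v c x)

theorem schurAct_apply (a : V →L[ℝ] V) (w : Schur lam mu V) (θ : Cells lam → StrongDual ℝ V)
    (v : Cells mu → V) :
    (schurAct a w).1 θ v = ∑ c, w.1 (Function.update θ c ((θ c).comp a)) v -
      ∑ c, w.1 θ (Function.update v c (a (v c))) := tensAct_apply a w.1 θ v

theorem schurAct_conj_schurMap_apply {P : V →L[ℝ] W} {Q : W →L[ℝ] V} (hQP : ∀ v, Q (P v) = v)
    (a : V →L[ℝ] W) (w : Schur lam mu V) (θ : Cells lam → StrongDual ℝ W) (v : Cells mu → W) :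
    (schurAct (a.comp Q) (schurMap P Q w)).1 θ v =
      ∑ c, w.1 (Function.update (fun d => (θ d).comp P) c ((θ c).comp a)) (fun d => Q (v d)) -
      ∑ c, w.1 (fun d => (θ d).comp P)
        (Function.update (fun d => Q (v d)) c (Q (a (Q (v c))))) := by
  have hcancel : ∀ θ : StrongDual ℝ W, (θ.comp (a.comp Q)).comp P = θ.comp a := fun θ => by
    ext x
    simp [hQP]
  simp only [schurAct_apply, schurMap_apply_update_left, schurMap_apply_update_right, hcancel,
    ContinuousLinearMap.comp_apply]

theorem schurMap_schurAct {P : V →L[ℝ] W} {Q : W →L[ℝ] V} (hQP : ∀ v, Q (P v) = v)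
    (a : V →L[ℝ] V) (w : Schur lam mu V) :
    schurMap P Q (schurAct a w) = schurAct ((P.comp a).comp Q) (schurMap P Q w) := by
  refine schur_ext fun θ v => ?_
  rw [schurAct_conj_schurMap_apply hQP, schurMap_apply, schurAct_apply]
  simp only [ContinuousLinearMap.comp_apply, hQP, ContinuousLinearMap.comp_assoc]

theorem schurAct_add (a b : V →L[ℝ] V) (w : Schur lam mu V) :
    schurAct (a + b) w = schurAct a w + schurAct b w := Subtype.ext (tensAct_add a b w.1)

theorem schurAct_smul (r : ℝ) (a : V →L[ℝ] V) (w : Schur lam mu V) :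
    schurAct (r • a) w = r • schurAct a w := Subtype.ext (tensAct_smul r a w.1)

theorem contDiff_multilinear_apply {ι : Type*} [Fintype ι] {G : Type*} [NormedAddCommGroup G]
    [NormedSpace ℝ G] {n : WithTop ℕ∞} :
    ContDiff ℝ n fun p : ContinuousMultilinearMap ℝ (fun _ : ι => V) G × (ι → V) => p.1 p.2 :=
  ((ContinuousLinearMap.id ℝ
    (ContinuousMultilinearMap ℝ (fun _ : ι => V) G)).continuousMultilinearMapOption.contDiff).comp
    (contDiff_pi.2 fun _ => contDiff_id)

section Coordinates

variable [FiniteDimensional ℝ V]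

variable (lam mu V) in
/-- The coordinates of a tensor: its values on all families of elements of fixed bases. They reduce
the calculus of tensor-valued functions to that of scalar functions. -/
def schurCoord : Schur lam mu V →ₗ[ℝ]
    ((Cells lam → Fin (Module.finrank ℝ (StrongDual ℝ V))) ×
      (Cells mu → Fin (Module.finrank ℝ V)) → ℂ) where
  toFun w i := w.1 (fun c => Module.finBasis ℝ (StrongDual ℝ V) (i.1 c))
    (fun c => Module.finBasis ℝ V (i.2 c))
  map_add' _ _ := rfl
  map_smul' _ _ := rfl

theorem schurCoord_injective : Function.Injective (schurCoord lam mu V) := by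
  intro w w' h
  refine Subtype.ext (ContinuousMultilinearMap.toMultilinearMap_injective ?_)
  refine Module.Basis.ext_multilinear (fun _ => Module.finBasis ℝ (StrongDual ℝ V)) fun i => ?_
  refine ContinuousMultilinearMap.toMultilinearMap_injective ?_
  exact Module.Basis.ext_multilinear (fun _ => Module.finBasis ℝ V) fun j => congrFun h (i, j)

instance : FiniteDimensional ℝ (Schur lam mu V) :=
  Module.Finite.of_injective (schurCoord lam mu V) schurCoord_injective

theorem exists_schurCoord_leftInverse :
    ∃ L : ((Cells lam → Fin (Module.finrank ℝ (StrongDual ℝ V))) ×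
      (Cells mu → Fin (Module.finrank ℝ V)) → ℂ) →L[ℝ] Schur lam mu V,
      ∀ w, L (schurCoord lam mu V w) = w := by
  obtain ⟨g, hg⟩ := LinearMap.exists_leftInverse_of_injective (schurCoord lam mu V)
    (LinearMap.ker_eq_bot.2 schurCoord_injective)
  exact ⟨LinearMap.toContinuousLinearMap g, fun w => LinearMap.congr_fun hg w⟩

theorem contDiffAt_schur {E : Type*} [NormedAddCommGroup E] [NormedSpace ℝ E] {n : WithTop ℕ∞}
    {f : E → Schur lam mu V} {x : E} (h : ∀ θ v, ContDiffAt ℝ n (fun y => (f y).1 θ v) x) :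
    ContDiffAt ℝ n f x := by
  obtain ⟨L, hL⟩ := exists_schurCoord_leftInverse (lam := lam) (mu := mu) (V := V)
  have hcoord : ContDiffAt ℝ n (fun y => schurCoord lam mu V (f y)) x :=
    contDiffAt_pi.2 fun i => h _ _
  exact (L.contDiff.contDiffAt.comp x hcoord).congr_of_eventuallyEq
    (.of_forall fun y => (hL (f y)).symm)

theorem hasDerivWithinAt_schur {f : ℝ → Schur lam mu V} {f' : Schur lam mu V} {s : Set ℝ} {t : ℝ}
    (h : ∀ θ v, HasDerivWithinAt (fun r => (f r).1 θ v) (f'.1 θ v) s t) :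
    HasDerivWithinAt f f' s t := by
  obtain ⟨L, hL⟩ := exists_schurCoord_leftInverse (lam := lam) (mu := mu) (V := V)
  have hcoord : HasDerivWithinAt (fun r => schurCoord lam mu V (f r)) (schurCoord lam mu V f') s
      t := hasDerivWithinAt_pi.2 fun i => h _ _
  have hinv := L.hasFDerivAt.comp_hasDerivWithinAt t hcoord
  rw [hL] at hinv
  exact hinv.congr (fun y _ => (hL (f y)).symm) (hL (f t)).symm

end Coordinates

theorem contDiff_schurMap [FiniteDimensional ℝ V] [FiniteDimensional ℝ W] {n : WithTop ℕ∞} :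
    ContDiff ℝ n (fun p : (V →L[ℝ] W) × (W →L[ℝ] V) =>
      (schurMap p.1 p.2 : Schur lam mu V →L[ℝ] Schur lam mu W)) := by
  rw [contDiff_clm_apply_iff]
  refine fun w => contDiff_iff_contDiffAt.2 fun p => contDiffAt_schur fun θ v => ?_
  change ContDiffAt ℝ n (fun p : (V →L[ℝ] W) × (W →L[ℝ] V) =>
    w.1 (fun c => (θ c).comp p.1) (fun c => p.2 (v c))) p
  have hleft : ContDiff ℝ n fun p : (V →L[ℝ] W) × (W →L[ℝ] V) => w.1 fun c => (θ c).comp p.1 :=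
    w.1.contDiff.comp (contDiff_pi.2 fun c =>
      (ContinuousLinearMap.compL ℝ V W ℝ (θ c)).contDiff.comp contDiff_fst)
  have hright : ContDiff ℝ n fun p : (V →L[ℝ] W) × (W →L[ℝ] V) => fun c => p.2 (v c) :=
    contDiff_pi.2 fun c => contDiff_snd.clm_apply contDiff_const
  exact (contDiff_multilinear_apply.comp (hleft.prodMk hright)).contDiffAt

theorem hasDerivWithinAt_schurMap_apply {P : ℝ → V →L[ℝ] W} {Q : ℝ → W →L[ℝ] V}
    {S : ℝ → Schur lam mu V} {P' : V →L[ℝ] W} {Q' : W →L[ℝ] V} {S' : Schur lam mu V} {s : Set ℝ}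
    {t : ℝ} (hP : HasDerivWithinAt P P' s t) (hQ : HasDerivWithinAt Q Q' s t)
    (hS : HasDerivWithinAt S S' s t) (θ : Cells lam → StrongDual ℝ W) (v : Cells mu → W) :
    HasDerivWithinAt (fun r => (schurMap (P r) (Q r) (S r)).1 θ v)
      (∑ c, (S t).1 (Function.update (fun d => (θ d).comp (P t)) c ((θ c).comp P'))
          (fun d => Q t (v d)) +
        ∑ c, (S t).1 (fun d => (θ d).comp (P t)) (Function.update (fun d => Q t (v d)) c (Q' (v c)))
        + (schurMap (P t) (Q t) S').1 θ v) s t := by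
  have hleft : ∀ c, HasFDerivWithinAt (fun r => (θ c).comp (P r))
      (ContinuousLinearMap.toSpanSingleton ℝ ((θ c).comp P')) s t := fun c =>
    ((ContinuousLinearMap.compL ℝ V W ℝ (θ c)).hasFDerivAt.comp_hasDerivWithinAt t
      hP).hasFDerivWithinAt
  have hright : ∀ c, HasFDerivWithinAt (fun r => Q r (v c))
      (ContinuousLinearMap.toSpanSingleton ℝ (Q' (v c))) s t := fun c => by
    simpa using (hQ.clm_apply (hasDerivWithinAt_const t s (v c))).hasFDerivWithinAt
  have htensor : HasFDerivWithinAt (fun r => (S r).1)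
      (ContinuousLinearMap.toSpanSingleton ℝ S'.1) s t :=
    ((((schur lam mu V).restrictScalars ℝ).subtypeL).hasFDerivAt.comp_hasDerivWithinAt t
      hS).hasFDerivWithinAt
  refine ((htensor.continuousMultilinearMap_apply hleft).continuousMultilinearMap_apply
    hright).hasDerivWithinAt.congr_deriv ?_
  rw [schurMap_apply]
  simp only [_root_.add_apply, _root_.sum_apply, ContinuousLinearMap.comp_apply,
    ContinuousLinearMap.toSpanSingleton_apply, one_smul,
    ContinuousMultilinearMap.toContinuousLinearMap_apply, ContinuousMultilinearMap.apply_apply]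
  abel

theorem hasDerivWithinAt_schurMap [FiniteDimensional ℝ W]
    {P : ℝ → V →L[ℝ] W} {Q : ℝ → W →L[ℝ] V} {S : ℝ → Schur lam mu V}
    {P' : V →L[ℝ] W} {Q' : W →L[ℝ] V} {S' : Schur lam mu V} {s : Set ℝ} {t : ℝ}
    (hP : HasDerivWithinAt P P' s t) (hQ : HasDerivWithinAt Q Q' s t)
    (hS : HasDerivWithinAt S S' s t) (hQP : ∀ v, Q t (P t v) = v)
    (hQ' : ∀ w, Q' w = -Q t (P' (Q t w))) :
    HasDerivWithinAt (fun r => schurMap (P r) (Q r) (S r))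
      (schurAct (P'.comp (Q t)) (schurMap (P t) (Q t) (S t)) + schurMap (P t) (Q t) S') s t := by
  refine hasDerivWithinAt_schur fun θ v =>
    (hasDerivWithinAt_schurMap_apply hP hQ hS θ v).congr_deriv ?_
  change _ = (schurAct (P'.comp (Q t)) (schurMap (P t) (Q t) (S t))).1 θ v +
    (schurMap (P t) (Q t) S').1 θ v
  rw [schurAct_conj_schurMap_apply hQP, sub_eq_add_neg, ← Finset.sum_neg_distrib]
  congr 2
  refine Finset.sum_congr rfl fun c _ => ?_
  rw [hQ']
  exact ((S t).1 fun d => (θ d).comp (P t)).toMultilinearMap.map_update_neg _ c _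

variable (lam mu V) in
/-- `schurAct` as a continuous linear function of the endomorphism, so that smooth families of
endomorphisms act smoothly. -/
def schurActL [FiniteDimensional ℝ V] : (V →L[ℝ] V) →L[ℝ] Schur lam mu V →L[ℝ] Schur lam mu V :=
  LinearMap.toContinuousLinearMap
    { toFun := fun a => schurAct a
      map_add' := fun a b => by ext1 w; exact schurAct_add a b w
      map_smul' := fun r a => by ext1 w; exact schurAct_smul r a w }

end SchurCalculus

section Transition

open Set Filter Topology

variable {H : Type*} [NormedAddCommGroup H] [NormedSpace ℝ H]
variable {X : Type*} [TopologicalSpace X] [ChartedSpace H X]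

/-- The coordinate change from the preferred chart at `c` to the preferred chart at `d`. -/
def coordChange (H : Type*) [NormedAddCommGroup H] [NormedSpace ℝ H]
    {X : Type*} [TopologicalSpace X] [ChartedSpace H X] (c d : X) : H → H :=
  extChartAt 𝓘(ℝ, H) d ∘ (extChartAt 𝓘(ℝ, H) c).symm

/-- The domain of the coordinate change from the preferred chart at `c` to the one at `d`. -/
def overlap (H : Type*) [NormedAddCommGroup H] [NormedSpace ℝ H]
    {X : Type*} [TopologicalSpace X] [ChartedSpace H X] (c d : X) : Set H :=
  ((extChartAt 𝓘(ℝ, H) c).symm.trans (extChartAt 𝓘(ℝ, H) d)).source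

/-- The Jacobian of the coordinate change: it relates the readings of a tangent vector in the
preferred charts at `c` and `d`. -/
def jacobian (H : Type*) [NormedAddCommGroup H] [NormedSpace ℝ H]
    {X : Type*} [TopologicalSpace X] [ChartedSpace H X] (c d : X) (z : H) : H →L[ℝ] H :=
  fderiv ℝ (coordChange H c d) z

theorem mem_overlap {c d : X} {z : H} : z ∈ overlap H c d ↔
    z ∈ (extChartAt 𝓘(ℝ, H) c).target ∧
      (extChartAt 𝓘(ℝ, H) c).symm z ∈ (extChartAt 𝓘(ℝ, H) d).source := by
  simp only [overlap, PartialEquiv.trans_source, PartialEquiv.symm_source, mem_inter_iff,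
    mem_preimage]

theorem chart_mem_overlap {c d y : X} (hc : y ∈ (extChartAt 𝓘(ℝ, H) c).source)
    (hd : y ∈ (extChartAt 𝓘(ℝ, H) d).source) : extChartAt 𝓘(ℝ, H) c y ∈ overlap H c d := by
  rw [mem_overlap, PartialEquiv.left_inv _ hc]
  exact ⟨PartialEquiv.map_source _ hc, hd⟩

theorem coordChange_chart {c d y : X} (hc : y ∈ (extChartAt 𝓘(ℝ, H) c).source) :
    coordChange H c d (extChartAt 𝓘(ℝ, H) c y) = extChartAt 𝓘(ℝ, H) d y := by
  rw [coordChange, Function.comp_apply, PartialEquiv.left_inv _ hc]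

theorem isOpen_overlap (c d : X) : IsOpen (overlap H c d) := by
  rw [overlap, PartialEquiv.trans_source, PartialEquiv.symm_source]
  exact (continuousOn_extChartAt_symm c).isOpen_inter_preimage (isOpen_extChartAt_target c)
    (isOpen_extChartAt_source d)

theorem coordChange_mem_overlap {c d : X} {z : H} (hz : z ∈ overlap H c d) :
    coordChange H c d z ∈ overlap H d c := by
  rw [mem_overlap] at hz
  exact chart_mem_overlap hz.2 (PartialEquiv.map_target _ hz.1)

theorem coordChange_coordChange {c d : X} {z : H} (hz : z ∈ overlap H c d) :
    coordChange H d c (coordChange H c d z) = z := by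
  rw [mem_overlap] at hz
  rw [coordChange, coordChange, Function.comp_apply, Function.comp_apply,
    PartialEquiv.left_inv _ hz.2, PartialEquiv.right_inv _ hz.1]

variable [IsManifold 𝓘(ℝ, H) ∞ X]

theorem contDiffOn_coordChange (c d : X) : ContDiffOn ℝ ∞ (coordChange H c d) (overlap H c d) :=
  contDiffOn_ext_coord_change (I := 𝓘(ℝ, H)) d c

theorem contDiffOn_jacobian (c d : X) : ContDiffOn ℝ ∞ (jacobian H c d) (overlap H c d) :=
  (contDiffOn_coordChange c d).fderiv_of_isOpen (isOpen_overlap c d) (by norm_cast)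

theorem hasFDerivAt_coordChange {c d : X} {z : H} (hz : z ∈ overlap H c d) :
    HasFDerivAt (coordChange H c d) (jacobian H c d z) z :=
  (((contDiffOn_coordChange c d).differentiableOn (by norm_num)).differentiableAt
    ((isOpen_overlap c d).mem_nhds hz)).hasFDerivAt

theorem hasFDerivAt_jacobian {c d : X} {z : H} (hz : z ∈ overlap H c d) :
    HasFDerivAt (jacobian H c d) (fderiv ℝ (jacobian H c d) z) z :=
  (((contDiffOn_jacobian c d).differentiableOn (by norm_num)).differentiableAt
    ((isOpen_overlap c d).mem_nhds hz)).hasFDerivAt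

theorem fderiv_jacobian_symm {c d : X} {z : H} (hz : z ∈ overlap H c d) (v w : H) :
    fderiv ℝ (jacobian H c d) z v w = fderiv ℝ (jacobian H c d) z w v :=
  (((contDiffOn_coordChange c d).contDiffAt
    ((isOpen_overlap c d).mem_nhds hz)).isSymmSndFDerivAt (by
      rw [minSmoothness_of_isRCLikeNormedField]
      exact WithTop.coe_le_coe.2 le_top)).eq v w

theorem jacobian_jacobian {c d : X} {z : H} (hz : z ∈ overlap H c d) (v : H) :
    jacobian H d c (coordChange H c d z) (jacobian H c d z v) = v := by
  have hchain := (hasFDerivAt_coordChange (coordChange_mem_overlap hz)).comp z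
    (hasFDerivAt_coordChange hz)
  have hid : HasFDerivAt (coordChange H d c ∘ coordChange H c d) (.id ℝ H) z := by
    refine (hasFDerivAt_id z).congr_of_eventuallyEq ?_
    filter_upwards [(isOpen_overlap c d).mem_nhds hz] with y hy
    exact coordChange_coordChange hy
  exact DFunLike.congr_fun (hchain.unique hid) v

theorem jacobian_jacobian' {c d : X} {z : H} (hz : z ∈ overlap H c d) (v : H) :
    jacobian H c d z (jacobian H d c (coordChange H c d z) v) = v := by
  have h := jacobian_jacobian (coordChange_mem_overlap hz) v
  rwa [coordChange_coordChange hz] at h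

theorem toModel_eq_tangentCoordChange {c y : X} (hy : y ∈ (extChartAt 𝓘(ℝ, H) c).source)
    (v : TangentSpace 𝓘(ℝ, H) y) :
    toModel c y v = tangentCoordChange 𝓘(ℝ, H) y c y (by exact v) := by
  rw [extChartAt_source] at hy
  rw [toModel, TangentBundle.continuousLinearMapAt_trivializationAt_eq_core hy]
  rfl

theorem toModel_eq_jacobian {c d y : X} (hc : y ∈ (extChartAt 𝓘(ℝ, H) c).source)
    (hd : y ∈ (extChartAt 𝓘(ℝ, H) d).source) (v : TangentSpace 𝓘(ℝ, H) y) :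
    toModel d y v = jacobian H c d (extChartAt 𝓘(ℝ, H) c y) (toModel c y v) := by
  have hjac : jacobian H c d (extChartAt 𝓘(ℝ, H) c y) = tangentCoordChange 𝓘(ℝ, H) c d y := by
    rw [tangentCoordChange_def, modelWithCornersSelf_coe, range_id, fderivWithin_univ]
    rfl
  rw [hjac]
  refine (toModel_eq_tangentCoordChange hd v).trans ?_
  rw [toModel_eq_tangentCoordChange hc]
  exact (tangentCoordChange_comp ⟨⟨mem_extChartAt_source y, hc⟩, hd⟩).symm

theorem fromModel_toModel {c y : X} (hy : y ∈ (extChartAt 𝓘(ℝ, H) c).source)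
    (v : TangentSpace 𝓘(ℝ, H) y) : fromModel c y (toModel c y v) = v := by
  rw [extChartAt_source] at hy
  exact Bundle.Trivialization.symmL_continuousLinearMapAt _ hy v

theorem toModel_fromModel {c y : X} (hy : y ∈ (extChartAt 𝓘(ℝ, H) c).source) (v : H) :
    toModel c y (fromModel c y v) = v := by
  rw [extChartAt_source] at hy
  exact Bundle.Trivialization.continuousLinearMapAt_symmL _ hy v

theorem contMDiffOn_fromModel (c : X) (v : H) :
    ContMDiffOn 𝓘(ℝ, H) (𝓘(ℝ, H).prod 𝓘(ℝ, H)) ∞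
      (fun y : X => (⟨y, fromModel c y v⟩ : Bundle.TotalSpace H (TangentSpace 𝓘(ℝ, H))))
      (chartAt H c).source := by
  have hsection := (trivializationAt H (TangentSpace 𝓘(ℝ, H)) c).contMDiffOn_section_baseSet_iff
    (IB := 𝓘(ℝ, H)) (n := ∞) (s := fun y : X => fromModel c y v)
  rw [TangentBundle.trivializationAt_baseSet] at hsection
  refine hsection.2 ((contMDiffOn_const (c := v)).congr fun y hy => ?_)
  have htriv := toModel_fromModel (c := c) (y := y) (by rwa [extChartAt_source]) v
  rwa [toModel, Bundle.Trivialization.continuousLinearMapAt_apply,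
    Bundle.Trivialization.coe_linearMapAt_of_mem _ (by simpa using hy)] at htriv

theorem fromModel_eq_jacobian {c d y : X} (hc : y ∈ (extChartAt 𝓘(ℝ, H) c).source)
    (hd : y ∈ (extChartAt 𝓘(ℝ, H) d).source) (v : H) :
    fromModel c y v = fromModel d y (jacobian H c d (extChartAt 𝓘(ℝ, H) c y) v) := by
  conv_rhs => rw [← toModel_fromModel hc v, ← toModel_eq_jacobian hc hd, fromModel_toModel hd]

theorem toModel_velocity {γ : ℝ → X} {t : ℝ} {c : X}
    (hγ : MDifferentiableAt 𝓘(ℝ, ℝ) 𝓘(ℝ, H) γ t) (hc : γ t ∈ (extChartAt 𝓘(ℝ, H) c).source) :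
    toModel c (γ t) (velocity H γ t) = deriv (fun r => extChartAt 𝓘(ℝ, H) c (γ r)) t := by
  have hc' : γ t ∈ (chartAt H c).source := by rwa [extChartAt_source] at hc
  have hchain := mfderiv_comp t (mdifferentiableAt_extChartAt (I := 𝓘(ℝ, H)) hc') hγ
  rw [mfderiv_eq_fderiv] at hchain
  have hderiv : deriv (fun r => extChartAt 𝓘(ℝ, H) c (γ r)) t =
      mfderiv 𝓘(ℝ, H) 𝓘(ℝ, H) (extChartAt 𝓘(ℝ, H) c) (γ t) (velocity H γ t) :=
    DFunLike.congr_fun hchain (1 : ℝ)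
  have hchart : mfderiv 𝓘(ℝ, H) 𝓘(ℝ, H) (extChartAt 𝓘(ℝ, H) c) (γ t) =
      tangentCoordChange 𝓘(ℝ, H) (γ t) c (γ t) :=
    mfderiv_chartAt_eq_tangentCoordChange hc'
  refine (toModel_eq_tangentCoordChange hc _).trans (Eq.trans ?_ hderiv.symm)
  exact (DFunLike.congr_fun hchart _).symm

theorem contDiffAt_extChartAt_comp {γ : ℝ → X} {t : ℝ} {c : X}
    (hγ : ContMDiffAt 𝓘(ℝ, ℝ) 𝓘(ℝ, H) ∞ γ t) (hc : γ t ∈ (extChartAt 𝓘(ℝ, H) c).source) :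
    ContDiffAt ℝ ∞ (fun r => extChartAt 𝓘(ℝ, H) c (γ r)) t := by
  have hc' : γ t ∈ (chartAt H c).source := by rwa [extChartAt_source] at hc
  exact ((contMDiffAt_extChartAt' (I := 𝓘(ℝ, H)) hc').comp t hγ).contDiffAt

end Transition

section Christoffel

open Set Filter Topology

theorem christoffelLower_apply {H : Type*} [NormedAddCommGroup H] [NormedSpace ℝ H]
    (G : H → H →L[ℝ] H →L[ℝ] ℝ) (z v w y : H) :
    christoffelLower G z v w y =
      1 / 2 * (fderiv ℝ G z v w y + fderiv ℝ G z w v y - fderiv ℝ G z y v w) := by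
  simp [christoffelLower]

theorem christoffelLower_pullback {H : Type*} [NormedAddCommGroup H] [NormedSpace ℝ H]
    {G G' : H → H →L[ℝ] H →L[ℝ] ℝ} {ψ : H → H} {J : H → H →L[ℝ] H} {D : H →L[ℝ] H →L[ℝ] H} {z : H}
    (hψ : HasFDerivAt ψ (J z) z) (hJ : HasFDerivAt J D z) (hD : ∀ v w, D v w = D w v)
    (hG : DifferentiableAt ℝ G z) (hG' : DifferentiableAt ℝ G' (ψ z))
    (hsymm : ∀ v w, G' (ψ z) v w = G' (ψ z) w v)
    (h : ∀ᶠ y in 𝓝 z, ∀ v w, G y v w = G' (ψ y) (J y v) (J y w)) (v w y : H) :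
    christoffelLower G z v w y =
      christoffelLower G' (ψ z) (J z v) (J z w) (J z y) + G' (ψ z) (D v w) (J z y) := by
  have hfderiv : ∀ a v w, fderiv ℝ G z a v w = fderiv ℝ G' (ψ z) (J z a) (J z v) (J z w) +
      G' (ψ z) (D a v) (J z w) + G' (ψ z) (J z v) (D a w) := by
    intro a v w
    have hleft := (hG.hasFDerivAt.clm_apply (hasFDerivAt_const v z)).clm_apply
      (hasFDerivAt_const w z)
    have hright := ((hG'.hasFDerivAt.comp z hψ).clm_apply
      (hJ.clm_apply (hasFDerivAt_const v z))).clm_apply (hJ.clm_apply (hasFDerivAt_const w z))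
    have heq := DFunLike.congr_fun
      (hleft.unique (hright.congr_of_eventuallyEq (h.mono fun y hy => hy v w))) a
    simp only [ContinuousLinearMap.comp_zero, zero_add, ContinuousLinearMap.flip_apply,
      Function.comp_apply, ContinuousLinearMap.flip_add, _root_.add_apply,
      ContinuousLinearMap.comp_apply] at heq
    rw [heq]
    ring
  rw [christoffelLower_apply, christoffelLower_apply, hfderiv, hfderiv, hfderiv, hD w v,
    hD y v, hD y w, hsymm (J z w) (D v y), hsymm (J z v)]
  ring

variable {H : Type*} [NormedAddCommGroup H] [NormedSpace ℝ H]
variable {X : Type*} [TopologicalSpace X] [ChartedSpace H X] [IsManifold 𝓘(ℝ, H) ∞ X]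
variable [Bundle.RiemannianBundle (fun x : X => TangentSpace 𝓘(ℝ, H) x)]

theorem metricInChart_apply (c : X) (z v w : H) : metricInChart c z v w =
    inner ℝ (fromModel c ((extChartAt 𝓘(ℝ, H) c).symm z) v)
      (fromModel c ((extChartAt 𝓘(ℝ, H) c).symm z) w) := rfl

theorem metricInChart_symm (c : X) (z v w : H) :
    metricInChart c z v w = metricInChart c z w v := by
  rw [metricInChart_apply, metricInChart_apply, real_inner_comm]

theorem eq_zero_of_metricInChart_self {c : X} {z : H}
    (hz : z ∈ (extChartAt 𝓘(ℝ, H) c).target) {v : H} (h : metricInChart c z v v = 0) : v = 0 := by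
  rw [metricInChart_apply, inner_self_eq_zero] at h
  rw [← toModel_fromModel (PartialEquiv.map_target _ hz) v, h, map_zero]

theorem metricInChart_extChartAt {c y : X} (hy : y ∈ (extChartAt 𝓘(ℝ, H) c).source) (v w : H) :
    metricInChart c (extChartAt 𝓘(ℝ, H) c y) v w =
      inner ℝ (fromModel c y v) (fromModel c y w) := by
  rw [metricInChart_apply, PartialEquiv.left_inv _ hy]

theorem eq_of_forall_metricInChart {c : X} {z : H} (hz : z ∈ (extChartAt 𝓘(ℝ, H) c).target)
    {v w : H} (h : ∀ y, metricInChart c z v y = metricInChart c z w y) : v = w := by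
  refine sub_eq_zero.1 (eq_zero_of_metricInChart_self hz ?_)
  rw [map_sub (metricInChart c z)]
  exact sub_eq_zero.2 (h _)

theorem metricInChart_coordChange {c d : X} {z : H} (hz : z ∈ overlap H c d) (v w : H) :
    metricInChart c z v w =
      metricInChart d (coordChange H c d z) (jacobian H c d z v) (jacobian H c d z w) := by
  rw [mem_overlap] at hz
  have hpoint : (extChartAt 𝓘(ℝ, H) d).symm (coordChange H c d z) =
      (extChartAt 𝓘(ℝ, H) c).symm z := PartialEquiv.left_inv _ hz.2
  have hsource := PartialEquiv.map_target _ hz.1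
  rw [metricInChart_apply, metricInChart_apply, hpoint, fromModel_eq_jacobian hsource hz.2 v,
    fromModel_eq_jacobian hsource hz.2 w, PartialEquiv.right_inv _ hz.1]

/-- The Christoffel symbols of the second kind in the preferred chart at `c`. Unlike `christoffel`,
which only knows the chart centred at the base point, they can be differentiated along a chart. -/
def christoffelInChart (c : X) (z v : H) : H →L[ℝ] H :=
  (metricInChart c z).inverse.comp (christoffelLower (metricInChart c) z v)

theorem christoffelInChart_add (c : X) (z v w : H) :
    christoffelInChart c z (v + w) = christoffelInChart c z v + christoffelInChart c z w := by
  rw [christoffelInChart, christoffelLower_add, ContinuousLinearMap.comp_add]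
  rfl

theorem christoffelInChart_smul (c : X) (z : H) (r : ℝ) (v : H) :
    christoffelInChart c z (r • v) = r • christoffelInChart c z v := by
  rw [christoffelInChart, christoffelLower_smul, ContinuousLinearMap.comp_smul]
  rfl

variable [FiniteDimensional ℝ H]

theorem metricInChart_isInvertible {c : X} {z : H} (hz : z ∈ (extChartAt 𝓘(ℝ, H) c).target) :
    (metricInChart c z : H →L[ℝ] H →L[ℝ] ℝ).IsInvertible := by
  have hinj : Function.Injective (metricInChart c z) := by
    rw [injective_iff_map_eq_zero]
    intro v hv
    exact eq_zero_of_metricInChart_self hz (by rw [hv]; rfl)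
  have hdim : Module.finrank ℝ H = Module.finrank ℝ (H →L[ℝ] ℝ) := by
    rw [(LinearMap.toContinuousLinearMap (𝕜 := ℝ) (E := H) (F' := ℝ)).symm.finrank_eq]
    exact (Subspace.dual_finrank_eq (K := ℝ) (V := H)).symm
  refine ⟨(LinearEquiv.ofInjectiveOfFinrankEq
    (metricInChart c z : H →ₗ[ℝ] H →L[ℝ] ℝ) hinj hdim).toContinuousLinearEquiv, rfl⟩

theorem metricInChart_christoffelInChart {c : X} {z : H} (hz : z ∈ (extChartAt 𝓘(ℝ, H) c).target)
    (v w y : H) : metricInChart c z (christoffelInChart c z v w) y =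
      christoffelLower (metricInChart c) z v w y := by
  rw [christoffelInChart, ContinuousLinearMap.comp_apply,
    (metricInChart_isInvertible hz).self_apply_inverse]

theorem toModel_christoffel (x : X) (v w : TangentSpace 𝓘(ℝ, H) x) :
    toModel x x (christoffel x v w) =
      christoffelInChart x (extChartAt 𝓘(ℝ, H) x x) (toModel x x v) (toModel x x w) := by
  have hx := mem_extChartAt_source (I := 𝓘(ℝ, H)) x
  have hz : extChartAt 𝓘(ℝ, H) x x ∈ (extChartAt 𝓘(ℝ, H) x).target := mem_extChartAt_target x
  refine eq_of_forall_metricInChart hz fun y => ?_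
  rw [metricInChart_christoffelInChart hz, metricInChart_extChartAt hx, fromModel_toModel hx]
  refine (InnerProductSpace.toDual_symm_apply).trans ?_
  change christoffelLower (metricInChart x) (extChartAt 𝓘(ℝ, H) x x) (toModel x x v)
    (toModel x x w) (toModel x x (fromModel x x y)) = _
  rw [toModel_fromModel hx]

variable [IsContMDiffRiemannianBundle 𝓘(ℝ, H) ∞ H (fun x : X => TangentSpace 𝓘(ℝ, H) x)]

theorem contDiffOn_metricInChart (c : X) :
    ContDiffOn ℝ ∞ (metricInChart c : H → H →L[ℝ] H →L[ℝ] ℝ) (extChartAt 𝓘(ℝ, H) c).target := by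
  refine contDiffOn_clm_apply.2 fun v => contDiffOn_clm_apply.2 fun w => ?_
  have hinner := ContMDiffOn.inner_bundle (E := fun x : X => TangentSpace 𝓘(ℝ, H) x)
    (contMDiffOn_fromModel c v) (contMDiffOn_fromModel c w)
  exact (hinner.comp (contMDiffOn_extChartAt_symm (n := ∞) (I := 𝓘(ℝ, H)) c) fun z hz => by
    rw [mem_preimage, ← extChartAt_source 𝓘(ℝ, H)]
    exact PartialEquiv.map_target _ hz).contDiffOn

theorem contDiffOn_christoffelInChart (c : X) :
    ContDiffOn ℝ ∞ (fun p : H × H => christoffelInChart c p.1 p.2)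
      ((extChartAt 𝓘(ℝ, H) c).target ×ˢ univ) := by
  have hmetric := contDiffOn_metricInChart (H := H) c
  have hfst : MapsTo (Prod.fst : H × H → H) ((extChartAt 𝓘(ℝ, H) c).target ×ˢ univ)
    (extChartAt 𝓘(ℝ, H) c).target := fun p hp => hp.1
  have hfderiv : ContDiffOn ℝ ∞ (fun p : H × H => fderiv ℝ (metricInChart c) p.1)
      ((extChartAt 𝓘(ℝ, H) c).target ×ˢ univ) :=
    (hmetric.fderiv_of_isOpen (isOpen_extChartAt_target c) (by norm_cast)).comp
      contDiff_fst.contDiffOn hfst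
  have hinv : ContDiffOn ℝ ∞ (fun p : H × H => (metricInChart c p.1).inverse)
      ((extChartAt 𝓘(ℝ, H) c).target ×ˢ univ) := fun p hp => by
    have hp_inv := (metricInChart_isInvertible (c := c) (hfst hp)).contDiffAt_map_inverse (n := ∞)
    exact hp_inv.comp_contDiffWithinAt p ((hmetric.comp contDiff_fst.contDiffOn hfst) p hp)
  have hflip : ContDiffOn ℝ ∞ (fun p : H × H => (fderiv ℝ (metricInChart c) p.1).flip p.2)
      ((extChartAt 𝓘(ℝ, H) c).target ×ˢ univ) :=
    ((ContinuousLinearMap.flipₗᵢ ℝ H H (H →L[ℝ] ℝ)).contDiff.comp_contDiffOn hfderiv).clm_apply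
      contDiffOn_snd
  exact hinv.clm_comp ((((hfderiv.clm_apply contDiffOn_snd).add hflip).sub
    ((ContinuousLinearMap.flipₗᵢ ℝ H H ℝ).contDiff.comp_contDiffOn hflip)).const_smul (1 / 2 : ℝ))

theorem jacobian_christoffelInChart {c d : X} {z : H} (hz : z ∈ overlap H c d) (v w : H) :
    jacobian H c d z (christoffelInChart c z v w) =
      christoffelInChart d (coordChange H c d z) (jacobian H c d z v) (jacobian H c d z w) +
        fderiv ℝ (jacobian H c d) z v w := by
  have hzc := (mem_overlap.1 hz).1
  have hzd := (mem_overlap.1 (coordChange_mem_overlap hz)).1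
  have hnhds := (isOpen_overlap (H := H) c d).mem_nhds hz
  have hdiff : ∀ {e : X} {y : H}, y ∈ (extChartAt 𝓘(ℝ, H) e).target →
      DifferentiableAt ℝ (metricInChart e : H → H →L[ℝ] H →L[ℝ] ℝ) y := fun hy =>
    ((contDiffOn_metricInChart _).differentiableOn (by norm_num)).differentiableAt
      ((isOpen_extChartAt_target _).mem_nhds hy)
  refine eq_of_forall_metricInChart hzd fun y => ?_
  obtain ⟨y, rfl⟩ : ∃ y', y = jacobian H c d z y' := ⟨_, (jacobian_jacobian' hz y).symm⟩
  rw [← metricInChart_coordChange hz, metricInChart_christoffelInChart hzc, map_add,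
    _root_.add_apply,
    metricInChart_christoffelInChart hzd]
  refine christoffelLower_pullback (hasFDerivAt_coordChange hz) (hasFDerivAt_jacobian hz)
    (fderiv_jacobian_symm hz)
    (hdiff hzc) (hdiff hzd) (metricInChart_symm d _) ?_ v w y
  filter_upwards [hnhds] with y hy
  exact metricInChart_coordChange hy

end Christoffel

section ChartEquations

open Set Filter Topology

variable {H : Type*} [NormedAddCommGroup H] [NormedSpace ℝ H]
variable {X : Type*} [TopologicalSpace X] [ChartedSpace H X]

theorem eventually_mem_extChartAt_source {γ : ℝ → X} {t : ℝ} {c : X} (hγ : ContinuousAt γ t)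
    (hc : γ t ∈ (extChartAt 𝓘(ℝ, H) c).source) :
    ∀ᶠ r in 𝓝 t, γ r ∈ (extChartAt 𝓘(ℝ, H) c).source :=
  hγ.eventually_mem ((isOpen_extChartAt_source c).mem_nhds hc)

theorem extChartAt_comp_eventuallyEq {γ : ℝ → X} {t : ℝ} {c : X} (d : X)
    (hγ : ContinuousAt γ t) (hc : γ t ∈ (extChartAt 𝓘(ℝ, H) c).source) :
    (fun r => extChartAt 𝓘(ℝ, H) d (γ r)) =ᶠ[𝓝 t]
      fun r => coordChange H c d (extChartAt 𝓘(ℝ, H) c (γ r)) := by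
  filter_upwards [eventually_mem_extChartAt_source hγ hc] with r hr
  exact (coordChange_chart hr).symm

variable [IsManifold 𝓘(ℝ, H) ∞ X]

theorem deriv_extChartAt_comp {γ : ℝ → X} {t : ℝ} {c d : X}
    (hγ : MDifferentiableAt 𝓘(ℝ, ℝ) 𝓘(ℝ, H) γ t) (hc : γ t ∈ (extChartAt 𝓘(ℝ, H) c).source)
    (hd : γ t ∈ (extChartAt 𝓘(ℝ, H) d).source) :
    deriv (fun r => extChartAt 𝓘(ℝ, H) d (γ r)) t =
      jacobian H c d (extChartAt 𝓘(ℝ, H) c (γ t))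
        (deriv (fun r => extChartAt 𝓘(ℝ, H) c (γ r)) t) := by
  rw [← toModel_velocity hγ hc, ← toModel_velocity hγ hd, toModel_eq_jacobian hc hd]

theorem hasDerivAt_deriv_coordChange {ζ : ℝ → H} {t : ℝ} {c d : X}
    (hζ : ContDiffAt ℝ ∞ ζ t) (hmem : ζ t ∈ overlap H c d) :
    HasDerivAt (deriv fun r => coordChange H c d (ζ r))
      (fderiv ℝ (jacobian H c d) (ζ t) (deriv ζ t) (deriv ζ t) +
        jacobian H c d (ζ t) (deriv (deriv ζ) t)) t := by
  have hdiff : ∀ᶠ r in 𝓝 t, ContDiffAt ℝ 1 ζ r :=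
    (hζ.of_le (by norm_cast)).eventually (by simp)
  have hderiv : (deriv fun r => coordChange H c d (ζ r)) =ᶠ[𝓝 t]
      fun r => jacobian H c d (ζ r) (deriv ζ r) := by
    filter_upwards [hdiff, hζ.continuousAt.eventually_mem ((isOpen_overlap c d).mem_nhds hmem)]
      with r hr hr'
    exact ((hasFDerivAt_coordChange hr').comp_hasDerivAt r
      (hr.differentiableAt (by norm_num)).hasDerivAt).deriv
  have hζ' : ContDiffAt ℝ ∞ (deriv ζ) t :=
    (hζ.fderiv_right (m := ∞) (by norm_cast)).clm_apply contDiffAt_const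
  exact (((hasFDerivAt_jacobian hmem).comp_hasDerivAt t
    (hζ.differentiableAt (by norm_num)).hasDerivAt).clm_apply
      (hζ'.differentiableAt (by norm_num)).hasDerivAt).congr_of_eventuallyEq hderiv

theorem hasFDerivAt_jacobian_inverse {c d : X} {z : H} (hz : z ∈ overlap H c d) :
    ∃ D : H →L[ℝ] H →L[ℝ] H, HasFDerivAt (fun y => jacobian H d c (coordChange H c d y)) D z ∧
      ∀ v w, D v w = -jacobian H d c (coordChange H c d z)
        (fderiv ℝ (jacobian H c d) z v (jacobian H d c (coordChange H c d z) w)) := by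
  have hinv := (hasFDerivAt_jacobian (coordChange_mem_overlap hz)).comp z
      (hasFDerivAt_coordChange hz)
  refine ⟨_, hinv, fun v w => ?_⟩
  have hcomp : HasFDerivAt (fun y => (jacobian H d c (coordChange H c d y)).comp (jacobian H c d y))
      (0 : H →L[ℝ] H →L[ℝ] H) z := by
    refine (hasFDerivAt_const (ContinuousLinearMap.id ℝ H) z).congr_of_eventuallyEq ?_
    filter_upwards [(isOpen_overlap c d).mem_nhds hz] with y hy
    ext v
    exact jacobian_jacobian hy v
  have hzero := DFunLike.congr_fun
    (DFunLike.congr_fun ((hinv.clm_comp (hasFDerivAt_jacobian hz)).unique hcomp) v)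
    (jacobian H d c (coordChange H c d z) w)
  rw [eq_neg_iff_add_eq_zero, add_comm]
  simpa [jacobian_jacobian' hz] using hzero

section Geodesic

variable [FiniteDimensional ℝ H]
variable [Bundle.RiemannianBundle (fun x : X => TangentSpace 𝓘(ℝ, H) x)]
variable [IsContMDiffRiemannianBundle 𝓘(ℝ, H) ∞ H (fun x : X => TangentSpace 𝓘(ℝ, H) x)]

theorem IsGeodesicOn.hasDerivAt_deriv {γ : ℝ → X} {J : Set ℝ} (h : IsGeodesicOn H γ J) {t : ℝ}
    (ht : t ∈ J) {c : X} (hc : γ t ∈ (extChartAt 𝓘(ℝ, H) c).source) :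
    HasDerivAt (deriv fun r => extChartAt 𝓘(ℝ, H) c (γ r))
      (-christoffelInChart c (extChartAt 𝓘(ℝ, H) c (γ t))
        (deriv (fun r => extChartAt 𝓘(ℝ, H) c (γ r)) t)
        (deriv (fun r => extChartAt 𝓘(ℝ, H) c (γ r)) t)) t := by
  obtain ⟨hγ, hgeod⟩ := h t ht
  have hdiff := hγ.mdifferentiableAt (by norm_num)
  have hd := mem_extChartAt_source (I := 𝓘(ℝ, H)) (γ t)
  have hmem := chart_mem_overlap hd hc
  refine ((hasDerivAt_deriv_coordChange (contDiffAt_extChartAt_comp hγ hd) hmem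
    ).congr_of_eventuallyEq
      (extChartAt_comp_eventuallyEq c hγ.continuousAt hd).deriv).congr_deriv ?_
  rw [iteratedDeriv_succ, iteratedDeriv_one, toModel_christoffel, toModel_velocity hdiff hd]
    at hgeod
  rw [eq_neg_of_add_eq_zero_left hgeod, map_neg, jacobian_christoffelInChart hmem,
      ← deriv_extChartAt_comp hdiff hd hc,
    coordChange_chart hd]
  abel

end Geodesic

variable {lam mu : YoungDiagram}

/-- The change of components of elements of `E` from the preferred chart at `c` to the one at `d`,
at the point with coordinate `z` in the former. -/
def tensorChange (lam mu : YoungDiagram) (c d : X) (z : H) :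
    Schur lam mu H →L[ℝ] Schur lam mu H :=
  schurMap (jacobian H c d z) (jacobian H d c (coordChange H c d z))

variable [FiniteDimensional ℝ H]

theorem contDiffOn_tensorChange (c d : X) :
    ContDiffOn ℝ ∞ (tensorChange (H := H) lam mu c d) (overlap H c d) :=
  ContDiff.comp_contDiffOn (f := fun z => (jacobian H c d z, jacobian H d c (coordChange H c d z)))
    (contDiff_schurMap (V := H) (W := H)) ((contDiffOn_jacobian c d).prodMk
      ((contDiffOn_jacobian d c).comp (contDiffOn_coordChange c d)
        fun _ => coordChange_mem_overlap))

variable [Bundle.RiemannianBundle (fun x : X => TangentSpace 𝓘(ℝ, H) x)]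

omit [FiniteDimensional ℝ H] in
theorem eToModel_eq_tensorChange {c d y : X} (hc : y ∈ (extChartAt 𝓘(ℝ, H) c).source)
    (hd : y ∈ (extChartAt 𝓘(ℝ, H) d).source) (e : EFib H lam mu y) :
    eToModel lam mu d y e =
      tensorChange lam mu c d (extChartAt 𝓘(ℝ, H) c y) (eToModel lam mu c y e) := by
  refine schur_ext fun θ v => ?_
  rw [tensorChange, coordChange_chart hc]
  change e.1 (fun i => (θ i).comp (toModel d y)) (fun i => fromModel d y (v i)) =
    e.1 (fun i => ((θ i).comp (jacobian H c d (extChartAt 𝓘(ℝ, H) c y))).comp (toModel c y))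
      (fun i => fromModel c y (jacobian H d c (extChartAt 𝓘(ℝ, H) d y) (v i)))
  congr 2
  · funext i
    ext w
    exact congrArg (θ i) (toModel_eq_jacobian hc hd w)
  · funext i
    exact fromModel_eq_jacobian hd hc (v i)

variable [IsContMDiffRiemannianBundle 𝓘(ℝ, H) ∞ H (fun x : X => TangentSpace 𝓘(ℝ, H) x)]

/-- Since `dS/dt + Γ(v) S` is the covariant derivative of `S` along the curve, this says that
covariant derivatives along curves are independent of the chart. -/
theorem hasDerivWithinAt_tensorChange {c d : X} {ζ : ℝ → H} {v : H} {I : Set ℝ} {t : ℝ}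
    {S : ℝ → Schur lam mu H} {S' : Schur lam mu H} (hζ : HasDerivWithinAt ζ v I t)
    (hS : HasDerivWithinAt S S' I t) (hz : ζ t ∈ overlap H c d) :
    HasDerivWithinAt (fun r => tensorChange lam mu c d (ζ r) (S r))
      (tensorChange lam mu c d (ζ t) (S' + schurAct (christoffelInChart c (ζ t) v) (S t)) -
        schurAct (christoffelInChart d (coordChange H c d (ζ t)) (jacobian H c d (ζ t) v))
          (tensorChange lam mu c d (ζ t) (S t))) I t := by
  obtain ⟨D, hD, hDapply⟩ := hasFDerivAt_jacobian_inverse hz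
  refine (hasDerivWithinAt_schurMap ((hasFDerivAt_jacobian hz).comp_hasDerivWithinAt t hζ)
    (hD.comp_hasDerivWithinAt t hζ) hS (jacobian_jacobian hz) (fun w => hDapply v w)).congr_deriv ?_
  have hconj :
      ((jacobian H c d (ζ t)).comp (christoffelInChart c (ζ t) v)).comp
          (jacobian H d c (coordChange H c d (ζ t))) =
        christoffelInChart d (coordChange H c d (ζ t)) (jacobian H c d (ζ t) v) +
          (fderiv ℝ (jacobian H c d) (ζ t) v).comp (jacobian H d c (coordChange H c d (ζ t))) := by
    ext w
    simp [jacobian_christoffelInChart hz, jacobian_jacobian' hz]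
  rw [map_add, tensorChange, schurMap_schurAct (jacobian_jacobian hz), hconj, schurAct_add]
  simp only [Function.comp]
  abel

end ChartEquations

section TensorComponents

variable {H : Type*} [NormedAddCommGroup H] [NormedSpace ℝ H]
variable {X : Type*} [TopologicalSpace X] [ChartedSpace H X] [IsManifold 𝓘(ℝ, H) ∞ X]
variable [Bundle.RiemannianBundle (fun x : X => TangentSpace 𝓘(ℝ, H) x)]
variable {lam mu : YoungDiagram}

theorem schurMap_fromModel_toModel {c y : X} (hy : y ∈ (extChartAt 𝓘(ℝ, H) c).source)
    (e : EFib H lam mu y) :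
    schurMap (V := H) (W := TangentSpace 𝓘(ℝ, H) y) (fromModel c y) (toModel c y)
      (eToModel lam mu c y e) = e := by
  refine schur_ext fun θ v => ?_
  change e.1 (fun i => ((θ i).comp (fromModel c y)).comp (toModel c y))
    (fun i => fromModel c y (toModel c y (v i))) = e.1 θ v
  congr 2
  · funext i
    ext w
    exact congrArg (θ i) (fromModel_toModel hy w)
  · funext i
    exact fromModel_toModel hy (v i)

theorem eToModel_schurMap_fromModel {c y : X} (hy : y ∈ (extChartAt 𝓘(ℝ, H) c).source)
    (e : Schur lam mu H) :
    eToModel lam mu c y (schurMap (V := H) (W := TangentSpace 𝓘(ℝ, H) y) (fromModel c y)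
      (toModel c y) e) = e := by
  refine schur_ext fun θ v => ?_
  change e.1 (fun i => ((θ i).comp (toModel c y)).comp (fromModel c y))
    (fun i => toModel c y (fromModel c y (v i))) = e.1 θ v
  congr 2
  · funext i
    ext w
    exact congrArg (θ i) (toModel_fromModel hy w)
  · funext i
    exact toModel_fromModel hy (v i)

theorem eToModel_injective {c y : X} (hy : y ∈ (extChartAt 𝓘(ℝ, H) c).source) :
    Function.Injective (eToModel lam mu c y : EFib H lam mu y → Schur lam mu H) := fun a b h => by
  rw [← schurMap_fromModel_toModel hy a, h, schurMap_fromModel_toModel hy b]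

theorem eToModel_kFromModel {k : ℕ} (x : X) (M : KSchur lam mu H k)
    (m : Fin k → TangentSpace 𝓘(ℝ, H) x) :
    eToModel lam mu x x (kFromModel x x M m) = M fun i => toModel x x (m i) :=
  eToModel_schurMap_fromModel (mem_extChartAt_source x) _

/-- The components of a section of `E` in the preferred chart at `c`, as a function of the
coordinate. -/
def compInChart (u : ∀ x : X, EFib H lam mu x) (c : X) (z : H) : Schur lam mu H :=
  eToModel lam mu c ((extChartAt 𝓘(ℝ, H) c).symm z) (u ((extChartAt 𝓘(ℝ, H) c).symm z))

theorem compInChart_extChartAt (u : ∀ x : X, EFib H lam mu x) {c y : X}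
    (hy : y ∈ (extChartAt 𝓘(ℝ, H) c).source) :
    compInChart u c (extChartAt 𝓘(ℝ, H) c y) = eToModel lam mu c y (u y) := by
  rw [compInChart, PartialEquiv.left_inv _ hy]

theorem compInChart_coordChange (u : ∀ x : X, EFib H lam mu x) {c d : X} {z : H}
    (hz : z ∈ overlap H c d) :
    compInChart u d (coordChange H c d z) = tensorChange lam mu c d z (compInChart u c z) := by
  obtain ⟨hzc, hzd⟩ := mem_overlap.1 hz
  have h := eToModel_eq_tensorChange (PartialEquiv.map_target _ hzc) hzd
    (u ((extChartAt 𝓘(ℝ, H) c).symm z))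
  rw [PartialEquiv.right_inv _ hzc] at h
  exact (compInChart_extChartAt u hzd).trans h

theorem IsSmoothSection.contDiffOn_compInChart {u : ∀ x : X, EFib H lam mu x}
    (hu : IsSmoothSection u) (c : X) :
    ContDiffOn ℝ ∞ (compInChart u c) (extChartAt 𝓘(ℝ, H) c).target :=
  ((hu c).comp (contMDiffOn_extChartAt_symm (n := ∞) (I := 𝓘(ℝ, H)) c) fun _ hz =>
    (extChartAt_source 𝓘(ℝ, H) c).subset (PartialEquiv.map_target _ hz)).contDiffOn

theorem IsSmoothSection.hasFDerivAt_compInChart {u : ∀ x : X, EFib H lam mu x}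
    (hu : IsSmoothSection u) {c : X} {z : H} (hz : z ∈ (extChartAt 𝓘(ℝ, H) c).target) :
    HasFDerivAt (compInChart u c) (fderiv ℝ (compInChart u c) z) z :=
  (((hu.contDiffOn_compInChart c).differentiableOn (by norm_num)).differentiableAt
    ((isOpen_extChartAt_target c).mem_nhds hz)).hasFDerivAt

end TensorComponents

section CovariantDerivative

open Set Filter Topology

variable {H : Type*} [NormedAddCommGroup H] [NormedSpace ℝ H] [FiniteDimensional ℝ H]
variable {X : Type*} [TopologicalSpace X] [ChartedSpace H X] [IsManifold 𝓘(ℝ, H) ∞ X]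
variable [Bundle.RiemannianBundle (fun x : X => TangentSpace 𝓘(ℝ, H) x)]
variable {lam mu : YoungDiagram}

theorem eToModel_eGamma (x : X) (v : TangentSpace 𝓘(ℝ, H) x) (e : EFib H lam mu x) :
    eToModel lam mu x x (eGamma x v e) =
      schurAct (christoffelInChart x (extChartAt 𝓘(ℝ, H) x x) (toModel x x v))
        (eToModel lam mu x x e) := by
  have hx := mem_extChartAt_source (I := 𝓘(ℝ, H)) x
  refine (schurMap_schurAct (V := TangentSpace 𝓘(ℝ, H) x) (W := H) (P := toModel x x)
    (Q := fromModel x x) (fromModel_toModel hx) (christoffel x v) e).trans ?_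
  congr 2
  ext w
  refine (toModel_christoffel x v (fromModel x x w)).trans ?_
  rw [toModel_fromModel hx]

theorem eToModel_nablaAt {k : ℕ} (s : ∀ x : X, KFib H lam mu k x) (x : X)
    (v : TangentSpace 𝓘(ℝ, H) x) (m : Fin k → TangentSpace 𝓘(ℝ, H) x) :
    eToModel lam mu x x (nablaAt s x v m) =
      fderiv ℝ (sectionInChart s x) (extChartAt 𝓘(ℝ, H) x x) (toModel x x v)
        (fun i => toModel x x (m i)) +
      (schurAct (christoffelInChart x (extChartAt 𝓘(ℝ, H) x x) (toModel x x v))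
          (eToModel lam mu x x (s x m)) -
        ∑ i, eToModel lam mu x x (s x (Function.update m i (christoffel x v (m i))))) := by
  have hnabla : nablaAt s x v m =
      kFromModel x x (fderiv ℝ (sectionInChart s x) (extChartAt 𝓘(ℝ, H) x x) (toModel x x v)) m +
        kGamma x v (s x) m := rfl
  have hGamma : kGamma x v (s x) m = eGamma x v (s x m) -
      ∑ i, s x (Function.update m i (christoffel x v (m i))) :=
    congrArg (eGamma x v (s x m) - ·)
      (slotSum_apply (V := TangentSpace 𝓘(ℝ, H) x) (christoffel x v) (s x) m)
  rw [hnabla, map_add, eToModel_kFromModel, hGamma, map_sub, eToModel_eGamma, map_sum]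

/-- The components of `∇ u` in the preferred chart at `c`: the derivative of the components of `u`
corrected by the Christoffel symbols. -/
def covInChart (u : ∀ x : X, EFib H lam mu x) (c : X) (z : H) : H →L[ℝ] Schur lam mu H :=
  LinearMap.toContinuousLinearMap
    { toFun := fun v =>
        fderiv ℝ (compInChart u c) z v + schurAct (christoffelInChart c z v) (compInChart u c z)
      map_add' := fun v w => by
        simp only [map_add, christoffelInChart_add, schurAct_add]
        abel
      map_smul' := fun r v => by
        simp only [map_smul, christoffelInChart_smul, schurAct_smul, smul_add, RingHom.id_apply] }

theorem covInChart_apply (u : ∀ x : X, EFib H lam mu x) (c : X) (z v : H) :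
    covInChart u c z v =
      fderiv ℝ (compInChart u c) z v + schurAct (christoffelInChart c z v) (compInChart u c z) :=
  rfl

theorem sectionInChart_nablaIter_zero (u : ∀ x : X, EFib H lam mu x) (c : X) (z : H) :
    sectionInChart (nablaIter u 0) c z =
      (continuousMultilinearCurryFin0 ℝ H (Schur lam mu H)).symm (compInChart u c z) := by
  ext1 m
  rfl

theorem eToModel_nablaIter_one_self {u : ∀ x : X, EFib H lam mu x} (hu : IsSmoothSection u)
    (x : X) (m : Fin 1 → TangentSpace 𝓘(ℝ, H) x) :
    eToModel lam mu x x (nablaIter u 1 x m) =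
      covInChart u x (extChartAt 𝓘(ℝ, H) x x) (toModel x x (m 0)) := by
  have hdiff : DifferentiableAt ℝ (sectionInChart (nablaIter u 0) x) (extChartAt 𝓘(ℝ, H) x x) := by
    rw [funext (sectionInChart_nablaIter_zero u x)]
    exact (continuousMultilinearCurryFin0 ℝ H
      (Schur lam mu H)).symm.toContinuousLinearEquiv.differentiableAt.comp _
        (hu.hasFDerivAt_compInChart (mem_extChartAt_target x)).differentiableAt
  refine (eToModel_nablaAt (nablaIter u 0) x (m 0) (Fin.tail m)).trans ?_
  rw [← fderiv_continuousMultilinear_apply_const_apply hdiff, Finset.univ_eq_empty,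
    Finset.sum_empty, sub_zero, covInChart_apply,
    compInChart_extChartAt u (mem_extChartAt_source x)]
  rfl

variable [IsContMDiffRiemannianBundle 𝓘(ℝ, H) ∞ H (fun x : X => TangentSpace 𝓘(ℝ, H) x)]

theorem covInChart_coordChange {u : ∀ x : X, EFib H lam mu x} (hu : IsSmoothSection u) {c d : X}
    {z : H} (hz : z ∈ overlap H c d) (v : H) :
    covInChart u d (coordChange H c d z) (jacobian H c d z v) =
      tensorChange lam mu c d z (covInChart u c z v) := by
  obtain ⟨ζ, hζ, rfl⟩ : ∃ ζ : ℝ → H, HasDerivAt ζ v 0 ∧ ζ 0 = z :=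
    ⟨fun r => z + r • v, by simpa using ((hasDerivAt_id (0 : ℝ)).smul_const v).const_add z,
      by simp⟩
  have hc := (hu.hasFDerivAt_compInChart (mem_overlap.1 hz).1).comp_hasDerivAt 0 hζ
  have hd := (hu.hasFDerivAt_compInChart
    (mem_overlap.1 (coordChange_mem_overlap hz)).1).comp_hasDerivAt 0
      ((hasFDerivAt_coordChange hz).comp_hasDerivAt 0 hζ)
  have htensor := hasDerivWithinAt_tensorChange (c := c) (d := d)
    (hζ.hasDerivWithinAt (s := univ)) hc.hasDerivWithinAt hz
  have hchange : (fun r => tensorChange lam mu c d (ζ r) (compInChart u c (ζ r))) =ᶠ[𝓝 0]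
      fun r => compInChart u d (coordChange H c d (ζ r)) := by
    filter_upwards [hζ.continuousAt.eventually_mem ((isOpen_overlap c d).mem_nhds hz)] with r hr
    exact (compInChart_coordChange u hr).symm
  have hfderiv := (hd.congr_of_eventuallyEq hchange).unique (hasDerivWithinAt_univ.1 htensor)
  rw [covInChart_apply, hfderiv, compInChart_coordChange u hz, covInChart_apply]
  simp only [Function.comp_apply]
  abel

theorem eToModel_nablaIter_one {u : ∀ x : X, EFib H lam mu x} (hu : IsSmoothSection u) {c y : X}
    (hy : y ∈ (extChartAt 𝓘(ℝ, H) c).source) (m : Fin 1 → TangentSpace 𝓘(ℝ, H) y) :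
    eToModel lam mu c y (nablaIter u 1 y m) =
      covInChart u c (extChartAt 𝓘(ℝ, H) c y) (toModel c y (m 0)) := by
  have hyy := mem_extChartAt_source (I := 𝓘(ℝ, H)) y
  rw [eToModel_eq_tensorChange hyy hy, eToModel_nablaIter_one_self hu,
    ← covInChart_coordChange hu (chart_mem_overlap hyy hy), coordChange_chart hyy,
    ← toModel_eq_jacobian hyy hy]

theorem sectionInChart_nablaIter_one {u : ∀ x : X, EFib H lam mu x} (hu : IsSmoothSection u)
    {c : X} {z : H} (hz : z ∈ (extChartAt 𝓘(ℝ, H) c).target) :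
    sectionInChart (nablaIter u 1) c z =
      (continuousMultilinearCurryFin1 ℝ H (Schur lam mu H)).symm (covInChart u c z) := by
  ext1 m
  have hsource := PartialEquiv.map_target _ hz
  refine (eToModel_nablaIter_one hu hsource (fun i => fromModel c _ (m i))).trans ?_
  rw [PartialEquiv.right_inv _ hz, toModel_fromModel hsource]
  rfl

theorem contDiffOn_covInChart {u : ∀ x : X, EFib H lam mu x} (hu : IsSmoothSection u) (c : X) :
    ContDiffOn ℝ ∞ (covInChart u c) (extChartAt 𝓘(ℝ, H) c).target := by
  refine contDiffOn_clm_apply.2 fun v => ?_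
  have hfderiv : ContDiffOn ℝ ∞ (fun z => fderiv ℝ (compInChart u c) z v)
      (extChartAt 𝓘(ℝ, H) c).target :=
    ((hu.contDiffOn_compInChart c).fderiv_of_isOpen (isOpen_extChartAt_target c)
      (by norm_cast)).clm_apply contDiffOn_const
  have hchr : ContDiffOn ℝ ∞ (fun z => christoffelInChart c z v) (extChartAt 𝓘(ℝ, H) c).target :=
    ContDiffOn.comp (g := fun p : H × H => christoffelInChart c p.1 p.2) (f := fun z => (z, v))
      (contDiffOn_christoffelInChart c) (contDiff_prodMk_left v).contDiffOn
      fun z hz => ⟨hz, mem_univ v⟩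
  exact hfderiv.add (((schurActL lam mu H).contDiff.comp_contDiffOn hchr).clm_apply
    (hu.contDiffOn_compInChart c))

theorem eToModel_nablaIter_two {u : ∀ x : X, EFib H lam mu x} (hu : IsSmoothSection u) (x : X)
    (m : Fin 2 → TangentSpace 𝓘(ℝ, H) x) :
    eToModel lam mu x x (nablaIter u 2 x m) =
      fderiv ℝ (covInChart u x) (extChartAt 𝓘(ℝ, H) x x) (toModel x x (m 0)) (toModel x x (m 1)) +
      schurAct (christoffelInChart x (extChartAt 𝓘(ℝ, H) x x) (toModel x x (m 0)))
        (covInChart u x (extChartAt 𝓘(ℝ, H) x x) (toModel x x (m 1))) -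
      covInChart u x (extChartAt 𝓘(ℝ, H) x x)
        (christoffelInChart x (extChartAt 𝓘(ℝ, H) x x) (toModel x x (m 0))
          (toModel x x (m 1))) := by
  have hx := mem_extChartAt_source (I := 𝓘(ℝ, H)) x
  have htarget := (isOpen_extChartAt_target (I := 𝓘(ℝ, H)) x).mem_nhds (mem_extChartAt_target x)
  let curry : (H →L[ℝ] Schur lam mu H) →L[ℝ] KSchur lam mu H 1 :=
    (continuousMultilinearCurryFin1 ℝ H (Schur lam mu H)).symm.toContinuousLinearEquiv
  have hfderiv : HasFDerivAt (sectionInChart (nablaIter u 1) x)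
      (curry.comp (fderiv ℝ (covInChart u x) (extChartAt 𝓘(ℝ, H) x x)))
      (extChartAt 𝓘(ℝ, H) x x) :=
    (curry.hasFDerivAt.comp _ (((contDiffOn_covInChart hu x).differentiableOn
      (by norm_num)).differentiableAt htarget).hasFDerivAt).congr_of_eventuallyEq
        (Filter.mem_of_superset htarget fun z hz => sectionInChart_nablaIter_one hu hz)
  have h := eToModel_nablaAt (nablaIter u 1) x (m 0) (Fin.tail m)
  rw [hfderiv.fderiv, eToModel_nablaIter_one hu hx, Fin.sum_univ_one,
    eToModel_nablaIter_one hu hx, Function.update_self, toModel_christoffel] at h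
  refine h.trans ?_
  rw [add_sub_assoc]
  rfl

end CovariantDerivative

section ParallelTransport

open Set Filter Topology

variable {H : Type*} [NormedAddCommGroup H] [NormedSpace ℝ H] [FiniteDimensional ℝ H]
variable {X : Type*} [TopologicalSpace X] [ChartedSpace H X] [IsManifold 𝓘(ℝ, H) ∞ X]
variable [Bundle.RiemannianBundle (fun x : X => TangentSpace 𝓘(ℝ, H) x)]
variable {lam mu : YoungDiagram} {γ : ℝ → X} {s : ∀ r, EFib H lam mu (γ r)} {I : Set ℝ} {t : ℝ}
  {c d : X}

/-- The section `s` of `E` along `γ` satisfies the equation of parallel transport at time `t`,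
written in the preferred chart at `c`; the time derivative is taken within `I`. -/
def IsParallelInChartAt (c : X) (γ : ℝ → X) (s : ∀ r, EFib H lam mu (γ r)) (I : Set ℝ)
    (t : ℝ) : Prop :=
  HasDerivWithinAt (fun r => eToModel lam mu c (γ r) (s r))
    (-schurAct (christoffelInChart c (extChartAt 𝓘(ℝ, H) c (γ t))
      (deriv (fun r => extChartAt 𝓘(ℝ, H) c (γ r)) t)) (eToModel lam mu c (γ t) (s t))) I t

/-- The section `s` of `E` along `γ` is parallel on `[a, b]`; `IsParallel` is the case of the unit
interval. -/
def IsParallelOn (γ : ℝ → X) (s : ∀ r, EFib H lam mu (γ r)) (a b : ℝ) : Prop :=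
  ∀ t ∈ Icc a b, HasDerivWithinAt (fun r => eToModel lam mu (γ t) (γ r) (s r))
    (-eToModel lam mu (γ t) (γ t) (eGamma (γ t) (velocity H γ t) (s t))) (Icc a b) t

variable [IsContMDiffRiemannianBundle 𝓘(ℝ, H) ∞ H (fun x : X => TangentSpace 𝓘(ℝ, H) x)]

theorem IsParallelInChartAt.change_chart (h : IsParallelInChartAt c γ s I t) (htI : t ∈ I)
    (hγ : ContMDiffAt 𝓘(ℝ, ℝ) 𝓘(ℝ, H) ∞ γ t) (hc : γ t ∈ (extChartAt 𝓘(ℝ, H) c).source)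
    (hd : γ t ∈ (extChartAt 𝓘(ℝ, H) d).source) : IsParallelInChartAt d γ s I t := by
  have hζ := ((contDiffAt_extChartAt_comp hγ hc).differentiableAt (by norm_num)).hasDerivAt
  have htensor := hasDerivWithinAt_tensorChange (c := c) (d := d) hζ.hasDerivWithinAt h
    (chart_mem_overlap hc hd)
  rw [neg_add_cancel, map_zero, zero_sub, coordChange_chart hc,
    ← deriv_extChartAt_comp (hγ.mdifferentiableAt (by norm_num)) hc hd,
    ← eToModel_eq_tensorChange hc hd] at htensor
  refine htensor.congr_of_eventuallyEq_of_mem (nhdsWithin_le_nhds ?_) htI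
  filter_upwards [eventually_mem_extChartAt_source hγ.continuousAt hc,
    eventually_mem_extChartAt_source hγ.continuousAt hd] with r hrc hrd
  exact eToModel_eq_tensorChange hrc hrd (s r)

theorem hasDerivWithinAt_neg_eGamma_iff (htI : t ∈ I)
    (hγ : ContMDiffAt 𝓘(ℝ, ℝ) 𝓘(ℝ, H) ∞ γ t) (hc : γ t ∈ (extChartAt 𝓘(ℝ, H) c).source) :
    HasDerivWithinAt (fun r => eToModel lam mu (γ t) (γ r) (s r))
      (-eToModel lam mu (γ t) (γ t) (eGamma (γ t) (velocity H γ t) (s t))) I t ↔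
    IsParallelInChartAt c γ s I t := by
  have hself := mem_extChartAt_source (I := 𝓘(ℝ, H)) (γ t)
  rw [eToModel_eGamma, toModel_velocity (hγ.mdifferentiableAt (by norm_num)) hself]
  exact ⟨fun h => IsParallelInChartAt.change_chart h htI hγ hself hc,
    fun h => h.change_chart htI hγ hc hself⟩

variable {a b : ℝ}

theorem isParallelOn_iff (hγ : ∀ t ∈ Icc a b, ContMDiffAt 𝓘(ℝ, ℝ) 𝓘(ℝ, H) ∞ γ t)
    (hc : ∀ t ∈ Icc a b, γ t ∈ (extChartAt 𝓘(ℝ, H) c).source) :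
    IsParallelOn γ s a b ↔ ∀ t ∈ Icc a b, IsParallelInChartAt c γ s (Icc a b) t :=
  forall₂_congr fun t ht => hasDerivWithinAt_neg_eGamma_iff ht (hγ t ht) (hc t ht)

end ParallelTransport

section GeodesicEquation

open Set Filter Topology

variable {H : Type*} [NormedAddCommGroup H] [NormedSpace ℝ H] [FiniteDimensional ℝ H]
variable {X : Type*} [TopologicalSpace X] [ChartedSpace H X] [IsManifold 𝓘(ℝ, H) ∞ X]

/-- Position and velocity of a curve in the preferred chart at `c`. -/
def chartState (c : X) (γ : ℝ → X) (t : ℝ) : H × H :=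
  (extChartAt 𝓘(ℝ, H) c (γ t), deriv (fun r => extChartAt 𝓘(ℝ, H) c (γ r)) t)

/-- The curve `γ` lies at time `t` in the domain of the preferred chart at `c`, and its position and
velocity there are given by `q`. -/
structure HasChartState (c : X) (γ : ℝ → X) (t : ℝ) (q : H × H) : Prop where
  mem_source : γ t ∈ (extChartAt 𝓘(ℝ, H) c).source
  chartState_eq : chartState c γ t = q

namespace HasChartState

variable {c d : X} {γ : ℝ → X} {t : ℝ} {q : H × H}

omit [FiniteDimensional ℝ H] [IsManifold 𝓘(ℝ, H) ∞ X] in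
theorem fst_eq (h : HasChartState c γ t q) : extChartAt 𝓘(ℝ, H) c (γ t) = q.1 :=
  congrArg Prod.fst h.chartState_eq

omit [FiniteDimensional ℝ H] [IsManifold 𝓘(ℝ, H) ∞ X] in
theorem snd_eq (h : HasChartState c γ t q) :
    deriv (fun r => extChartAt 𝓘(ℝ, H) c (γ r)) t = q.2 :=
  congrArg Prod.snd h.chartState_eq

omit [FiniteDimensional ℝ H] [IsManifold 𝓘(ℝ, H) ∞ X] in
theorem fst_mem_target (h : HasChartState c γ t q) : q.1 ∈ (extChartAt 𝓘(ℝ, H) c).target :=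
  h.fst_eq ▸ PartialEquiv.map_source _ h.mem_source

omit [FiniteDimensional ℝ H] in
theorem change_chart (h : HasChartState c γ t q) (hγ : MDifferentiableAt 𝓘(ℝ, ℝ) 𝓘(ℝ, H) γ t)
    (hd : γ t ∈ (extChartAt 𝓘(ℝ, H) d).source) :
    HasChartState d γ t (coordChange H c d q.1, jacobian H c d q.1 q.2) := by
  refine ⟨hd, ?_⟩
  rw [← h.fst_eq, ← h.snd_eq, coordChange_chart h.mem_source,
    ← deriv_extChartAt_comp hγ h.mem_source hd, chartState]

end HasChartState

variable [Bundle.RiemannianBundle (fun x : X => TangentSpace 𝓘(ℝ, H) x)]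

/-- The geodesic vector field in the preferred chart at `c`: its integral curves are the positions
and velocities of geodesics. -/
def geodesicField (c : X) (p : H × H) : H × H := (p.2, -christoffelInChart c p.1 p.2 p.2)

/-- On `J`, the curve `p` solves the geodesic equation in the preferred chart at `c`. -/
structure IsGeodesicInChart (c : X) (p : ℝ → H × H) (J : Set ℝ) : Prop where
  mem_target : ∀ t ∈ J, (p t).1 ∈ (extChartAt 𝓘(ℝ, H) c).target
  hasDerivAt : ∀ t ∈ J, HasDerivAt p (geodesicField c (p t)) t

variable [IsContMDiffRiemannianBundle 𝓘(ℝ, H) ∞ H (fun x : X => TangentSpace 𝓘(ℝ, H) x)]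

theorem contDiffOn_geodesicField (c : X) :
    ContDiffOn ℝ ∞ (geodesicField (H := H) c) ((extChartAt 𝓘(ℝ, H) c).target ×ˢ univ) :=
  contDiffOn_snd.prodMk (((contDiffOn_christoffelInChart c).clm_apply contDiffOn_snd).neg)

variable {c : X} {γ : ℝ → X} {J : Set ℝ} {p : ℝ → H × H} {t : ℝ}

theorem IsGeodesicOn.hasDerivAt_chartState (h : IsGeodesicOn H γ J) (ht : t ∈ J)
    (hc : γ t ∈ (extChartAt 𝓘(ℝ, H) c).source) :
    HasDerivAt (chartState (H := H) c γ) (geodesicField c (chartState c γ t)) t :=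
  ((contDiffAt_extChartAt_comp (h t ht).1 hc).differentiableAt (by norm_num)).hasDerivAt.prodMk
    (h.hasDerivAt_deriv ht hc)

theorem IsGeodesicOn.eventually_hasChartState (hγ : IsGeodesicOn H γ J)
    (hp : IsGeodesicInChart c p J) (hJ : J ∈ 𝓝 t) (ht : HasChartState c γ t (p t)) :
    ∀ᶠ r in 𝓝 t, HasChartState c γ r (p r) := by
  have htJ := mem_of_mem_nhds hJ
  have htarget : (extChartAt 𝓘(ℝ, H) c).target ×ˢ (univ : Set H) ∈ 𝓝 (p t) :=
    ((isOpen_extChartAt_target c).prod isOpen_univ).mem_nhds ⟨hp.mem_target t htJ, mem_univ _⟩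
  obtain ⟨K, s, hs, hK⟩ := (((contDiffOn_geodesicField (H := H) c).contDiffAt htarget).of_le
    (by norm_cast : (1 : ℕ∞ω) ≤ ∞)).exists_lipschitzOnWith
  have hsource := eventually_mem_extChartAt_source (hγ t htJ).1.continuousAt ht.mem_source
  have hstate : ∀ᶠ r in 𝓝 t,
      HasDerivAt (chartState (H := H) c γ) (geodesicField c (chartState c γ r)) r ∧
        chartState c γ r ∈ s := by
    filter_upwards [hsource, hJ, (hγ.hasDerivAt_chartState htJ
      ht.mem_source).continuousAt.eventually_mem (ht.chartState_eq.symm ▸ hs)] with r hrc hrJ hrs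
    exact ⟨hγ.hasDerivAt_chartState hrJ hrc, hrs⟩
  have hsol : ∀ᶠ r in 𝓝 t, HasDerivAt p (geodesicField c (p r)) r ∧ p r ∈ s := by
    filter_upwards [(hp.hasDerivAt t htJ).continuousAt.eventually_mem hs, hJ] with r hrs hrJ
    exact ⟨hp.hasDerivAt r hrJ, hrs⟩
  filter_upwards [hsource, ODE_solution_unique_of_eventually
    (Eventually.of_forall fun _ => hK) hstate hsol ht.chartState_eq] with r hrc hr
  exact ⟨hrc, hr⟩

theorem IsGeodesicOn.hasChartState_of_frequently [T2Space X] (hγ : IsGeodesicOn H γ J)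
    (hp : IsGeodesicInChart c p J) (ht : t ∈ J)
    (hfreq : ∃ᶠ r in 𝓝 t, HasChartState c γ r (p r)) : HasChartState c γ t (p t) := by
  have hcont : ContinuousAt (fun r => (extChartAt 𝓘(ℝ, H) c).symm (p r).1) t :=
    ContinuousAt.comp (f := fun r => (p r).1) ((continuousOn_extChartAt_symm c).continuousAt
      ((isOpen_extChartAt_target c).mem_nhds (hp.mem_target t ht)))
      (continuous_fst.continuousAt.comp (hp.hasDerivAt t ht).continuousAt)
  have heq : γ t = (extChartAt 𝓘(ℝ, H) c).symm (p t).1 :=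
    tendsto_nhds_unique_of_frequently_eq (hγ t ht).1.continuousAt hcont
      (hfreq.mono fun r hr => by rw [← hr.fst_eq, PartialEquiv.left_inv _ hr.mem_source])
  have hsource : γ t ∈ (extChartAt 𝓘(ℝ, H) c).source :=
    heq ▸ PartialEquiv.map_target _ (hp.mem_target t ht)
  exact ⟨hsource, tendsto_nhds_unique_of_frequently_eq
    (hγ.hasDerivAt_chartState ht hsource).continuousAt (hp.hasDerivAt t ht).continuousAt
    (hfreq.mono fun r hr => hr.chartState_eq)⟩

theorem IsGeodesicOn.hasChartState [T2Space X] (hγ : IsGeodesicOn H γ J)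
    (hp : IsGeodesicInChart c p J) (hJo : IsOpen J) (hJ : IsPreconnected J) {t₀ : ℝ}
    (ht₀ : t₀ ∈ J) (h₀ : HasChartState c γ t₀ (p t₀)) (ht : t ∈ J) :
    HasChartState c γ t (p t) := by
  suffices J ⊆ {r | r ∈ J ∧ HasChartState c γ r (p r)} from (this ht).2
  refine hJ.subset_of_closure_inter_subset (isOpen_iff_mem_nhds.2 ?_) ⟨t₀, ht₀, ht₀, h₀⟩ ?_
  · rintro r ⟨hr, hrp⟩
    filter_upwards [hJo.mem_nhds hr,
      hγ.eventually_hasChartState hp (hJo.mem_nhds hr) hrp] with q hqJ hq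
    exact ⟨hqJ, hq⟩
  · rintro r ⟨hrcl, hr⟩
    exact ⟨hr, hγ.hasChartState_of_frequently hp hr
      ((mem_closure_iff_frequently.1 hrcl).mono fun q hq => hq.2)⟩

end GeodesicEquation

section TransportMatrix

open Set Filter Topology

theorem eq_of_hasDerivWithinAt_zero {E : Type*} [NormedAddCommGroup E] [NormedSpace ℝ E]
    {f : ℝ → E} {a b : ℝ} (hab : a ≤ b) (h : ∀ t ∈ Icc a b, HasDerivWithinAt f 0 (Icc a b) t) :
    f b = f a :=
  constant_of_has_deriv_right_zero (fun t ht => (h t ht).continuousWithinAt)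
    (fun t ht => (h t ⟨ht.1, ht.2.le⟩).mono_of_mem_nhdsWithin (Icc_mem_nhdsGE_of_mem ht)) b
    ⟨hab, le_rfl⟩

theorem hasDerivWithinAt_Icc_of_split {E : Type*} [NormedAddCommGroup E] [NormedSpace ℝ E]
    {f : ℝ → E} {f' : E} {a b d t : ℝ} (hab : a ≤ b) (hbd : b ≤ d)
    (hleft : t ≤ b → HasDerivWithinAt f f' (Icc a b) t)
    (hright : b ≤ t → HasDerivWithinAt f f' (Icc b d) t) :
    HasDerivWithinAt f f' (Icc a d) t := by
  rw [← Icc_union_Icc_eq_Icc hab hbd]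
  have trivial_of_notMem : ∀ {p q : ℝ}, t ∉ Icc p q → HasDerivWithinAt f f' (Icc p q) t :=
    fun h => HasFDerivWithinAt.of_notMem_closure (by rwa [isClosed_Icc.closure_eq])
  rcases lt_trichotomy t b with h | rfl | h
  · exact (hleft h.le).union (trivial_of_notMem fun h' => h.not_ge h'.1)
  · exact (hleft le_rfl).union (hright le_rfl)
  · exact (trivial_of_notMem fun h' => h.not_ge h'.2).union (hright h.le)

variable {H : Type*} [NormedAddCommGroup H] [NormedSpace ℝ H] [FiniteDimensional ℝ H]
variable {X : Type*} [TopologicalSpace X] [ChartedSpace H X] [IsManifold 𝓘(ℝ, H) ∞ X]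
variable [Bundle.RiemannianBundle (fun x : X => TangentSpace 𝓘(ℝ, H) x)]
variable {lam mu : YoungDiagram}

namespace IsParallelOn

variable {γ : ℝ → X} {a b d a' b' : ℝ}

theorem mono {s : ∀ t : ℝ, EFib H lam mu (γ t)} (h : IsParallelOn γ s a b) (ha : a ≤ a')
    (hb : b' ≤ b) : IsParallelOn γ s a' b' :=
  fun t ht => (h t ⟨ha.trans ht.1, ht.2.trans hb⟩).mono (Icc_subset_Icc ha hb)

theorem of_self (s : ∀ t : ℝ, EFib H lam mu (γ t)) : IsParallelOn γ s a a := fun t _ => by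
  rw [Icc_self]
  exact HasFDerivWithinAt.of_subsingleton subsingleton_singleton

theorem glue {s₁ s₂ : ∀ t : ℝ, EFib H lam mu (γ t)} (hab : a ≤ b) (hbd : b ≤ d)
    (h₁ : IsParallelOn γ s₁ a b) (h₂ : IsParallelOn γ s₂ b d) (h : s₁ b = s₂ b) :
    ∃ s : ∀ t : ℝ, EFib H lam mu (γ t), IsParallelOn γ s a d ∧ s d = s₂ d := by
  classical
  let s : ∀ t : ℝ, EFib H lam mu (γ t) := fun t => if t ≤ b then s₁ t else s₂ t
  have hleft : ∀ t ≤ b, s t = s₁ t := fun t ht => if_pos ht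
  have hright : ∀ t, b ≤ t → s t = s₂ t := fun t ht => by
    rcases ht.eq_or_lt with rfl | hlt
    · rw [hleft _ le_rfl, h]
    · exact if_neg hlt.not_ge
  refine ⟨s, fun t ht => hasDerivWithinAt_Icc_of_split hab hbd (fun htb => ?_) (fun htb => ?_),
    hright d hbd⟩
  · rw [hleft t htb]
    refine (h₁ t ⟨ht.1, htb⟩).congr_of_mem (fun r hr => ?_) ⟨ht.1, htb⟩
    rw [hleft r hr.2]
  · rw [hright t htb]
    refine (h₂ t ⟨htb, ht.2⟩).congr_of_mem (fun r hr => ?_) ⟨htb, ht.2⟩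
    rw [hright r hr.1]

end IsParallelOn

/-- Every vector over `γ b` extends to a parallel section over `[a, b]`, and `M` is the matrix of
the parallel transport from time `b` to time `a`, in the preferred charts at `d` and `c`. -/
structure IsTransportMatrix (γ : ℝ → X) (c d : X) (a b : ℝ)
    (M : Schur lam mu H →L[ℝ] Schur lam mu H) : Prop where
  apply_eq : ∀ s : ∀ t : ℝ, EFib H lam mu (γ t), IsParallelOn γ s a b →
    M (eToModel lam mu d (γ b) (s b)) = eToModel lam mu c (γ a) (s a)
  exists_isParallelOn : ∀ e : EFib H lam mu (γ b), ∃ s : ∀ t : ℝ, EFib H lam mu (γ t),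
    IsParallelOn γ s a b ∧ s b = e

namespace IsTransportMatrix

variable {γ : ℝ → X} {c d d' : X} {a b t : ℝ} {M N : Schur lam mu H →L[ℝ] Schur lam mu H}

theorem refl (ha : γ a ∈ (extChartAt 𝓘(ℝ, H) c).source) :
    IsTransportMatrix γ c c a a (1 : Schur lam mu H →L[ℝ] Schur lam mu H) where
  apply_eq _ _ := rfl
  exists_isParallelOn e :=
    ⟨fun t => schurMap (V := H) (W := TangentSpace 𝓘(ℝ, H) (γ t)) (fromModel c (γ t))
      (toModel c (γ t)) (eToModel lam mu c (γ a) e), .of_self _, schurMap_fromModel_toModel ha e⟩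

theorem trans (hM : IsTransportMatrix γ c d a b M) (hN : IsTransportMatrix γ d d' b t N)
    (hab : a ≤ b) (hbt : b ≤ t) : IsTransportMatrix γ c d' a t (M.comp N) where
  apply_eq s hs := by
    rw [ContinuousLinearMap.comp_apply, hN.apply_eq s (hs.mono hab le_rfl),
      hM.apply_eq s (hs.mono le_rfl hbt)]
  exists_isParallelOn e := by
    obtain ⟨s₂, hs₂, he⟩ := hN.exists_isParallelOn e
    obtain ⟨s₁, hs₁, heq⟩ := hM.exists_isParallelOn (s₂ b)
    obtain ⟨s, hs, hse⟩ := hs₁.glue hab hbt hs₂ heq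
    exact ⟨s, hs, hse.trans he⟩

theorem change_chart (h : IsTransportMatrix γ c d a b M)
    (hd : γ b ∈ (extChartAt 𝓘(ℝ, H) d).source) (hd' : γ b ∈ (extChartAt 𝓘(ℝ, H) d').source) :
    IsTransportMatrix γ c d' a b
      (M.comp (tensorChange lam mu d' d (extChartAt 𝓘(ℝ, H) d' (γ b)))) where
  apply_eq s hs := by
    rw [ContinuousLinearMap.comp_apply, ← eToModel_eq_tensorChange hd' hd, h.apply_eq s hs]
  exists_isParallelOn := h.exists_isParallelOn

end IsTransportMatrix

end TransportMatrix

section FrameSolution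

open Set Filter Topology

variable {H : Type*} [NormedAddCommGroup H] [NormedSpace ℝ H]
variable {X : Type*} [TopologicalSpace X] [ChartedSpace H X] [IsManifold 𝓘(ℝ, H) ∞ X]
variable [Bundle.RiemannianBundle (fun x : X => TangentSpace 𝓘(ℝ, H) x)]
variable {lam mu : YoungDiagram}

/-- In the preferred chart at `c`: a solution `p` of the geodesic equation, together with the matrix
`K` of the parallel transport along it and its inverse `N`. Carrying both along makes smooth
dependence of `N` on the initial data part of the same flow. -/
structure IsFrameSolution (c : X) (p : ℝ → H × H) (N K : ℝ → Schur lam mu H →L[ℝ] Schur lam mu H)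
    (J : Set ℝ) : Prop extends IsGeodesicInChart c p J where
  hasDerivAt_left : ∀ t ∈ J,
    HasDerivAt N ((N t).comp (schurAct (christoffelInChart c (p t).1 (p t).2))) t
  hasDerivAt_right : ∀ t ∈ J,
    HasDerivAt K (-((schurAct (christoffelInChart c (p t).1 (p t).2)).comp (K t))) t

namespace IsFrameSolution

variable {c : X} {p : ℝ → H × H} {N K : ℝ → Schur lam mu H →L[ℝ] Schur lam mu H} {J : Set ℝ}
  {a b : ℝ}

theorem mono (h : IsFrameSolution c p N K J) {J' : Set ℝ} (hJ : J' ⊆ J) :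
    IsFrameSolution c p N K J' where
  mem_target t ht := h.mem_target t (hJ ht)
  hasDerivAt t ht := h.hasDerivAt t (hJ ht)
  hasDerivAt_left t ht := h.hasDerivAt_left t (hJ ht)
  hasDerivAt_right t ht := h.hasDerivAt_right t (hJ ht)

theorem shift (h : IsFrameSolution c p N K J) (t₁ : ℝ) :
    IsFrameSolution c (fun t => p (t - t₁)) (fun t => N (t - t₁)) (fun t => K (t - t₁))
      {t | t - t₁ ∈ J} where
  mem_target _ ht := h.mem_target _ ht
  hasDerivAt t ht := (h.hasDerivAt _ ht).comp_sub_const t t₁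
  hasDerivAt_left t ht := (h.hasDerivAt_left _ ht).comp_sub_const t t₁
  hasDerivAt_right t ht := (h.hasDerivAt_right _ ht).comp_sub_const t t₁

theorem rescale (h : IsFrameSolution c p N K J) (r : ℝ) :
    IsFrameSolution c (fun t => ((p (r * t)).1, r • (p (r * t)).2)) (fun t => N (r * t))
      (fun t => K (r * t)) {t | r * t ∈ J} := by
  have hmul : ∀ t, HasDerivAt (fun t => r * t) r t := fun t => by
    simpa using (hasDerivAt_id t).const_mul r
  refine ⟨⟨fun t ht => h.mem_target _ ht, fun t ht => ?_⟩, fun t ht => ?_, fun t ht => ?_⟩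
  · have hp := HasDerivAt.scomp t (h.hasDerivAt _ ht) (hmul t)
    have hfst : HasDerivAt (fun t => (p (r * t)).1) (r • geodesicField c (p (r * t))).1 t := hp.fst
    have hsnd : HasDerivAt (fun t => (p (r * t)).2) (r • geodesicField c (p (r * t))).2 t := hp.snd
    refine (hfst.prodMk (hsnd.const_smul r)).congr_deriv ?_
    simp [geodesicField, christoffelInChart_smul]
  · refine (HasDerivAt.scomp t (h.hasDerivAt_left _ ht) (hmul t)).congr_deriv ?_
    ext1 w
    simp [christoffelInChart_smul, schurAct_smul]
  · refine (HasDerivAt.scomp t (h.hasDerivAt_right _ ht) (hmul t)).congr_deriv ?_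
    ext1 w
    simp [christoffelInChart_smul, schurAct_smul]

theorem left_comp_right (h : IsFrameSolution c p N K J) (hab : a ≤ b) (hJ : Icc a b ⊆ J)
    (hN : N a = 1) (hK : K a = 1) : (N b).comp (K b) = .id ℝ _ := by
  have hconst := eq_of_hasDerivWithinAt_zero (f := fun t => (N t).comp (K t)) hab fun t ht => by
    refine (((h.hasDerivAt_left t (hJ ht)).clm_comp (h.hasDerivAt_right t (hJ ht))).congr_deriv
      ?_).hasDerivWithinAt
    ext1 w
    simp
  refine hconst.trans ?_
  rw [hN, hK]
  rfl

variable [FiniteDimensional ℝ H]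

theorem right_apply_left (h : IsFrameSolution c p N K J) (hab : a ≤ b) (hJ : Icc a b ⊆ J)
    (hN : N a = 1) (hK : K a = 1) (e : Schur lam mu H) : K b (N b e) = e :=
  LinearMap.congr_fun ((LinearMap.comp_eq_id_comm ℝ _).1
    (congrArg ContinuousLinearMap.toLinearMap (h.left_comp_right hab hJ hN hK))) e

variable {γ : ℝ → X}
variable [IsContMDiffRiemannianBundle 𝓘(ℝ, H) ∞ H (fun x : X => TangentSpace 𝓘(ℝ, H) x)]

theorem left_apply_eq (h : IsFrameSolution c p N K J) (hab : a ≤ b) (hJ : Icc a b ⊆ J)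
    (hN : N a = 1) (hγ : ∀ t ∈ Icc a b, ContMDiffAt 𝓘(ℝ, ℝ) 𝓘(ℝ, H) ∞ γ t)
    (hc : ∀ t ∈ Icc a b, HasChartState c γ t (p t)) {s : ∀ t : ℝ, EFib H lam mu (γ t)}
    (hs : IsParallelOn γ s a b) :
    N b (eToModel lam mu c (γ b) (s b)) = eToModel lam mu c (γ a) (s a) := by
  have hpar := (isParallelOn_iff hγ fun t ht => (hc t ht).mem_source).1 hs
  have hconst := eq_of_hasDerivWithinAt_zero (f := fun t => N t (eToModel lam mu c (γ t) (s t)))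
    hab fun t ht => by
      refine ((h.hasDerivAt_left t (hJ ht)).hasDerivWithinAt.clm_apply (hpar t ht)).congr_deriv ?_
      rw [(hc t ht).fst_eq, (hc t ht).snd_eq]
      simp
  rw [hconst, hN]
  rfl

theorem exists_isParallelOn (h : IsFrameSolution c p N K J) (hab : a ≤ b) (hJ : Icc a b ⊆ J)
    (hN : N a = 1) (hK : K a = 1) (hγ : ∀ t ∈ Icc a b, ContMDiffAt 𝓘(ℝ, ℝ) 𝓘(ℝ, H) ∞ γ t)
    (hc : ∀ t ∈ Icc a b, HasChartState c γ t (p t)) (e : EFib H lam mu (γ b)) :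
    ∃ s : ∀ t : ℝ, EFib H lam mu (γ t), IsParallelOn γ s a b ∧ s b = e := by
  let S : ℝ → Schur lam mu H := fun t => K t (N b (eToModel lam mu c (γ b) e))
  refine ⟨fun t => schurMap (V := H) (W := TangentSpace 𝓘(ℝ, H) (γ t)) (fromModel c (γ t))
    (toModel c (γ t)) (S t),
    (isParallelOn_iff hγ fun t ht => (hc t ht).mem_source).2 fun t ht => ?_, ?_⟩
  · have hS : HasDerivWithinAt S (-schurAct (christoffelInChart c (p t).1 (p t).2) (S t))
        (Icc a b) t :=
      (((h.hasDerivAt_right t (hJ ht)).clm_apply (hasDerivAt_const t _)).congr_deriv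
        (by simp [S])).hasDerivWithinAt
    rw [IsParallelInChartAt, eToModel_schurMap_fromModel (hc t ht).mem_source, (hc t ht).fst_eq,
      (hc t ht).snd_eq]
    exact hS.congr_of_mem (fun r hr => eToModel_schurMap_fromModel (hc r hr).mem_source _) ht
  · have hSb : S b = eToModel lam mu c (γ b) e := h.right_apply_left hab hJ hN hK _
    have hinv := schurMap_fromModel_toModel (hc b ⟨hab, le_rfl⟩).mem_source e
    rwa [← hSb] at hinv

theorem isTransportMatrix [T2Space X] (h : IsFrameSolution c p N K J) (hγ : IsGeodesicOn H γ J)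
    (hJo : IsOpen J) (hJ : J.OrdConnected) (ha : a ∈ J) (hb : b ∈ J) (hab : a ≤ b) (hN : N a = 1)
    (hK : K a = 1) (hstate : HasChartState c γ a (p a)) :
    HasChartState c γ b (p b) ∧ IsTransportMatrix γ c c a b (N b) := by
  have hIcc : Icc a b ⊆ J := hJ.out ha hb
  have hc : ∀ t ∈ J, HasChartState c γ t (p t) := fun t ht =>
    hγ.hasChartState h.toIsGeodesicInChart hJo hJ.isPreconnected ha hstate ht
  have hsmooth : ∀ t ∈ Icc a b, ContMDiffAt 𝓘(ℝ, ℝ) 𝓘(ℝ, H) ∞ γ t := fun t ht =>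
    (hγ t (hIcc ht)).1
  exact ⟨hc b hb, fun s hs => h.left_apply_eq hab hIcc hN hsmooth (fun t ht => hc t (hIcc ht)) hs,
    h.exists_isParallelOn hab hIcc hN hK hsmooth fun t ht => hc t (hIcc ht)⟩

end IsFrameSolution

end FrameSolution

section FrameFlow

open Set Filter Topology

variable {H : Type*} [NormedAddCommGroup H] [NormedSpace ℝ H]

/-- The phase space of the flow of frames: position, velocity, the matrix `N` of the parallel
transport back to the starting point, and its inverse `K`. -/
abbrev FrameState (lam mu : YoungDiagram) (H : Type*) [NormedAddCommGroup H] [NormedSpace ℝ H] :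
    Type _ :=
  (H × H) × (Schur lam mu H →L[ℝ] Schur lam mu H) × (Schur lam mu H →L[ℝ] Schur lam mu H)

variable {X : Type*} [TopologicalSpace X] [ChartedSpace H X] [IsManifold 𝓘(ℝ, H) ∞ X]
variable [Bundle.RiemannianBundle (fun x : X => TangentSpace 𝓘(ℝ, H) x)]
variable {lam mu : YoungDiagram}

/-- The vector field in the preferred chart at `c` whose integral curves are the frame solutions
`IsFrameSolution`. -/
def frameField (c : X) (y : FrameState lam mu H) : FrameState lam mu H :=
  (geodesicField c y.1, y.2.1.comp (schurAct (christoffelInChart c y.1.1 y.1.2)),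
    -(schurAct (christoffelInChart c y.1.1 y.1.2)).comp y.2.2)

variable [FiniteDimensional ℝ H]
variable [IsContMDiffRiemannianBundle 𝓘(ℝ, H) ∞ H (fun x : X => TangentSpace 𝓘(ℝ, H) x)]

theorem contDiffOn_frameField (c : X) :
    ContDiffOn ℝ ∞ (frameField (H := H) (lam := lam) (mu := mu) c)
      (((extChartAt 𝓘(ℝ, H) c).target ×ˢ univ) ×ˢ univ) := by
  have hstate : ContDiffOn ℝ ∞ (fun y : FrameState lam mu H => y.1)
    (((extChartAt 𝓘(ℝ, H) c).target ×ˢ univ) ×ˢ univ) := contDiffOn_fst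
  have hgeodesic := (contDiffOn_geodesicField c).comp hstate fun y hy => hy.1
  have haction : ContDiffOn ℝ ∞
      (fun y : FrameState lam mu H => schurActL lam mu H (christoffelInChart c y.1.1 y.1.2))
      (((extChartAt 𝓘(ℝ, H) c).target ×ˢ univ) ×ˢ univ) :=
    (schurActL lam mu H).contDiff.comp_contDiffOn
      ((contDiffOn_christoffelInChart c).comp
        (g := fun p : H × H => christoffelInChart c p.1 p.2) hstate fun y hy => hy.1)
  exact hgeodesic.prodMk ((contDiff_snd.fst.contDiffOn.clm_comp haction).prodMk
    (haction.clm_comp contDiff_snd.snd.contDiffOn).neg)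

/-- A local flow of frame solutions in the preferred chart at `c`: for all initial positions and
velocities in `W` it is defined for times in `(-δ, δ)`, it starts at the identity frame, and it is
`n` times differentiable in the initial data. -/
structure IsFrameFlow (c : X) (n : ℕ) (δ : ℝ) (W : Set (H × H)) (P : H × H → ℝ → H × H)
    (N K : H × H → ℝ → Schur lam mu H →L[ℝ] Schur lam mu H) : Prop where
  isFrameSolution : ∀ p ∈ W, IsFrameSolution c (P p) (N p) (K p) (Ioo (-δ) δ)
  state_zero : ∀ p ∈ W, P p 0 = p
  left_zero : ∀ p ∈ W, N p 0 = 1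
  right_zero : ∀ p ∈ W, K p 0 = 1
  contDiffOn_state : ∀ t ∈ Ioo (-δ) δ, ContDiffOn ℝ n (fun p => P p t) W
  contDiffOn_left : ∀ t ∈ Ioo (-δ) δ, ContDiffOn ℝ n (fun p => N p t) W

theorem exists_isFrameFlow (c : X) {p₀ : H × H} (hp₀ : p₀.1 ∈ (extChartAt 𝓘(ℝ, H) c).target)
    (n : ℕ) : ∃ δ > 0, ∃ W : Set (H × H), IsOpen W ∧ p₀ ∈ W ∧ ∃ (P : H × H → ℝ → H × H)
      (N K : H × H → ℝ → Schur lam mu H →L[ℝ] Schur lam mu H), IsFrameFlow c n δ W P N K := by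
  have : CompleteSpace (FrameState lam mu H) := FiniteDimensional.complete ℝ _
  let ι : H × H → FrameState lam mu H := fun p => (p, 1, 1)
  have hι : ContDiff ℝ n ι := contDiff_id.prodMk contDiff_const
  obtain ⟨δ, hδ, W, hWo, hW, Φ, hΦ, hΦs⟩ := exists_contDiffOn_local_flow
    (((isOpen_extChartAt_target c).prod isOpen_univ).prod isOpen_univ)
    ((contDiffOn_frameField (lam := lam) (mu := mu) c).of_le (by exact_mod_cast le_top))
    (x₀ := ι p₀) ⟨⟨hp₀, mem_univ _⟩, mem_univ _⟩ (n := n)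
  have hsmooth : ∀ t ∈ Ioo (-δ) δ, ContDiffOn ℝ n (fun p => Φ (ι p) t) (ι ⁻¹' W) := fun t ht =>
    ContDiffOn.comp (g := fun y => Φ y t) (hΦs t ht) hι.contDiffOn fun p hp => hp
  have hderiv : ∀ p ∈ ι ⁻¹' W, ∀ t ∈ Ioo (-δ) δ,
      HasDerivAt (Φ (ι p)) (frameField c (Φ (ι p) t)) t := fun p hp t ht => ((hΦ _ hp).2 t ht).2
  exact ⟨δ, hδ, ι ⁻¹' W, hWo.preimage hι.continuous, hW, fun p t => (Φ (ι p) t).1,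
    fun p t => (Φ (ι p) t).2.1, fun p t => (Φ (ι p) t).2.2,
    { isFrameSolution := fun p hp =>
        { mem_target := fun t ht => ((hΦ _ hp).2 t ht).1.1.1
          hasDerivAt := fun t ht => (hderiv p hp t ht).fst
          hasDerivAt_left := fun t ht => (hderiv p hp t ht).snd.fst
          hasDerivAt_right := fun t ht => (hderiv p hp t ht).snd.snd }
      state_zero := fun p hp => congrArg Prod.fst (hΦ _ hp).1
      left_zero := fun p hp => congrArg (fun y => y.2.1) (hΦ _ hp).1
      right_zero := fun p hp => congrArg (fun y => y.2.2) (hΦ _ hp).1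
      contDiffOn_state := fun t ht => (hsmooth t ht).fst
      contDiffOn_left := fun t ht => (hsmooth t ht).snd.fst }⟩

end FrameFlow

section SmoothTransport

open Set Filter Topology

theorem Icc_induction_of_locally_propagates {P : ℝ → Prop} {a b : ℝ} (hab : a ≤ b) (ha : P a)
    (hloc : ∀ t ∈ Icc a b, ∃ U ∈ 𝓝 t, ∀ t₁ ∈ U ∩ Icc a b, ∀ t₂ ∈ U ∩ Icc a b,
      t₁ ≤ t₂ → P t₁ → P t₂) : P b := by
  choose! U hU hstep using hloc
  obtain ⟨τ, hτ0, hmono, ⟨n, hn⟩, hcover⟩ := exists_monotone_Icc_subset_open_cover_Icc hab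
    (c := fun i : Icc a b => Subtype.val ⁻¹' interior (U i))
    (fun _ => isOpen_interior.preimage continuous_subtype_val)
    (fun t _ => mem_iUnion.2 ⟨t, mem_interior_iff_mem_nhds.2 (hU t t.2)⟩)
  have hτ : ∀ k, P (τ k) := fun k => by
    induction k with
    | zero => rwa [hτ0]
    | succ k ih =>
      obtain ⟨i, hi⟩ := hcover k
      have hle := hmono k.le_succ
      exact hstep i i.2 _ ⟨interior_subset (hi (left_mem_Icc.2 hle)), (τ k).2⟩ _
        ⟨interior_subset (hi (right_mem_Icc.2 hle)), (τ (k + 1)).2⟩ hle ih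
  simpa only [hn n le_rfl] using hτ n

variable {H : Type*} [NormedAddCommGroup H] [NormedSpace ℝ H] [FiniteDimensional ℝ H]
variable {X : Type*} [TopologicalSpace X] [ChartedSpace H X] [IsManifold 𝓘(ℝ, H) ∞ X]
variable [Bundle.RiemannianBundle (fun x : X => TangentSpace 𝓘(ℝ, H) x)]
variable {lam mu : YoungDiagram} {x c : X} {ξ ξ₀ : TangentSpace 𝓘(ℝ, H) x} {γ γ₀ : ℝ → X} {t : ℝ}

namespace IsGeodesicFrom

theorem start (h : IsGeodesicFrom x ξ γ) : γ 0 = x :=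
  congrArg Bundle.TotalSpace.proj h.2

theorem contMDiffAt (h : IsGeodesicFrom x ξ γ) (ht : t ∈ Icc (0 : ℝ) 1) :
    ContMDiffAt 𝓘(ℝ, ℝ) 𝓘(ℝ, H) ∞ γ t := by
  obtain ⟨a, b, ha, hb, hγ⟩ := h.1
  exact (hγ t ⟨ha.trans_le ht.1, ht.2.trans_lt hb⟩).1

theorem start_mem_source (h : IsGeodesicFrom x ξ γ) : γ 0 ∈ (extChartAt 𝓘(ℝ, H) x).source :=
  h.start.symm ▸ mem_extChartAt_source x

theorem hasChartState_zero (h : IsGeodesicFrom x ξ γ) :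
    HasChartState x γ 0 (extChartAt 𝓘(ℝ, H) x x, toModel x x ξ) := by
  refine ⟨h.start_mem_source, ?_⟩
  have hvelocity : toModel x (γ 0) (velocity H γ 0) = toModel x x ξ :=
    congrArg (fun p : TangentBundle 𝓘(ℝ, H) X => toModel x p.1 p.2) h.2
  rw [toModel_velocity ((h.contMDiffAt ⟨le_rfl, zero_le_one⟩).mdifferentiableAt (by norm_num))
    h.start_mem_source] at hvelocity
  rw [chartState, h.start, hvelocity]

end IsGeodesicFrom

theorem isGeodesicFrom_geodesic (h : ξ ∈ expDomain x) : IsGeodesicFrom x ξ (geodesic x ξ) := by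
  have hex : ∃ γ : ℝ → X, IsGeodesicFrom x ξ γ := h
  rw [geodesic, dif_pos hex]
  exact hex.choose_spec

omit [FiniteDimensional ℝ H] [IsManifold 𝓘(ℝ, H) ∞ X] in
theorem exists_sigma_mk_eq {y : X} (h : y = x) (a : EFib H lam mu y) :
    ∃ w : EFib H lam mu x, (⟨y, a⟩ : Σ y : X, EFib H lam mu y) = ⟨x, w⟩ := by
  subst h
  exact ⟨a, rfl⟩

omit [FiniteDimensional ℝ H] in
theorem eToModel_eq_of_sigma_mk_eq (c : X) {y y' : X} {a : EFib H lam mu y} {b : EFib H lam mu y'}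
    (h : (⟨y, a⟩ : Σ y : X, EFib H lam mu y) = ⟨y', b⟩) :
    eToModel lam mu c y a = eToModel lam mu c y' b := by
  obtain ⟨rfl, hab⟩ := Sigma.mk.inj h
  rw [eq_of_heq hab]

theorem eToModel_transport (hξ : ξ ∈ expDomain x) {M : Schur lam mu H →L[ℝ] Schur lam mu H}
    (hM : IsTransportMatrix (geodesic x ξ) x c 0 1 M) (e : EFib H lam mu (expMap x ξ)) :
    eToModel lam mu x x (transport x ξ e) = M (eToModel lam mu c (expMap x ξ) e) := by
  have hex : ∃ w, IsTransported x ξ e w := by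
    obtain ⟨s, hs, hs1⟩ := hM.exists_isParallelOn e
    obtain ⟨w, hw⟩ := exists_sigma_mk_eq (isGeodesicFrom_geodesic hξ).start (s 0)
    exact ⟨w, s, hs, hs1, hw⟩
  have htransported : IsTransported x ξ e (transport x ξ e) := by
    rw [transport, dif_pos hex]
    exact hex.choose_spec
  obtain ⟨s, hs, hs1, hs0⟩ := htransported
  rw [← eToModel_eq_of_sigma_mk_eq x hs0, ← hM.apply_eq s hs]
  exact congrArg (fun a => M (eToModel lam mu c (geodesic x ξ 1) a)) hs1

/-- For initial velocities near `ξ₀`, the position and velocity at time `t` of the geodesic issued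
from `x`, and the parallel transport along it from time `t` to time `0`, are given in the preferred
chart at `c` by functions which are `n` times differentiable at `ξ₀`. -/
def HasSmoothTransport (lam mu : YoungDiagram) (n : ℕ) (ξ₀ : TangentSpace 𝓘(ℝ, H) x) (c : X)
    (t : ℝ) : Prop :=
  ∃ (σ : TangentSpace 𝓘(ℝ, H) x → H × H)
    (M : TangentSpace 𝓘(ℝ, H) x → Schur lam mu H →L[ℝ] Schur lam mu H),
    ContDiffAt ℝ n σ ξ₀ ∧ ContDiffAt ℝ n M ξ₀ ∧ ∀ᶠ ξ in 𝓝 ξ₀, ∀ γ : ℝ → X,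
      IsGeodesicFrom x ξ γ → HasChartState c γ t (σ ξ) ∧ IsTransportMatrix γ x c 0 t (M ξ)

namespace HasSmoothTransport

variable {n : ℕ}

theorem zero (n : ℕ) (ξ₀ : TangentSpace 𝓘(ℝ, H) x) : HasSmoothTransport lam mu n ξ₀ x 0 := by
  let P : TangentSpace 𝓘(ℝ, H) x →L[ℝ] H := toModel x x
  have hvelocity : ContDiffAt ℝ n P ξ₀ := P.contDiff.contDiffAt
  refine ⟨fun ξ => (extChartAt 𝓘(ℝ, H) x x, P ξ), fun _ => 1,
    contDiffAt_const.prodMk hvelocity, contDiffAt_const, Eventually.of_forall fun ξ γ hγ => ?_⟩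
  exact ⟨hγ.hasChartState_zero, .refl hγ.start_mem_source⟩

theorem change_chart {d : X} (h : HasSmoothTransport lam mu n ξ₀ c t) (ht : t ∈ Icc (0 : ℝ) 1)
    (hγ₀ : IsGeodesicFrom x ξ₀ γ₀) (hd : γ₀ t ∈ (extChartAt 𝓘(ℝ, H) d).source) :
    HasSmoothTransport lam mu n ξ₀ d t := by
  obtain ⟨σ, M, hσ, hM, hev⟩ := h
  have hstate₀ := (hev.self_of_nhds γ₀ hγ₀).1
  have hmem : (σ ξ₀).1 ∈ overlap H c d :=
    hstate₀.fst_eq ▸ chart_mem_overlap hstate₀.mem_source hd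
  have hnhds := (isOpen_overlap (H := H) c d).mem_nhds hmem
  have hnhds' := (isOpen_overlap (H := H) d c).mem_nhds (coordChange_mem_overlap hmem)
  have hn : (n : ℕ∞ω) ≤ ∞ := by exact_mod_cast le_top
  have hposition : ContDiffAt ℝ n (fun ξ => coordChange H c d (σ ξ).1) ξ₀ :=
    (((contDiffOn_coordChange c d).contDiffAt hnhds).of_le hn).comp ξ₀
      (f := fun ξ => (σ ξ).1) hσ.fst
  have hjac : ContDiffAt ℝ n (fun ξ => jacobian H c d (σ ξ).1) ξ₀ :=
    (((contDiffOn_jacobian c d).contDiffAt hnhds).of_le hn).comp ξ₀ (f := fun ξ => (σ ξ).1) hσ.fst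
  have htensor : ContDiffAt ℝ n
      (fun ξ => tensorChange lam mu d c (coordChange H c d (σ ξ).1)) ξ₀ :=
    (((contDiffOn_tensorChange (lam := lam) (mu := mu) d c).contDiffAt hnhds').of_le hn).comp ξ₀
      (f := fun ξ => coordChange H c d (σ ξ).1) hposition
  refine ⟨fun ξ => (coordChange H c d (σ ξ).1, jacobian H c d (σ ξ).1 (σ ξ).2),
    fun ξ => (M ξ).comp (tensorChange lam mu d c (coordChange H c d (σ ξ).1)),
    hposition.prodMk (hjac.clm_apply hσ.snd), hM.clm_comp htensor, ?_⟩
  filter_upwards [hev, hσ.fst.continuousAt.eventually_mem hnhds] with ξ hξ hξmem γ hγ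
  obtain ⟨hstate, htransport⟩ := hξ γ hγ
  have hdγ : γ t ∈ (extChartAt 𝓘(ℝ, H) d).source := by
    have hsource := (mem_overlap.1 hξmem).2
    rwa [← hstate.fst_eq, PartialEquiv.left_inv _ hstate.mem_source] at hsource
  refine ⟨hstate.change_chart ((hγ.contMDiffAt ht).mdifferentiableAt (by norm_num)) hdγ, ?_⟩
  rw [← hstate.fst_eq, coordChange_chart hstate.mem_source]
  exact htransport.change_chart hstate.mem_source hdγ

variable [IsContMDiffRiemannianBundle 𝓘(ℝ, H) ∞ H (fun x : X => TangentSpace 𝓘(ℝ, H) x)]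

theorem step [T2Space X] {t₁ t₂ δ : ℝ} {W : Set (H × H)} {P : H × H → ℝ → H × H}
    {N K : H × H → ℝ → Schur lam mu H →L[ℝ] Schur lam mu H}
    (h : HasSmoothTransport lam mu n ξ₀ c t₁) (h₁ : t₁ ∈ Icc (0 : ℝ) 1) (h₂ : t₂ ∈ Icc (0 : ℝ) 1)
    (h₁₂ : t₁ ≤ t₂) (hδ : t₂ - t₁ < δ) (hW : IsOpen W) (hF : IsFrameFlow c n δ W P N K)
    (hγ₀ : IsGeodesicFrom x ξ₀ γ₀) (hγ₀W : chartState c γ₀ t₁ ∈ W) :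
    HasSmoothTransport lam mu n ξ₀ c t₂ := by
  obtain ⟨σ, M, hσ, hM, hev⟩ := h
  have hσW : W ∈ 𝓝 (σ ξ₀) :=
    (hev.self_of_nhds γ₀ hγ₀).1.chartState_eq ▸ hW.mem_nhds hγ₀W
  have hτ : t₂ - t₁ ∈ Ioo (-δ) δ := ⟨by linarith, hδ⟩
  refine ⟨fun ξ => P (σ ξ) (t₂ - t₁), fun ξ => (M ξ).comp (N (σ ξ) (t₂ - t₁)),
    ((hF.contDiffOn_state _ hτ).contDiffAt hσW).comp ξ₀ hσ,
    hM.clm_comp (((hF.contDiffOn_left _ hτ).contDiffAt hσW).comp ξ₀ hσ), ?_⟩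
  filter_upwards [hev, hσ.continuousAt.eventually_mem hσW] with ξ hξ hξW γ hγ
  obtain ⟨hstate, htransport⟩ := hξ γ hγ
  obtain ⟨a, b, ha, hb, hgeod⟩ := hγ.1
  have hsolution : IsFrameSolution c (fun t => P (σ ξ) (t - t₁)) (fun t => N (σ ξ) (t - t₁))
      (fun t => K (σ ξ) (t - t₁)) (Ioo a b ∩ Ioo (t₁ - δ) (t₁ + δ)) :=
    ((hF.isFrameSolution _ hξW).shift t₁).mono fun t ht =>
      ⟨by linarith [ht.2.1], by linarith [ht.2.2]⟩
  obtain ⟨hstate₂, htransport₂⟩ := hsolution.isTransportMatrix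
    (a := t₁) (b := t₂) (fun t ht => hgeod t ht.1) (isOpen_Ioo.inter isOpen_Ioo)
    (ordConnected_Ioo.inter ordConnected_Ioo)
    ⟨⟨ha.trans_le h₁.1, h₁.2.trans_lt hb⟩, by linarith, by linarith⟩
    ⟨⟨ha.trans_le h₂.1, h₂.2.trans_lt hb⟩, by linarith, by linarith⟩ h₁₂
    (by rw [sub_self, hF.left_zero _ hξW]) (by rw [sub_self, hF.right_zero _ hξW])
    (by rwa [sub_self, hF.state_zero _ hξW])
  exact ⟨hstate₂, htransport.trans htransport₂ h₁.1 h₁₂⟩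

theorem one [T2Space X] (n : ℕ) (hγ₀ : IsGeodesicFrom x ξ₀ γ₀) :
    HasSmoothTransport lam mu n ξ₀ (γ₀ 1) 1 := by
  refine Icc_induction_of_locally_propagates
    (P := fun t => ∀ c : X, γ₀ t ∈ (extChartAt 𝓘(ℝ, H) c).source →
      HasSmoothTransport lam mu n ξ₀ c t) zero_le_one
    (fun c hc => (zero n ξ₀).change_chart ⟨le_rfl, zero_le_one⟩ hγ₀ hc) (fun t ht => ?_) (γ₀ 1)
    (mem_extChartAt_source _)
  have hsource := mem_extChartAt_source (I := 𝓘(ℝ, H)) (γ₀ t)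
  obtain ⟨δ, hδ, W, hW, htW, P, N, K, hF⟩ := exists_isFrameFlow (lam := lam) (mu := mu)
    (γ₀ t) (p₀ := chartState (γ₀ t) γ₀ t) (mem_extChartAt_target (I := 𝓘(ℝ, H)) (γ₀ t)) n
  obtain ⟨a, b, ha, hb, hgeod⟩ := hγ₀.1
  have hstate : ContinuousAt (chartState (H := H) (γ₀ t) γ₀) t :=
    (hgeod.hasDerivAt_chartState ⟨ha.trans_le ht.1, ht.2.trans_lt hb⟩ hsource).continuousAt
  refine ⟨_, (((eventually_mem_extChartAt_source (hγ₀.contMDiffAt ht).continuousAt hsource).and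
    (hstate.eventually_mem (hW.mem_nhds htW))).and
      (Ioo_mem_nhds (sub_lt_self t (half_pos hδ)) (lt_add_of_pos_right t (half_pos hδ)))),
    fun t₁ h₁ t₂ h₂ h₁₂ hP d hd => ?_⟩
  obtain ⟨⟨⟨hsource₁, hW₁⟩, hlower, -⟩, ht₁⟩ := h₁
  obtain ⟨⟨-, -, hupper⟩, ht₂⟩ := h₂
  exact ((hP _ hsource₁).step ht₁ ht₂ h₁₂ (by linarith) hW hF hγ₀ hW₁).change_chart ht₂ hγ₀ hd

end HasSmoothTransport

variable [IsContMDiffRiemannianBundle 𝓘(ℝ, H) ∞ H (fun x : X => TangentSpace 𝓘(ℝ, H) x)]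

theorem exists_contDiffAt_transport [T2Space X] {u : ∀ x : X, EFib H lam mu x}
    (hu : IsSmoothSection u) (hξ₀ : ξ₀ ∈ expDomain x) (n : ℕ) :
    ∃ G : TangentSpace 𝓘(ℝ, H) x → Schur lam mu H, ContDiffAt ℝ n G ξ₀ ∧ ∀ᶠ ξ in 𝓝 ξ₀,
      ξ ∈ expDomain x → eToModel lam mu x x (transport x ξ (u (expMap x ξ))) = G ξ := by
  have hγ₀ := isGeodesicFrom_geodesic hξ₀
  obtain ⟨σ, M, hσ, hM, hev⟩ := HasSmoothTransport.one (lam := lam) (mu := mu) n hγ₀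
  have htarget := (hev.self_of_nhds _ hγ₀).1.fst_mem_target
  have hcomp : ContDiffAt ℝ n (fun ξ => compInChart u (geodesic x ξ₀ 1) (σ ξ).1) ξ₀ :=
    (((hu.contDiffOn_compInChart _).contDiffAt ((isOpen_extChartAt_target _).mem_nhds
      htarget)).of_le (by exact_mod_cast le_top)).comp ξ₀ (f := fun ξ => (σ ξ).1) hσ.fst
  refine ⟨fun ξ => M ξ (compInChart u (geodesic x ξ₀ 1) (σ ξ).1), hM.clm_apply hcomp, ?_⟩
  filter_upwards [hev] with ξ hξ hξdom
  obtain ⟨hstate, htransport⟩ := hξ _ (isGeodesicFrom_geodesic hξdom)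
  rw [eToModel_transport hξdom htransport, ← hstate.fst_eq]
  exact congrArg (M ξ) (compInChart_extChartAt u hstate.mem_source).symm

end SmoothTransport

section RadialExpansion

open Set Filter Topology

variable {H : Type*} [NormedAddCommGroup H] [NormedSpace ℝ H]
variable {X : Type*} [TopologicalSpace X] [ChartedSpace H X] [IsManifold 𝓘(ℝ, H) ∞ X]
variable [Bundle.RiemannianBundle (fun x : X => TangentSpace 𝓘(ℝ, H) x)]
variable {lam mu : YoungDiagram} {u : ∀ x : X, EFib H lam mu x} {c x : X}
  {v : TangentSpace 𝓘(ℝ, H) x} {p : ℝ → H × H} {N K : ℝ → Schur lam mu H →L[ℝ] Schur lam mu H}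
  {J : Set ℝ} {t : ℝ}

theorem IsGeodesicInChart.hasDerivAt_fst (h : IsGeodesicInChart c p J) (ht : t ∈ J) :
    HasDerivAt (fun t => (p t).1) (p t).2 t :=
  (h.hasDerivAt t ht).fst

theorem IsGeodesicInChart.hasDerivAt_snd (h : IsGeodesicInChart c p J) (ht : t ∈ J) :
    HasDerivAt (fun t => (p t).2) (-christoffelInChart c (p t).1 (p t).2 (p t).2) t :=
  (h.hasDerivAt t ht).snd

namespace IsFrameSolution

theorem hasDerivAt_left_apply (h : IsFrameSolution c p N K J) (ht : t ∈ J)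
    {w : ℝ → Schur lam mu H} {w' : Schur lam mu H} (hw : HasDerivAt w w' t) :
    HasDerivAt (fun t => N t (w t))
      (N t (w' + schurAct (christoffelInChart c (p t).1 (p t).2) (w t))) t := by
  refine ((h.hasDerivAt_left t ht).clm_apply hw).congr_deriv ?_
  rw [map_add, add_comm, ContinuousLinearMap.comp_apply]

variable [FiniteDimensional ℝ H]

theorem hasDerivAt_left_compInChart (hu : IsSmoothSection u) (h : IsFrameSolution c p N K J)
    (ht : t ∈ J) :
    HasDerivAt (fun t => N t (compInChart u c (p t).1)) (N t (covInChart u c (p t).1 (p t).2)) t :=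
  h.hasDerivAt_left_apply ht <| HasFDerivAt.comp_hasDerivAt (l := compInChart u c)
    (f := fun t => (p t).1) t (hu.hasFDerivAt_compInChart (h.mem_target t ht))
    (h.hasDerivAt_fst ht)

variable [IsContMDiffRiemannianBundle 𝓘(ℝ, H) ∞ H (fun x : X => TangentSpace 𝓘(ℝ, H) x)]

theorem hasDerivAt_left_covInChart (hu : IsSmoothSection u) (h : IsFrameSolution c p N K J)
    (ht : t ∈ J) :
    HasDerivAt (fun t => N t (covInChart u c (p t).1 (p t).2))
      (N t (fderiv ℝ (covInChart u c) (p t).1 (p t).2 (p t).2 +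
        schurAct (christoffelInChart c (p t).1 (p t).2) (covInChart u c (p t).1 (p t).2) -
        covInChart u c (p t).1 (christoffelInChart c (p t).1 (p t).2 (p t).2))) t := by
  have hcov : HasDerivAt (fun t => covInChart u c (p t).1)
      (fderiv ℝ (covInChart u c) (p t).1 (p t).2) t :=
    HasFDerivAt.comp_hasDerivAt (l := covInChart u c) (f := fun t => (p t).1) t
      (((contDiffOn_covInChart hu c).differentiableOn (by norm_num)).differentiableAt
        ((isOpen_extChartAt_target c).mem_nhds (h.mem_target t ht))).hasFDerivAt
      (h.hasDerivAt_fst ht)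
  refine (h.hasDerivAt_left_apply ht (hcov.clm_apply (h.hasDerivAt_snd ht))).congr_deriv ?_
  rw [map_neg, ← sub_eq_add_neg, sub_add_eq_add_sub]

theorem eToModel_transport_smul [T2Space X] (h : IsFrameSolution x p N K J) (hJo : IsOpen J)
    (hJ : J.OrdConnected) (h0 : 0 ∈ J) (ht : t ∈ J)
    (hp : p 0 = (extChartAt 𝓘(ℝ, H) x x, toModel x x v)) (hN : N 0 = 1) (hK : K 0 = 1)
    (u : ∀ x : X, EFib H lam mu x) (htv : t • v ∈ expDomain x) :
    eToModel lam mu x x (transport x (t • v) (u (expMap x (t • v)))) =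
      N t (compInChart u x (p t).1) := by
  have hγ := isGeodesicFrom_geodesic htv
  obtain ⟨a, b, ha, hb, hgeod⟩ := hγ.1
  have hstate₀ : HasChartState x (geodesic x (t • v)) 0 ((p (t * 0)).1, t • (p (t * 0)).2) := by
    rw [mul_zero, hp]
    simpa only [map_smul] using hγ.hasChartState_zero
  obtain ⟨hstate, htransport⟩ :=
    ((h.rescale t).mono (inter_subset_left (t := Ioo a b))).isTransportMatrix
      (a := 0) (b := 1) (fun r hr => hgeod r hr.2)
      ((hJo.preimage (continuous_const.mul continuous_id)).inter isOpen_Ioo)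
      ((hJ.convex.linear_preimage (LinearMap.mulLeft ℝ t)).ordConnected.inter ordConnected_Ioo)
      ⟨by simpa using h0, ha, zero_lt_one.trans hb⟩ ⟨by simpa using ht, ha.trans zero_lt_one, hb⟩
      zero_le_one (by rwa [mul_zero]) (by rwa [mul_zero]) hstate₀
  have hposition := hstate.fst_eq
  rw [mul_one] at htransport hposition
  rw [eToModel_transport htv htransport, ← hposition]
  exact congrArg (N t) (compInChart_extChartAt u hstate.mem_source).symm

end IsFrameSolution

variable [FiniteDimensional ℝ H] [T2Space X]
variable [IsContMDiffRiemannianBundle 𝓘(ℝ, H) ∞ H (fun x : X => TangentSpace 𝓘(ℝ, H) x)]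

theorem exists_radial_expansion (hu : IsSmoothSection u) (x : X)
    (v : TangentSpace 𝓘(ℝ, H) x) : ∃ h : ℝ → Schur lam mu H,
      (∀ᶠ t in 𝓝 (0 : ℝ), t • v ∈ expDomain x →
        eToModel lam mu x x (transport x (t • v) (u (expMap x (t • v)))) = h t) ∧
      ∀ k ≤ 2, iteratedDeriv k h 0 = eToModel lam mu x x (nablaIter u k x fun _ => v) := by
  have hx := mem_extChartAt_source (I := 𝓘(ℝ, H)) x
  obtain ⟨δ, hδ, W, -, hW, P, N, K, hF⟩ := exists_isFrameFlow (lam := lam) (mu := mu) x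
    (p₀ := (extChartAt 𝓘(ℝ, H) x x, toModel x x v)) (mem_extChartAt_target (I := 𝓘(ℝ, H)) x) 0
  have hsol := hF.isFrameSolution _ hW
  have hp := hF.state_zero _ hW
  have hN := hF.left_zero _ hW
  have hK := hF.right_zero _ hW
  generalize P (extChartAt 𝓘(ℝ, H) x x, toModel x x v) = p at hsol hp
  generalize N (extChartAt 𝓘(ℝ, H) x x, toModel x x v) = N at hsol hN
  generalize K (extChartAt 𝓘(ℝ, H) x x, toModel x x v) = K at hsol hK
  have h0 : (0 : ℝ) ∈ Ioo (-δ) δ := ⟨neg_lt_zero.2 hδ, hδ⟩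
  have hnear : ∀ᶠ t in 𝓝 (0 : ℝ), t ∈ Ioo (-δ) δ := isOpen_Ioo.mem_nhds h0
  have hderiv : deriv (fun t => N t (compInChart u x (p t).1)) =ᶠ[𝓝 0]
      fun t => N t (covInChart u x (p t).1 (p t).2) := by
    filter_upwards [hnear] with t ht using (hsol.hasDerivAt_left_compInChart hu ht).deriv
  refine ⟨fun t => N t (compInChart u x (p t).1), ?_, fun k hk => ?_⟩
  · filter_upwards [hnear] with t ht htv
    exact hsol.eToModel_transport_smul isOpen_Ioo ordConnected_Ioo h0 ht hp hN hK u htv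
  interval_cases k
  · rw [iteratedDeriv_zero, hp, hN]
    exact compInChart_extChartAt u hx
  · rw [iteratedDeriv_one, hderiv.eq_of_nhds, hp, hN, eToModel_nablaIter_one hu hx]
    rfl
  · rw [iteratedDeriv_succ, iteratedDeriv_one, hderiv.deriv_eq,
      (hsol.hasDerivAt_left_covInChart hu h0).deriv, hp, hN, eToModel_nablaIter_two hu]
    rfl

end RadialExpansion

section FourierAnalysis

open Set Filter Topology MeasureTheory FourierTransform

theorem contDiff_cutoff {V : Type*} [NormedAddCommGroup V] [InnerProductSpace ℝ V] {χ : ℝ → ℝ}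
    {n : ℕ∞ω} (hχ : ContDiffOn ℝ n χ (Ici 0)) (hχ1 : ∀ t ∈ Icc (0 : ℝ) 1, χ t = 1) {ε : ℝ}
    (hε : 0 < ε) : ContDiff ℝ n fun ξ : V => χ (‖ξ‖ / ε) := by
  refine contDiff_iff_contDiffAt.2 fun ξ => ?_
  rcases eq_or_ne ξ 0 with rfl | hξ
  · refine (contDiffAt_const (c := (1 : ℝ))).congr_of_eventuallyEq ?_
    filter_upwards [Metric.ball_mem_nhds (0 : V) hε] with ζ hζ
    rw [mem_ball_zero_iff] at hζ
    exact hχ1 _ ⟨by positivity, (div_le_one hε).2 hζ.le⟩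
  · have hpos : 0 < ‖ξ‖ / ε := by positivity
    exact ContDiffAt.comp ξ (g := χ) (f := fun ξ : V => ‖ξ‖ / ε)
      (hχ.contDiffAt (Ici_mem_nhds hpos)) ((contDiffAt_norm ℝ hξ).div_const ε)

section Diagonal

variable {V S : Type*} [NormedAddCommGroup V] [NormedSpace ℝ V] [NormedAddCommGroup S]
  [NormedSpace ℝ S] {k : ℕ}

theorem iteratedDeriv_comp_smul_const {f : V → S} (hf : ContDiff ℝ k f) (v : V) (t : ℝ) :
    iteratedDeriv k (fun t : ℝ => f (t • v)) t = iteratedFDeriv ℝ k f (t • v) fun _ => v := by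
  have hcomp := congrArg (fun M => M fun _ => (1 : ℝ))
    ((ContinuousLinearMap.toSpanSingleton ℝ v).iteratedFDeriv_comp_right hf t le_rfl)
  simpa [Function.comp_def, iteratedDeriv_eq_iteratedFDeriv] using hcomp

theorem map_eq_map_of_diagonal_eq {G : Type*} [AddCommGroup G] [Module ℝ G]
    (B : ContinuousMultilinearMap ℝ (fun _ : Fin k => V) S →ₗ[ℝ] G)
    (hB : ∀ (σ : Equiv.Perm (Fin k)) (M : ContinuousMultilinearMap ℝ (fun _ : Fin k => V) S),
      B (M.domDomCongr σ) = B M)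
    {M N : ContinuousMultilinearMap ℝ (fun _ : Fin k => V) S}
    (h : ∀ v : V, (M fun _ => v) = N fun _ => v) : B M = B N := by
  -- The symmetrization of `M` is the `k`-th derivative of `v ↦ M (v, …, v)`.
  have hsymmetrization :
      ∑ σ : Equiv.Perm (Fin k), M.domDomCongr σ = ∑ σ : Equiv.Perm (Fin k), N.domDomCongr σ := by
    ext v
    simp only [sum_apply, ContinuousMultilinearMap.domDomCongr_apply]
    rw [← M.iteratedFDeriv_comp_diagonal 0 v, ← N.iteratedFDeriv_comp_diagonal 0 v, funext h]
  have hcard : (Fintype.card (Equiv.Perm (Fin k)) : ℝ) ≠ 0 :=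
    Nat.cast_ne_zero.2 Fintype.card_ne_zero
  have hsum := congrArg B hsymmetrization
  simp only [map_sum, hB, Finset.sum_const, Finset.card_univ, ← Nat.cast_smul_eq_nsmul ℝ] at hsum
  exact smul_right_injective G hcard hsum

end Diagonal

variable {V : Type*} [NormedAddCommGroup V] [InnerProductSpace ℝ V] [FiniteDimensional ℝ V]
  [MeasurableSpace V] [BorelSpace V] {S : Type*} [NormedAddCommGroup S] [NormedSpace ℂ S]

theorem eq_complexToReal [hS : NormedSpace ℝ S] [IsScalarTower ℝ ℂ S] :
    hS = NormedSpace.complexToReal := by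
  ext r s
  exact (algebraMap_smul ℂ r s).symm

theorem fourier_eq_integral_toDual [NormedSpace ℝ S] [IsScalarTower ℝ ℂ S] (f : V → S) (w : V) :
    𝓕 f w = ∫ ξ, Complex.exp (-2 * Real.pi * Complex.I *
      (InnerProductSpace.toDual ℝ V w ξ : ℝ)) • f ξ := by
  obtain rfl := eq_complexToReal (S := S)
  rw [Real.fourier_eq']
  refine integral_congr_ae (Eventually.of_forall fun ξ => ?_)
  simp only [InnerProductSpace.toDual_apply_apply, real_inner_comm ξ w]
  congr 2
  push_cast
  ring

variable [hS : NormedSpace ℝ S] [IsScalarTower ℝ ℂ S] {f : V → S}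

theorem integrable_fourier_of_hasCompactSupport (hf : ContDiff ℝ ∞ f) (hc : HasCompactSupport f) :
    Integrable (𝓕 f) := by
  obtain rfl := eq_complexToReal (S := S)
  have h := (𝓕 (hc.toSchwartzMap hf)).integrable (μ := volume)
  rwa [SchwartzMap.fourier_coe] at h

theorem integral_fourier_eq_apply_zero [CompleteSpace S] (hf : ContDiff ℝ ∞ f)
    (hc : HasCompactSupport f) : ∫ w, 𝓕 f w = f 0 := by
  obtain rfl := eq_complexToReal (S := S)
  have h := congrFun (hf.continuous.fourierInv_fourier_eq
    (hf.continuous.integrable_of_hasCompactSupport hc)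
    (integrable_fourier_of_hasCompactSupport hf hc)) 0
  rw [Real.fourierInv_eq'] at h
  simpa using h

theorem integrable_map_fourier_iteratedFDeriv {G : Type*} [NormedAddCommGroup G] [NormedSpace ℝ G]
    (hf : ContDiff ℝ ∞ f) (hc : HasCompactSupport f) (k : ℕ)
    (B : ContinuousMultilinearMap ℝ (fun _ : Fin k => V) S →L[ℝ] G) :
    Integrable fun w => B (𝓕 (iteratedFDeriv ℝ k f) w) :=
  B.integrable_comp (integrable_fourier_of_hasCompactSupport
    (hf.iteratedFDeriv_right (by norm_cast)) (hc.iteratedFDeriv k))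

theorem integral_map_fourier_iteratedFDeriv [CompleteSpace S] {G : Type*} [NormedAddCommGroup G]
    [NormedSpace ℝ G] [CompleteSpace G] (hf : ContDiff ℝ ∞ f) (hc : HasCompactSupport f) (k : ℕ)
    (B : ContinuousMultilinearMap ℝ (fun _ : Fin k => V) S →L[ℝ] G) :
    ∫ w, B (𝓕 (iteratedFDeriv ℝ k f) w) = B (iteratedFDeriv ℝ k f 0) := by
  have hderiv : ContDiff ℝ ∞ (iteratedFDeriv ℝ k f) := hf.iteratedFDeriv_right (by norm_cast)
  rw [B.integral_comp_comm
      (integrable_fourier_of_hasCompactSupport hderiv (hc.iteratedFDeriv k)),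
    integral_fourier_eq_apply_zero hderiv (hc.iteratedFDeriv k)]

theorem fourier_iteratedFDeriv_apply (hf : ContDiff ℝ ∞ f) (hc : HasCompactSupport f) (k : ℕ)
    (w : V) (m : Fin k → V) :
    𝓕 (iteratedFDeriv ℝ k f) w m =
      (∏ i, inner ℝ w (m i)) • (2 * Real.pi * Complex.I) ^ k • 𝓕 f w := by
  obtain rfl := eq_complexToReal (S := S)
  have hint (n : ℕ) : Integrable (iteratedFDeriv ℝ n f) :=
    (hf.continuous_iteratedFDeriv (by exact_mod_cast le_top)).integrable_of_hasCompactSupport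
      (hc.iteratedFDeriv n)
  have hprod : ∏ i, (-innerSL ℝ : V →L[ℝ] V →L[ℝ] ℝ) w (m i) =
      (-1) ^ k * ∏ i, inner ℝ w (m i) := by
    simp [Finset.prod_neg]
  have hsign : (-1 : ℂ) ^ k * (-1) ^ k = 1 := by rw [← mul_pow]; simp
  rw [Real.fourier_iteratedFDeriv (N := ⊤) hf (fun n _ => hint n) le_top,
    VectorFourier.fourierPowSMulRight_apply, hprod, ← Complex.coe_smul, ← Complex.coe_smul,
    smul_smul, smul_smul, neg_pow]
  congr 1
  push_cast
  linear_combination (2 * Real.pi * Complex.I) ^ k * (∏ i, (inner ℝ w (m i) : ℂ)) * hsign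

theorem fourier_iteratedFDeriv_eq_smulRight (hf : ContDiff ℝ ∞ f) (hc : HasCompactSupport f)
    (k : ℕ) (w : V) :
    𝓕 (iteratedFDeriv ℝ k f) w =
      ((ContinuousMultilinearMap.mkPiAlgebra ℝ (Fin k) ℝ).compContinuousLinearMap
        fun _ => InnerProductSpace.toDual ℝ V w).smulRight
          ((2 * Real.pi * Complex.I) ^ k • 𝓕 f w) := by
  ext m
  rw [fourier_iteratedFDeriv_apply hf hc]
  rfl

end FourierAnalysis

section Inversion

open Set Filter Topology MeasureTheory FourierTransform

variable {H : Type*} [NormedAddCommGroup H] [NormedSpace ℝ H] [FiniteDimensional ℝ H]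
  {X : Type*} [TopologicalSpace X] [ChartedSpace H X] [IsManifold 𝓘(ℝ, H) ∞ X]
  [Bundle.RiemannianBundle (fun x : X => TangentSpace 𝓘(ℝ, H) x)] {lam mu : YoungDiagram}
  {χ : ℝ → ℝ} {ε : ℝ} {u : ∀ x : X, EFib H lam mu x} {x : X}

/-- The section `u` pulled back to `T_x X` by `exp_x`, with values in `E_x` by parallel transport
along the radial geodesics, and cut off: `ξ ↦ χ(|ξ| / ε) τ_x^E (u (exp_x ξ))`. -/
def cutoffTransport (χ : ℝ → ℝ) (ε : ℝ) (u : ∀ x : X, EFib H lam mu x) (x : X)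
    (ξ : TangentSpace 𝓘(ℝ, H) x) : EFib H lam mu x :=
  χ (‖ξ‖ / ε) • transport x ξ (u (expMap x ξ))

theorem fourierIntegrand_eq (χ : ℝ → ℝ) (ε : ℝ) (u : ∀ x : X, EFib H lam mu x) (x : X)
    (η : StrongDual ℝ (TangentSpace 𝓘(ℝ, H) x)) (ξ : TangentSpace 𝓘(ℝ, H) x) :
    fourierIntegrand χ ε u x η ξ =
      Complex.exp (-2 * Real.pi * Complex.I * (η ξ : ℝ)) • cutoffTransport χ ε u x ξ := by
  rw [fourierIntegrand, mul_smul, cutoffTransport]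
  exact congrArg _ (algebraMap_smul ℂ (χ (‖ξ‖ / ε)) (transport x ξ (u (expMap x ξ))))

theorem cutoffTransport_eq_zero (hχ0 : ∀ t, 2 ≤ t → χ t = 0) (hε : 0 < ε)
    {ξ : TangentSpace 𝓘(ℝ, H) x} (hξ : 2 * ε ≤ ‖ξ‖) : cutoffTransport χ ε u x ξ = 0 := by
  rw [cutoffTransport, hχ0 _ ((le_div_iff₀ hε).2 hξ), zero_smul]

theorem cutoffTransport_eq_transport (hχ1 : ∀ t ∈ Icc (0 : ℝ) 1, χ t = 1) (hε : 0 < ε)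
    {ξ : TangentSpace 𝓘(ℝ, H) x} (hξ : ‖ξ‖ ≤ ε) :
    cutoffTransport χ ε u x ξ = transport x ξ (u (expMap x ξ)) := by
  rw [cutoffTransport, hχ1 _ ⟨by positivity, (div_le_one hε).2 hξ⟩, one_smul]

theorem hasCompactSupport_cutoffTransport (hχ0 : ∀ t, 2 ≤ t → χ t = 0) (hε : 0 < ε) :
    HasCompactSupport (cutoffTransport χ ε u x) := by
  have : ProperSpace (TangentSpace 𝓘(ℝ, H) x) := FiniteDimensional.proper ℝ _
  refine HasCompactSupport.intro (isCompact_closedBall (0 : TangentSpace 𝓘(ℝ, H) x) (2 * ε))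
    fun ξ hξ => cutoffTransport_eq_zero hχ0 hε ?_
  rw [mem_closedBall_zero_iff, not_le] at hξ
  exact hξ.le

theorem injDomain_subset_expDomain (x : X) :
    injDomain x ⊆ (expDomain x : Set (TangentSpace 𝓘(ℝ, H) x)) := fun _ hξ =>
  (connectedComponentIn_subset _ _ hξ).1

theorem fourierTransform_eq_integral (hχ0 : ∀ t, 2 ≤ t → χ t = 0) (hε : 0 < ε)
    (hεD : {ξ : TangentSpace 𝓘(ℝ, H) x | ‖ξ‖ ≤ 2 * ε} ⊆ injDomain x)
    (η : StrongDual ℝ (TangentSpace 𝓘(ℝ, H) x)) :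
    fourierTransform χ ε u x η =
      ∫ ξ, Complex.exp (-2 * Real.pi * Complex.I * (η ξ : ℝ)) • cutoffTransport χ ε u x ξ := by
  rw [fourierTransform, setIntegral_eq_integral_of_forall_compl_eq_zero]
  · simp only [fourierIntegrand_eq]
  · intro ξ hξ
    rw [fourierIntegrand_eq, cutoffTransport_eq_zero hχ0 hε, smul_zero]
    exact (not_le.1 fun h => hξ (hεD h)).le

theorem fourierTransform_toDual (hχ0 : ∀ t, 2 ≤ t → χ t = 0) (hε : 0 < ε)
    (hεD : {ξ : TangentSpace 𝓘(ℝ, H) x | ‖ξ‖ ≤ 2 * ε} ⊆ injDomain x)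
    (w : TangentSpace 𝓘(ℝ, H) x) :
    fourierTransform χ ε u x (InnerProductSpace.toDual ℝ (TangentSpace 𝓘(ℝ, H) x) w) =
      𝓕 (cutoffTransport χ ε u x) w :=
  (fourierTransform_eq_integral hχ0 hε hεD _).trans (fourier_eq_integral_toDual _ w).symm

variable [T2Space X]
  [IsContMDiffRiemannianBundle 𝓘(ℝ, H) ∞ H (fun x : X => TangentSpace 𝓘(ℝ, H) x)]

theorem contDiff_cutoffTransport (hχ : ContDiffOn ℝ ∞ χ (Ici 0))
    (hχ1 : ∀ t ∈ Icc (0 : ℝ) 1, χ t = 1) (hχ0 : ∀ t, 2 ≤ t → χ t = 0) (hε : 0 < ε)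
    (hu : IsSmoothSection u) (hεD : {ξ : TangentSpace 𝓘(ℝ, H) x | ‖ξ‖ ≤ 2 * ε} ⊆ expDomain x) :
    ContDiff ℝ ∞ (cutoffTransport χ ε u x) := by
  refine contDiff_infty.2 fun n => contDiff_iff_contDiffAt.2 fun ξ₀ => ?_
  rcases le_or_gt ‖ξ₀‖ (2 * ε) with hξ₀ | hξ₀
  · obtain ⟨G, hG, hGeq⟩ := exists_contDiffAt_transport hu (hεD hξ₀) n
    let L : Schur lam mu H →L[ℝ] EFib H lam mu x :=
      schurMap (V := H) (W := TangentSpace 𝓘(ℝ, H) x) (fromModel x x) (toModel x x)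
    have hcutoff : ContDiffAt ℝ n (fun ξ : TangentSpace 𝓘(ℝ, H) x => χ (‖ξ‖ / ε)) ξ₀ :=
      ((contDiff_cutoff hχ hχ1 hε).of_le (by exact_mod_cast le_top)).contDiffAt
    have hLG : ContDiffAt ℝ n (fun ξ => L (G ξ)) ξ₀ := L.contDiff.contDiffAt.comp ξ₀ hG
    refine (hcutoff.smul hLG).congr_of_eventuallyEq ?_
    filter_upwards [hGeq] with ξ hξ
    rcases le_or_gt ‖ξ‖ (2 * ε) with hle | hlt
    · have htransport := schurMap_fromModel_toModel (mem_extChartAt_source (I := 𝓘(ℝ, H)) x)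
        (transport x ξ (u (expMap x ξ)))
      rw [hξ (hεD hle)] at htransport
      exact congrArg (χ (‖ξ‖ / ε) • ·) htransport.symm
    · rw [cutoffTransport_eq_zero hχ0 hε hlt.le]
      change 0 = χ (‖ξ‖ / ε) • L (G ξ)
      rw [hχ0 _ ((le_div_iff₀ hε).2 hlt.le), zero_smul]
  · refine (contDiffAt_const (c := (0 : EFib H lam mu x))).congr_of_eventuallyEq ?_
    filter_upwards [(isOpen_lt continuous_const continuous_norm).mem_nhds hξ₀] with ξ hξ
    exact cutoffTransport_eq_zero hχ0 hε (le_of_lt hξ)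

theorem iteratedFDeriv_cutoffTransport (hχ : ContDiffOn ℝ ∞ χ (Ici 0))
    (hχ1 : ∀ t ∈ Icc (0 : ℝ) 1, χ t = 1) (hχ0 : ∀ t, 2 ≤ t → χ t = 0) (hε : 0 < ε)
    (hu : IsSmoothSection u) (hεD : {ξ : TangentSpace 𝓘(ℝ, H) x | ‖ξ‖ ≤ 2 * ε} ⊆ expDomain x)
    {k : ℕ} (hk : k ≤ 2) (v : TangentSpace 𝓘(ℝ, H) x) :
    (iteratedFDeriv ℝ k (cutoffTransport χ ε u x) 0 fun _ => v) = nablaIter u k x fun _ => v := by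
  have hf : ContDiff ℝ k (cutoffTransport χ ε u x) :=
    (contDiff_cutoffTransport hχ hχ1 hχ0 hε hu hεD).of_le (by exact_mod_cast le_top)
  let L : EFib H lam mu x →L[ℝ] Schur lam mu H := eToModel lam mu x x
  obtain ⟨h, hh, hderiv⟩ := exists_radial_expansion hu x v
  have hradial : (fun t : ℝ => L (cutoffTransport χ ε u x (t • v))) =ᶠ[𝓝 0] h := by
    have hnorm : ∀ᶠ t : ℝ in 𝓝 0, ‖t • v‖ < ε :=
      (continuous_id.smul continuous_const).norm.continuousAt.eventually_lt continuousAt_const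
        (by simpa using hε)
    filter_upwards [hh, hnorm] with t ht hlt
    rw [cutoffTransport_eq_transport hχ1 hε hlt.le]
    exact ht (hεD (by change ‖t • v‖ ≤ 2 * ε; linarith))
  refine eToModel_injective (mem_extChartAt_source (I := 𝓘(ℝ, H)) x) ?_
  rw [← hderiv k hk, iteratedDeriv_eq_iteratedFDeriv, ← (hradial.iteratedFDeriv ℝ k).eq_of_nhds,
    ← iteratedDeriv_eq_iteratedFDeriv,
    iteratedDeriv_comp_smul_const (f := fun ξ => L (cutoffTransport χ ε u x ξ))
      (L.contDiff.comp hf), zero_smul]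
  exact congrArg (fun M => M fun _ => v)
    (L.iteratedFDeriv_comp_left hf.contDiffAt le_rfl).symm

theorem integrable_fourierIntegrand (hχ : ContDiffOn ℝ ∞ χ (Ici 0))
    (hχ1 : ∀ t ∈ Icc (0 : ℝ) 1, χ t = 1) (hχ0 : ∀ t, 2 ≤ t → χ t = 0) (hε : 0 < ε)
    (hu : IsSmoothSection u) (hεD : {ξ : TangentSpace 𝓘(ℝ, H) x | ‖ξ‖ ≤ 2 * ε} ⊆ expDomain x)
    (η : StrongDual ℝ (TangentSpace 𝓘(ℝ, H) x)) : Integrable (fourierIntegrand χ ε u x η) := by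
  have hf := (contDiff_cutoffTransport hχ hχ1 hχ0 hε hu hεD).continuous
  have hexp : Continuous fun ξ : TangentSpace 𝓘(ℝ, H) x =>
      Complex.exp (-2 * Real.pi * Complex.I * (η ξ : ℝ)) := by fun_prop
  rw [funext (fourierIntegrand_eq χ ε u x η)]
  exact (hexp.smul hf).integrable_of_hasCompactSupport
    ((hasCompactSupport_cutoffTransport hχ0 hε).smul_left)

variable {FF : Type*} [NormedAddCommGroup FF] [NormedSpace ℝ FF]
  {F : X → Type*} [TopologicalSpace (Bundle.TotalSpace FF F)] [∀ x, NormedAddCommGroup (F x)]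
  [∀ x, NormedSpace ℝ (F x)] [FiberBundle FF F] [VectorBundle ℝ FF F] {p : ℕ}

theorem DiffOp.symbol_fourierTransform_toDual (A : DiffOp H lam mu FF F p)
    (hχ : ContDiffOn ℝ ∞ χ (Ici 0)) (hχ1 : ∀ t ∈ Icc (0 : ℝ) 1, χ t = 1)
    (hχ0 : ∀ t, 2 ≤ t → χ t = 0) (hε : 0 < ε) (hu : IsSmoothSection u)
    (hεD : {ξ : TangentSpace 𝓘(ℝ, H) x | ‖ξ‖ ≤ 2 * ε} ⊆ injDomain x)
    (w : TangentSpace 𝓘(ℝ, H) x) :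
    A.symbol x (InnerProductSpace.toDual ℝ (TangentSpace 𝓘(ℝ, H) x) w)
        (fourierTransform χ ε u x (InnerProductSpace.toDual ℝ (TangentSpace 𝓘(ℝ, H) x) w)) =
      ∑ r : Fin (p + 1),
        A.coeff r x (𝓕 (iteratedFDeriv ℝ (p - r) (cutoffTransport χ ε u x)) w) := by
  have hf := contDiff_cutoffTransport hχ hχ1 hχ0 hε hu (hεD.trans (injDomain_subset_expDomain x))
  have hc : HasCompactSupport (cutoffTransport χ ε u x) := hasCompactSupport_cutoffTransport hχ0 hε
  rw [fourierTransform_toDual hχ0 hε hεD, DiffOp.symbol]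
  exact Finset.sum_congr rfl fun r _ =>
    congrArg (A.coeff r x) (fourier_iteratedFDeriv_eq_smulRight hf hc (p - r) w).symm

theorem DiffOp.coeff_iteratedFDeriv_cutoffTransport (A : DiffOp H lam mu FF F p) (hp : p ≤ 2)
    (hχ : ContDiffOn ℝ ∞ χ (Ici 0)) (hχ1 : ∀ t ∈ Icc (0 : ℝ) 1, χ t = 1)
    (hχ0 : ∀ t, 2 ≤ t → χ t = 0) (hε : 0 < ε) (hu : IsSmoothSection u)
    (hεD : {ξ : TangentSpace 𝓘(ℝ, H) x | ‖ξ‖ ≤ 2 * ε} ⊆ expDomain x) (r : Fin (p + 1)) :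
    A.coeff r x (iteratedFDeriv ℝ (p - r) (cutoffTransport χ ε u x) 0) =
      A.coeff r x (nablaIter u (p - r) x) :=
  map_eq_map_of_diagonal_eq (k := p - r) (A.coeff r x).toLinearMap (A.symm r x)
    (iteratedFDeriv_cutoffTransport hχ hχ1 hχ0 hε hu hεD (by omega))

theorem _root_.mainTheorem1_general (hp : p ≤ 2) (A : DiffOp H lam mu FF F p)
    (hu : IsSmoothSection u) (hχ : ContDiffOn ℝ ∞ χ (Ici 0))
    (hχ1 : ∀ t ∈ Icc (0 : ℝ) 1, χ t = 1) (hχ0 : ∀ t, 2 ≤ t → χ t = 0) [CompleteSpace (F x)]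
    (hε : 0 < ε) (hεD : {ξ : TangentSpace 𝓘(ℝ, H) x | ‖ξ‖ ≤ 2 * ε} ⊆ injDomain x) :
    (∀ η, IntegrableOn (fourierIntegrand χ ε u x η) (injDomain x)) ∧
      Integrable (fun η => A.symbol x η (fourierTransform χ ε u x η)) (dualVolume x) ∧
      A.apply u x = ∫ η, A.symbol x η (fourierTransform χ ε u x η) ∂(dualVolume x) := by
  have hεD' := hεD.trans (injDomain_subset_expDomain x)
  have hcomplete : CompleteSpace (EFib H lam mu x) := FiniteDimensional.complete ℝ _
  have hf := contDiff_cutoffTransport hχ hχ1 hχ0 hε hu hεD'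
  have hc : HasCompactSupport (cutoffTransport χ ε u x) := hasCompactSupport_cutoffTransport hχ0 hε
  have hemb : MeasurableEmbedding (InnerProductSpace.toDual ℝ (TangentSpace 𝓘(ℝ, H) x)) :=
    (InnerProductSpace.toDual ℝ _).toHomeomorph.measurableEmbedding
  have hsymbol := A.symbol_fourierTransform_toDual hχ hχ1 hχ0 hε hu hεD
  have hint (r : Fin (p + 1)) :=
    integrable_map_fourier_iteratedFDeriv hf hc (p - r) (A.coeff r x)
  refine ⟨fun η => (integrable_fourierIntegrand hχ hχ1 hχ0 hε hu hεD' η).integrableOn, ?_, ?_⟩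
  · rw [dualVolume, hemb.integrable_map_iff]
    exact (integrable_finsetSum _ fun r _ => hint r).congr
      (Eventually.of_forall fun w => (hsymbol w).symm)
  · rw [dualVolume, hemb.integral_map]
    simp only [hsymbol]
    rw [integral_finsetSum _ fun r _ => hint r]
    refine Finset.sum_congr rfl fun r _ => ?_
    exact (A.coeff_iteratedFDeriv_cutoffTransport hp hχ hχ1 hχ0 hε hu hεD' r).symm.trans
      (integral_map_fourier_iteratedFDeriv hf hc (p - r) (A.coeff r x)).symm

end Inversion

end Geometry

end FourierInversion

end

theorem mainTheorem1
    {H : Type*} [NormedAddCommGroup H] [NormedSpace ℝ H] [FiniteDimensional ℝ H]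
    {X : Type*} [TopologicalSpace X] [T2Space X] [ChartedSpace H X] [IsManifold 𝓘(ℝ, H) ∞ X]
    [Bundle.RiemannianBundle (fun x : X => TangentSpace 𝓘(ℝ, H) x)]
    [IsContMDiffRiemannianBundle 𝓘(ℝ, H) ∞ H (fun x : X => TangentSpace 𝓘(ℝ, H) x)]
    (lam mu : YoungDiagram)
    {FF : Type*} [NormedAddCommGroup FF] [NormedSpace ℂ FF] [FiniteDimensional ℂ FF]
    {F : X → Type*} [TopologicalSpace (Bundle.TotalSpace FF F)]
    [∀ x, NormedAddCommGroup (F x)] [∀ x, InnerProductSpace ℂ (F x)]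
    [FiberBundle FF F] [VectorBundle ℂ FF F] [VectorBundle ℝ FF F]
    [ContMDiffVectorBundle ∞ FF F 𝓘(ℝ, H)]
    (_hF : FourierInversion.IsSmoothHermitian H FF F)
    {p : ℕ} (hp : p ≤ 2) (A : FourierInversion.DiffOp H lam mu FF F p)
    (u : ∀ x : X, FourierInversion.EFib H lam mu x) (hu : FourierInversion.IsSmoothSection u)
    (χ : ℝ → ℝ) (hχ : ContDiffOn ℝ ∞ χ (Set.Ici 0)) (hχ01 : ∀ t, 0 ≤ t → χ t ∈ Set.Icc (0 : ℝ) 1)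
    (hχ1 : ∀ t ∈ Set.Icc (0 : ℝ) 1, χ t = 1) (hχ0 : ∀ t, 2 ≤ t → χ t = 0)
    (x : X) (ε : ℝ) (hε : 0 < ε)
    (hεD : {ξ : TangentSpace 𝓘(ℝ, H) x | ‖ξ‖ ≤ 2 * ε} ⊆ FourierInversion.injDomain x) :
    (∀ η, MeasureTheory.IntegrableOn (FourierInversion.fourierIntegrand χ ε u x η)
        (FourierInversion.injDomain x)) ∧
      MeasureTheory.Integrable
        (fun η => A.symbol x η (FourierInversion.fourierTransform χ ε u x η))
        (FourierInversion.dualVolume x) ∧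
      A.apply u x = ∫ η, A.symbol x η (FourierInversion.fourierTransform χ ε u x η)
        ∂(FourierInversion.dualVolume x) := by
  have hFF : FiniteDimensional ℝ FF := FiniteDimensional.complexToReal FF
  have hFx : FiniteDimensional ℝ (F x) :=
    ((trivializationAt FF F x).linearEquivAt ℝ x
      (FiberBundle.mem_baseSet_trivializationAt' x)).symm.finiteDimensional
  have hcomplete : CompleteSpace (F x) := FiniteDimensional.complete ℝ (F x)
  exact mainTheorem1_general hp A hu hχ hχ1 hχ0 hε hεD
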